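/- **Setting.** Let $N$ be a finite set of areas, $E\subseteq N\times N$ an oriented set of tie lines forming a connected graph, and let a connected undirected communication graph on $N$ have neighbourhoods $N_{cj}$ and Laplacian $L$. Let $M_j,D_j,\beta_j,B_{ij},k_\alpha,g>0$ and $\overline P^{in}_j\in\mathbb R$. For each $j$ let $s_j\ge 1$ and $q_j(t)=q_{j0}+\sum_{k=1}^{s_j}q_{jk}\sin(a_{jk}t+\phi_{jk})$ with $q_{jk}\ne0$ and distinct $a_{jk}>0$. Put $\bar s_j=2s_j+1$. For $\alpha\in\mathbb R^{s_j}$, $A_j(\alpha)$ is the $\bar s_j\times\bar s_j$ matrix with ones on the superdiagonal, last row $[0,\alpha_1,0,\alpha_2,\dots,0,\alpha_{s_j},0]$ and zeros elsewhere. The true parameter is $\alpha_{jk}=-e_{s_j-k+1}(a_{j1}^2,\dots,a_{js_j}^2)$, with $e_i$ the elementary symmetric polynomials. Let $R_j=[r_{j1},\dots,r_{j,2s_j},1]$ be such that all roots of $\tau^{2s_j}+r_{j,2s_j}\tau^{2s_j-1}+\dots+r_{j1}$ have negative real part. Put $\tilde A_j(\alpha)=R_j(I+A_j(\alpha))$,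 $G_j=[0,\dots,0,1,g]^T\in\mathbb R^{\bar s_j}$, and $\Lambda_j(\zeta)=[\zeta_2,\zeta_4,\dots,\zeta_{2s_j}]^T$. Let $O_j$ be the matrix with rows $\tilde A_j(\alpha_j)A_j(\alpha_j)^i$ $(0\le i\le 2s_j)$, and $\varphi_j=O_j^{-1}(q_j,\dot q_j,\dots,q_j^{(2s_j)})^T$. The state is $x=(\tilde\theta,\omega,\mu,\nu)$ with $\tilde\theta\in\mathbb R^E$, $\omega,\mu\in\mathbb R^N$ and $\nu_j=(\hat\eta_j,\tilde\zeta_j,\tilde\alpha_j)\in\mathbb R^{1+\bar s_j+s_j}$. Write $\zeta_j=\tilde\zeta_j+\varphi_j$, $\hat\alpha_j=\alpha_j+\tilde\alpha_j$ and $\rho_j=\tilde A_j(\alpha_j)\varphi_j-\tilde A_j(\hat\alpha_j)\zeta_j$. With control gains $d_j\in\mathbb R$ and disturbance $w$, the closed loop is $$\dot{\tilde\theta}_{ij}=\omega_i-\omega_j,\qquad \dot\mu_j=-\sum_{k\in N_{cj}}(\mu_j-\mu_k)+\omega_j/\beta_j,\qquad \dot\nu_j=\tilde\phi_j(t,\nu_j,\omega_j,w_j),$$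 $$M_j\dot\omega_j=\overline P^{in}_j+w_j+\rho_j+\sum_{i\to j}B_{ij}\tilde\theta_{ij}-\sum_{j\to k}B_{jk}\tilde\theta_{jk}-\mu_j/\beta_j-d_j\omega_j-D_j\omega_j,$$ where the three blocks of $\tilde\phi_j$ are $$-\hat\eta_j-M_j\omega_j-w_j,$$ $$(A_j(\hat\alpha_j)-A_j(\alpha_j))\zeta_j+(A_j(\alpha_j)-G_jR_j)\tilde\zeta_j-G_j(\hat\eta_j+M_j\omega_j),$$ $$-k_\alpha\Lambda_j(\zeta_j)(\hat\eta_j+M_j\omega_j+R_j\tilde\zeta_j).$$ An equilibrium $x^*$ is a point where the right-hand side with $w=0$ vanishes for all $t\ge0$. The disturbances satisfy $\int_0^T|w_j|^2\,dt<\infty$ for all $0<T<\infty$. Trajectories are absolutely continuous and satisfy the equations almost everywhere. **Lyapunov functions and constants.** Consider families of $C^1$ functions $U_j(t,\nu_j)$ such that, for $t\ge0$: - $\underline U_j(\nu_j)\le U_j(t,\nu_j)\le\overline U_j(\nu_j)$ for some continuous, positive definite, radially unbounded $\underline U_j,\overline U_j$; - $\partial_tU_j+\partial_{\nu_j}U_j\,\tilde\phi_j(t,\nu_j,0,0)\le-\|\nu_j\|^2$;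 - $\|\partial_{\nu_j}U_j\|\le b_{j0}(\|\nu_j\|+\|\nu_j\|^3)$ with $b_{j0}>0$. For $\tilde c>0$ call $\{\sum_jU_j(t,\nu_j)\le\tilde c\}$ *the region*. Let $\bar c$ bound every $\|\nu_j\|$ on the region, let $\bar\varphi\ge\|\varphi_j(t)\|$ for all $j$ and $t\ge0$, let $c_2\ge\|R_j\|\bar\varphi+\|R_j\|+\|R_jA_j(\alpha_j)\|$ for all $j$, and let $c_3>1$ satisfy, for all $j$, $$c_3\ge\max\{c_2(1+\bar c),\ b_{j0}(1+\bar c^2),\ M_j+\|G_j\|M_j+k_\alpha M_j(\bar c+\bar\varphi)\}.$$ Put $\kappa=\frac{2c_3^2+1}{4c_3^2}+\frac{2c_3^6-c_3^4}{2c_3^2-2}$. Assumption A1 is: $d_j>\max\{\frac{1+2c_3^6}{2}-D_j,\ \kappa+2c_3^2-D_j\}$ for all $j$. Define $\gamma$ by $$\frac1\gamma=\min_{j\in N}\frac1{2c_3^2}\,(D_j+d_j-\kappa).$$ For an equilibrium $x^*$ put $$V_1=\tfrac12\Big(\sum_{(i,j)\in E}B_{ij}(\tilde\theta_{ij}-\tilde\theta_{ij}^*)^2+\sum_jM_j(\omega_j-\omega_j^*)^2+\sum_j(\mu_j-\mu_j^*)^2\Big),\qquad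 V_2=\sum_jU_j(t,\nu_j),\qquad V=\frac{V_1}{c_3}+\frac{V_2}{c_3^2}.$$ **Theorem.** Functions $U_j$ as above exist. For every such family and every $\tilde c>0$, admissible constants $\bar c,\bar\varphi,c_2,c_3$ exist (they do not involve the gains $d_j$). For all such constants and all $d_j$ satisfying A1: 1. $0<\gamma<1$. 2. For every equilibrium $x^*$, every $t\ge0$, every state in the region and every value of $w\in\mathbb R^N$, the derivative of $V$ along the closed loop satisfies $$\dot V\le-\frac{1}{4c_3^2}\|\nu\|^2-\frac1{2c_3^2}(\mu-\mu^*)^TL(\mu-\mu^*)-\frac1{2c_3^2}\sum_j(D_j+d_j-\kappa)\omega_j^2+\|w\|^2,$$ and also $\dot V\le\|w\|^2-\frac1\gamma\|\omega\|^2$. 3. Let $x$ be a trajectory on $[0,T]$ that stays in the region. Then $$V(t_2,x(t_2))-V(t_1,x(t_1))\le\int_{t_1}^{t_2}\big(\|w\|^2-\tfrac1\gamma\|\omega\|^2\big)\,dt\qquad(0\le t_1\le t_2\le T),$$ $$\int_0^T\|\omega\|^2dt\le\gamma\int_0^T\|w\|^2dt+\gamma V(0,x(0)).$$ If moreover $x(0)=x^*$,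 then $\int_0^T\|\omega\|^2dt\le\gamma\int_0^T\|w\|^2dt$. 4. A trajectory on $[0,T]$ with $c_3^2\big(V(0,x(0))+\int_0^T\|w\|^2dt\big)<\tilde c$ stays in the region on $[0,T]$. -/

import Mathlib

open MeasureTheory Matrix

noncomputable section

namespace FreqControl

/-- Index set of the internal-model state `ν = (η̂, ζ̃, α̃)` of an area with `s` sinusoids:
`η̂` is a scalar, `ζ̃` has `2 s + 1` entries and `α̃` has `s` entries. -/
abbrev NuIdx (s : ℕ) : Type := Unit ⊕ (Fin (2 * s + 1) ⊕ Fin s)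

/-- The space of `ν = (η̂, ζ̃, α̃)`, with the Euclidean norm. -/
abbrev Nu (s : ℕ) : Type := EuclideanSpace ℝ (NuIdx s)

/-- The component `η̂` of `ν`. -/
def etaOf {s : ℕ} (ν : Nu s) : ℝ := ν (Sum.inl ())

/-- The component `ζ̃` of `ν`. -/
def zetaOf {s : ℕ} (ν : Nu s) : Fin (2 * s + 1) → ℝ := fun i => ν (Sum.inr (Sum.inl i))

/-- The component `α̃` of `ν`. -/
def alphaOf {s : ℕ} (ν : Nu s) : Fin s → ℝ := fun k => ν (Sum.inr (Sum.inr k))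

/-- Assemble `ν = (η̂, ζ̃, α̃)`. -/
def mkNu {s : ℕ} (η : ℝ) (ζ : Fin (2 * s + 1) → ℝ) (α : Fin s → ℝ) : Nu s :=
  WithLp.toLp 2 (Sum.elim (fun _ => η) (Sum.elim ζ α))

/-- Euclidean norm of a plain vector. -/
def vecNorm {ι : Type*} [Fintype ι] (v : ι → ℝ) : ℝ := ‖WithLp.toLp 2 v‖

/-- The matrix `A(α)`: ones on the superdiagonal, last row `[0, α₁, 0, α₂, 0, …, α_s, 0]`. -/
def matA {s : ℕ} (α : Fin s → ℝ) : Matrix (Fin (2 * s + 1)) (Fin (2 * s + 1)) ℝ :=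
  Matrix.of fun i j =>
    if (i : ℕ) < 2 * s then (if (j : ℕ) = (i : ℕ) + 1 then 1 else 0)
    else ∑ k : Fin s, if (j : ℕ) = 2 * (k : ℕ) + 1 then α k else 0

/-- The row vector `R = [r₁, …, r_{2s}, 1]`. -/
def rowR {s : ℕ} (r : Fin (2 * s) → ℝ) : Fin (2 * s + 1) → ℝ := Fin.snoc r 1

/-- The row vector `Ã(α) = R (I + A(α))`. -/
def rowAt {s : ℕ} (r : Fin (2 * s) → ℝ) (α : Fin s → ℝ) : Fin (2 * s + 1) → ℝ :=
  rowR r ᵥ* (1 + matA α)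

/-- The matrix `O(α)` with rows `Ã(α), Ã(α) A(α), …, Ã(α) A(α)^{2s}`. -/
def matO {s : ℕ} (r : Fin (2 * s) → ℝ) (α : Fin s → ℝ) :
    Matrix (Fin (2 * s + 1)) (Fin (2 * s + 1)) ℝ :=
  Matrix.of fun i => rowAt r α ᵥ* (matA α) ^ (i : ℕ)

/-- The column vector `G = [0, …, 0, 1, g]ᵀ`. -/
def colG (s : ℕ) (g : ℝ) : Fin (2 * s + 1) → ℝ := fun i =>
  if (i : ℕ) = 2 * s then g else if (i : ℕ) + 1 = 2 * s then 1 else 0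

/-- The vector `Λ(ζ) = [ζ₂, ζ₄, …, ζ_{2s}]ᵀ` (one-based indices). -/
def vecLam {s : ℕ} (ζ : Fin (2 * s + 1) → ℝ) : Fin s → ℝ := fun k =>
  ζ ⟨2 * (k : ℕ) + 1, by have := k.isLt; omega⟩

/-- The coefficients `α` determined by the frequencies `a`:
`α_k = - e_{s-k+1}(a₁², …, a_s²)` (one-based `k`), with `e` the elementary symmetric polynomials. -/
def alphaCoef {s : ℕ} (a : Fin s → ℝ) : Fin s → ℝ := fun k =>
  -∑ T ∈ Finset.powersetCard (s - (k : ℕ)) (Finset.univ : Finset (Fin s)), ∏ l ∈ T, a l ^ 2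

/-- The plant, the power imbalance and the controller, except for the gains `d_j`. -/
structure Model (V : Type*) [Fintype V] where
  /-- tie lines, each with an arbitrary orientation -/
  lines : Finset (V × V)
  lines_irrefl : ∀ i, (i, i) ∉ lines
  lines_oriented : ∀ i j, (i, j) ∈ lines → (j, i) ∉ lines
  lines_connected : (SimpleGraph.fromRel fun i j => (i, j) ∈ lines).Connected
  /-- communication graph -/
  comm : SimpleGraph V
  comm_connected : comm.Connected
  /-- inertia -/
  M : V → ℝ
  M_pos : ∀ j, 0 < M j
  /-- damping -/
  D : V → ℝ
  D_pos : ∀ j, 0 < D j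
  /-- line parameters -/
  B : V × V → ℝ
  B_pos : ∀ e ∈ lines, 0 < B e
  /-- cost coefficients of the controllable loads -/
  β : V → ℝ
  β_pos : ∀ j, 0 < β j
  /-- known constant part of the power injection -/
  Pbar : V → ℝ
  /-- number of sinusoids in the power variation -/
  s : V → ℕ
  s_pos : ∀ j, 1 ≤ s j
  /-- offset error -/
  q0 : V → ℝ
  /-- amplitudes -/
  amp : ∀ j, Fin (s j) → ℝ
  amp_ne : ∀ j k, amp j k ≠ 0
  /-- frequencies -/
  freq : ∀ j, Fin (s j) → ℝ
  freq_pos : ∀ j k, 0 < freq j k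
  freq_inj : ∀ j, Function.Injective (freq j)
  /-- initial phases -/
  phase : ∀ j, Fin (s j) → ℝ
  /-- controller coefficients; the polynomial they define is Hurwitz -/
  r : ∀ j, Fin (2 * s j) → ℝ
  r_hurwitz : ∀ j (z : ℂ), z ^ (2 * s j) + ∑ i, (r j i : ℂ) * z ^ (i : ℕ) = 0 → z.re < 0
  /-- last entry of the vectors `G_j` -/
  g : ℝ
  g_pos : 0 < g
  /-- adaptation gain -/
  kα : ℝ
  kα_pos : 0 < kα

namespace Model

variable {V : Type*} [Fintype V] (S : Model V)

/-- The low-frequency power variation `q_j(t)`. -/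
def q (j : V) (t : ℝ) : ℝ :=
  S.q0 j + ∑ k, S.amp j k * Real.sin (S.freq j k * t + S.phase j k)

/-- The true parameter `α_j`. -/
def α (j : V) : Fin (S.s j) → ℝ := alphaCoef (S.freq j)

/-- `λ_j = (q_j, q_j', …, q_j^{(2 s_j)})`. -/
def lam (j : V) (t : ℝ) : Fin (2 * S.s j + 1) → ℝ := fun i => iteratedDeriv (i : ℕ) (S.q j) t

/-- `φ_j = O_j(α_j)⁻¹ λ_j`, the exosystem state. -/
def phi (j : V) (t : ℝ) : Fin (2 * S.s j + 1) → ℝ := (matO (S.r j) (S.α j))⁻¹ *ᵥ S.lam j t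

/-- `ρ_j = Ã(α_j) φ_j - Ã(α̂_j) ζ_j`, where `α̂ = α + α̃` and `ζ = ζ̃ + φ`. -/
def rho (j : V) (t : ℝ) (ν : Nu (S.s j)) : ℝ :=
  rowAt (S.r j) (S.α j) ⬝ᵥ S.phi j t
    - rowAt (S.r j) (alphaOf ν + S.α j) ⬝ᵥ (zetaOf ν + S.phi j t)

/-- Right-hand side of the `ν_j` equation, with frequency deviation `ω` and disturbance `w`. -/
def nuField (j : V) (t : ℝ) (ν : Nu (S.s j)) (ω w : ℝ) : Nu (S.s j) :=
  let ζ := zetaOf ν + S.phi j t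
  let u := etaOf ν + S.M j * ω
  mkNu (-etaOf ν - S.M j * ω - w)
    ((matA (alphaOf ν + S.α j) - matA (S.α j)) *ᵥ ζ
      + (matA (S.α j) - Matrix.vecMulVec (colG (S.s j) S.g) (rowR (S.r j))) *ᵥ zetaOf ν
      - u • colG (S.s j) S.g)
    ((-(S.kα * (u + rowR (S.r j) ⬝ᵥ zetaOf ν))) • vecLam ζ)

/-- The closed-loop state `x = (θ̃, ω, μ, ν)`; `θ̃` is indexed by the lines. -/
abbrev State : Type _ :=
  ({e : V × V // e ∈ S.lines} → ℝ) × (V → ℝ) × (V → ℝ) × (∀ j, Nu (S.s j))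

open scoped Classical in
/-- Power flowing into area `j`: `∑_{i → j} B_ij θ̃_ij - ∑_{j → k} B_jk θ̃_jk`. -/
def inflow (θ : {e : V × V // e ∈ S.lines} → ℝ) (j : V) : ℝ :=
  (∑ e, if e.1.2 = j then S.B e.1 * θ e else 0) - ∑ e, if e.1.1 = j then S.B e.1 * θ e else 0

open scoped Classical in
/-- Right-hand side of the closed-loop system at time `t`, state `x` and disturbance `w`. -/
def field (d : V → ℝ) (t : ℝ) (x : S.State) (w : V → ℝ) : S.State :=
  match x with
  | (θ, ω, μ, ν) =>
    (fun e => ω e.1.1 - ω e.1.2,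
     fun j => (S.M j)⁻¹ * (S.Pbar j + w j + S.rho j t (ν j) + S.inflow θ j
        - μ j / S.β j - d j * ω j - S.D j * ω j),
     fun j => -(∑ k ∈ S.comm.neighborFinset j, (μ j - μ k)) + ω j / S.β j,
     fun j => S.nuField j t (ν j) (ω j) (w j))

/-- An equilibrium of the undisturbed closed-loop system: its right-hand side vanishes there at
all times. -/
def IsEquilibrium (d : V → ℝ) (x : S.State) : Prop := ∀ t, 0 ≤ t → S.field d t x 0 = 0

/-- A (Carathéodory) trajectory on `[0, T]` under the disturbance `w`. -/
def IsTrajectory (d : V → ℝ) (w : V → ℝ → ℝ) (T : ℝ) (x : ℝ → S.State) : Prop :=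
  AbsolutelyContinuousOnInterval x 0 T ∧
    ∀ᵐ t ∂(volume.restrict (Set.Icc 0 T)), HasDerivAt x (S.field d t (x t) fun j => w j t) t

/-- Continuous, positive definite and radially unbounded. -/
def IsPosDefRadUnbdd {E : Type*} [NormedAddCommGroup E] (f : E → ℝ) : Prop :=
  Continuous f ∧ f 0 = 0 ∧ (∀ v, v ≠ 0 → 0 < f v) ∧
    ∀ K : ℝ, ∃ ϱ : ℝ, ∀ v, ϱ ≤ ‖v‖ → K ≤ f v

/-- `U_j` are strict Lyapunov functions of the undisturbed `ν_j` subsystems at `ω_j = 0`,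
with constants `b_j` in the gradient bound. -/
def IsLyapunov (U : ∀ j, ℝ → Nu (S.s j) → ℝ) (b : V → ℝ) : Prop :=
  ∀ j, 0 < b j ∧ ContDiff ℝ 1 (fun p : ℝ × Nu (S.s j) => U j p.1 p.2) ∧
    (∃ Ulow Uup : Nu (S.s j) → ℝ, IsPosDefRadUnbdd Ulow ∧ IsPosDefRadUnbdd Uup ∧
      ∀ t, 0 ≤ t → ∀ ν, Ulow ν ≤ U j t ν ∧ U j t ν ≤ Uup ν) ∧
    (∀ t, 0 ≤ t → ∀ ν, deriv (fun τ => U j τ ν) t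
      + fderiv ℝ (fun v => U j t v) ν (S.nuField j t ν 0 0) ≤ -‖ν‖ ^ 2) ∧
    (∀ t, 0 ≤ t → ∀ ν, ‖fderiv ℝ (fun v => U j t v) ν‖ ≤ b j * (‖ν‖ + ‖ν‖ ^ 3))

/-- `V₁(x) = ½ (x₁ - x₁*)ᵀ diag(B, M, I) (x₁ - x₁*)`, where `x₁ = (θ̃, ω, μ)`. -/
def V1 (xs x : S.State) : ℝ :=
  (1 / 2) * ((∑ e : {e : V × V // e ∈ S.lines}, S.B e.1 * (x.1 e - xs.1 e) ^ 2)
    + (∑ j, S.M j * (x.2.1 j - xs.2.1 j) ^ 2) + ∑ j, (x.2.2.1 j - xs.2.2.1 j) ^ 2)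

/-- `V₂(t, ν) = ∑_j U_j(t, ν_j)`. -/
def V2 (U : ∀ j, ℝ → Nu (S.s j) → ℝ) (t : ℝ) (ν : ∀ j, Nu (S.s j)) : ℝ := ∑ j, U j t (ν j)

/-- The storage function `V₁ / c₃ + V₂ / c₃²`. -/
def storage (U : ∀ j, ℝ → Nu (S.s j) → ℝ) (c3 : ℝ) (xs : S.State) (t : ℝ) (x : S.State) : ℝ :=
  S.V1 xs x / c3 + S.V2 U t x.2.2.2 / c3 ^ 2

/-- Derivative of `W` along the closed-loop system, at `(t, x)` with disturbance value `w`. -/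
def derivAlong (d : V → ℝ) (W : ℝ → S.State → ℝ) (t : ℝ) (x : S.State) (w : V → ℝ) : ℝ :=
  deriv (fun τ => W τ x) t + fderiv ℝ (fun y => W t y) x (S.field d t x w)

/-- The constants: `ctil` is the level of the region `{ν | ∑_j U_j(t, ν_j) ≤ ctil}`, `cbar` bounds
`‖ν_j‖` on this region, `phibar` bounds the exosystem states, and `c2`, `c3` are large enough in
terms of these and of the parameters. -/
structure Constants (U : ∀ j, ℝ → Nu (S.s j) → ℝ) (b : V → ℝ)
    (ctil cbar phibar c2 c3 : ℝ) : Prop where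
  region : ∀ t, 0 ≤ t → ∀ ν : ∀ j, Nu (S.s j), S.V2 U t ν ≤ ctil → ∀ j, ‖ν j‖ ≤ cbar
  phi_le : ∀ j t, 0 ≤ t → vecNorm (S.phi j t) ≤ phibar
  c2_ge : ∀ j, vecNorm (rowR (S.r j)) * phibar + vecNorm (rowR (S.r j))
    + vecNorm (rowR (S.r j) ᵥ* matA (S.α j)) ≤ c2
  c3_gt_one : 1 < c3
  c3_ge_c2 : c2 * (1 + cbar) ≤ c3
  c3_ge_b : ∀ j, b j * (1 + cbar ^ 2) ≤ c3
  c3_ge_M : ∀ j, S.M j + vecNorm (colG (S.s j) S.g) * S.M j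
    + S.kα * S.M j * (cbar + phibar) ≤ c3

/-- `(2 c₃² + 1) / (4 c₃²) + (2 c₃⁶ - c₃⁴) / (2 c₃² - 2)`. -/
def kappa (c3 : ℝ) : ℝ :=
  (2 * c3 ^ 2 + 1) / (4 * c3 ^ 2) + (2 * c3 ^ 6 - c3 ^ 4) / (2 * c3 ^ 2 - 2)

/-- Assumption on the gains `d_j`. -/
def GainAssumption (d : V → ℝ) (c3 : ℝ) : Prop :=
  ∀ j, max ((1 + 2 * c3 ^ 6) / 2 - S.D j) (kappa c3 + 2 * c3 ^ 2 - S.D j) < d j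

/-- `γ`, with `1 / γ = min_j (D_j + d_j - kappa c₃) / (2 c₃²)`. -/
def gain (d : V → ℝ) (c3 : ℝ) : ℝ :=
  (⨅ j, 1 / (2 * c3 ^ 2) * (S.D j + d j - kappa c3))⁻¹

end Model

end FreqControl

end

noncomputable section

/-! ### Calculus along absolutely continuous curves. -/

namespace FreqControl

/-! Existence of `U_j`. At zero frequency and disturbance, the internal-model error is described by
the filtered error u = η̂ + Rζ̃, the vector z of all entries of ζ̃ but the last, η̂ and α̃. Here η̂
decays, z is a companion system of the Hurwitz polynomial driven by η̂, and u' = -g u + α̃·Λ(ζ) +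
(terms linear in z and η̂). The adaptation law makes the cross term α̃·Λ(ζ) u cancel in u²/2 +
|α̃|²/(2kα). Adding quadratic forms in z and η̂ gives a weak Lyapunov function W₀ that decays in all
coordinates but α̃ (`exists_weak_lyapunov`).

Decay in α̃ comes from persistent excitation. The regressor Λ(φ) is a combination of cosines with
distinct frequencies, with an invertible, Vandermonde-type coefficient matrix W
(`exists_vecLam_phi_eq`). The term -u α̃·Λ(φ) contributes -(α̃·Λ(φ))² to the derivative. A bounded
oscillating quadratic form in α̃ replaces this square by its mean, -½|Wα̃|²
(`exists_auxiliary_lyapunov`). The remaining errors carry a factor 1 + ‖ν‖², so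
`exists_strict_lyapunov` combines W₁ with W₀ + W₀², which produces the cubic growth of the gradient.

Constants. The exosystem state must be bounded. The matrix O is a polynomial in A whose roots lie
strictly to the left of the imaginary axis, whereas the characteristic roots of A lie on that axis.
Bézout makes O invertible, and φ is an explicit trigonometric sum (`isUnit_matO`, `phi_eq`).

Dissipation. At an equilibrium ω = 0, ν = 0 and Lμ = 0. In the derivative of V₁ the exchanges
between θ̃, ω and μ cancel, leaving damping, the Laplacian form and ω(w + ρ). On the region ρ, the
gradient of U and the perturbation of the ν field have linear bounds in terms of c₃, so each area
reduces to a quadratic form in ‖ν_j‖, |ω_j|, |w_j|, settled by completing squares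
(`dissipation_form_le`).

Trajectories. The storage is absolutely continuous along a trajectory, so the pointwise inequality
integrates. Invariance of the region follows from a first-exit argument, and the gain bound from
nonnegativity of the final storage. -/

/-- Chain rule for a function of time and state along a curve. -/
theorem hasDerivAt_along {E : Type*} [NormedAddCommGroup E] [NormedSpace ℝ E] {W : ℝ → E → ℝ}
    {c : ℝ → ℝ} {γ : ℝ → E} {s : ℝ} {f : E}
    (hW : DifferentiableAt ℝ (fun p : ℝ × E => W p.1 p.2) (c s, γ s))
    (hc : HasDerivAt c 1 s) (hγ : HasDerivAt γ f s) :
    HasDerivAt (fun h => W (c h) (γ h))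
      (deriv (fun τ => W τ (γ s)) (c s) + fderiv ℝ (fun y => W (c s) y) (γ s) f) s := by
  have h1 := hW.hasFDerivAt.comp_hasDerivAt s (hc.prodMk hγ)
  have h2 : HasDerivAt (fun τ => W τ (γ s))
      (fderiv ℝ (fun p : ℝ × E => W p.1 p.2) (c s, γ s) (1, 0)) (c s) :=
    HasFDerivAt.comp_hasDerivAt (c s) (f := fun τ => (τ, γ s))
      (l := fun p : ℝ × E => W p.1 p.2) hW.hasFDerivAt
      ((hasDerivAt_id (c s)).prodMk (hasDerivAt_const (c s) (γ s)))
  have h3 : HasFDerivAt (fun y => W (c s) y)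
      ((fderiv ℝ (fun p : ℝ × E => W p.1 p.2) (c s, γ s)).comp
        ((0 : E →L[ℝ] ℝ).prod (ContinuousLinearMap.id ℝ E))) (γ s) :=
    HasFDerivAt.comp (γ s) (f := fun y : E => (c s, y))
      (g := fun p : ℝ × E => W p.1 p.2) hW.hasFDerivAt
      ((hasFDerivAt_const (c s) (γ s)).prodMk (hasFDerivAt_id (γ s)))
  rw [h2.deriv, h3.fderiv]
  refine h1.congr_deriv ?_
  symm
  change _ + fderiv ℝ (fun p : ℝ × E => W p.1 p.2) (c s, γ s) (0, f) = _
  rw [← map_add]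
  simp

/-- The derivative along a vector field, as a derivative along the straight line. -/
theorem hasDerivAt_line {E : Type*} [NormedAddCommGroup E] [NormedSpace ℝ E] {W : ℝ → E → ℝ}
    {t : ℝ} {x : E} (f : E) (hW : DifferentiableAt ℝ (fun p : ℝ × E => W p.1 p.2) (t, x)) :
    HasDerivAt (fun h : ℝ => W (t + h) (x + h • f))
      (deriv (fun τ => W τ x) t + fderiv ℝ (fun y => W t y) x f) 0 := by
  have h1 : HasDerivAt (fun h : ℝ => t + h) 1 0 := (hasDerivAt_id 0).const_add t
  have h2 : HasDerivAt (fun h : ℝ => x + h • f) f 0 := by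
    simpa using ((hasDerivAt_id (0 : ℝ)).smul_const f).const_add x
  have := hasDerivAt_along (W := W) (c := fun h => t + h) (γ := fun h => x + h • f) (s := 0)
    (by simpa using hW) h1 h2
  simpa using this

/-- A Lipschitz function of an absolutely continuous curve is absolutely continuous. -/
theorem _root_.LipschitzOnWith.comp_absolutelyContinuousOnInterval {X Y : Type*}
    [PseudoMetricSpace X] [PseudoMetricSpace Y] {F : X → Y} {K : NNReal} {s : Set X} {f : ℝ → X}
    {a b : ℝ}
    (hF : LipschitzOnWith K F s) (hf : AbsolutelyContinuousOnInterval f a b)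
    (hs : ∀ t ∈ Set.uIcc a b, f t ∈ s) : AbsolutelyContinuousOnInterval (fun t => F (f t)) a b := by
  rw [absolutelyContinuousOnInterval_iff] at hf ⊢
  intro ε hε
  -- The denominator is K + 1 because K may vanish.
  obtain ⟨δ, hδ, h⟩ := hf (ε / (K + 1)) (by positivity)
  refine ⟨δ, hδ, fun E hE hlt => ?_⟩
  have h1 := h E hE hlt
  have h2 : ∑ i ∈ Finset.range E.1, dist (F (f (E.2 i).1)) (F (f (E.2 i).2)) ≤
      K * ∑ i ∈ Finset.range E.1, dist (f (E.2 i).1) (f (E.2 i).2) := by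
    rw [Finset.mul_sum]
    refine Finset.sum_le_sum fun i hi => ?_
    have := hE.1 i hi
    exact hF.dist_le_mul _ (hs _ this.1) _ (hs _ this.2)
  have h0 : 0 ≤ ∑ i ∈ Finset.range E.1, dist (f (E.2 i).1) (f (E.2 i).2) :=
    Finset.sum_nonneg fun _ _ => dist_nonneg
  have hK : (0 : ℝ) ≤ K := K.2
  rw [lt_div_iff₀ (by positivity)] at h1
  nlinarith

/-- The graph of an absolutely continuous curve is absolutely continuous. -/
theorem _root_.AbsolutelyContinuousOnInterval.graph {X : Type*} [PseudoMetricSpace X]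
    {x : ℝ → X} {a b : ℝ} (hx : AbsolutelyContinuousOnInterval x a b) :
    AbsolutelyContinuousOnInterval (fun t => (t, x t)) a b := by
  rw [absolutelyContinuousOnInterval_iff] at hx ⊢
  intro ε hε
  obtain ⟨δ, hδ, h⟩ := hx (ε / 2) (by positivity)
  refine ⟨min δ (ε / 2), by positivity, fun E hE hlt => ?_⟩
  have h1 := h E hE (hlt.trans_le (min_le_left _ _))
  have h2 := hlt.trans_le (min_le_right _ _)
  calc ∑ i ∈ Finset.range E.1, dist ((E.2 i).1, x (E.2 i).1) ((E.2 i).2, x (E.2 i).2)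
      ≤ ∑ i ∈ Finset.range E.1, (dist (E.2 i).1 (E.2 i).2 + dist (x (E.2 i).1) (x (E.2 i).2)) :=
        Finset.sum_le_sum fun i _ => by
          rw [Prod.dist_eq]; exact max_le_add_of_nonneg dist_nonneg dist_nonneg
    _ < ε := by rw [Finset.sum_add_distrib]; linarith

/-- A `C¹` function is Lipschitz on balls. -/
theorem _root_.ContDiff.exists_lipschitzOnWith_closedBall {E : Type*} [NormedAddCommGroup E]
    [NormedSpace ℝ E] [ProperSpace E] {F : E → ℝ} (hF : ContDiff ℝ 1 F) (C : ℝ) :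
    ∃ K, LipschitzOnWith K F (Metric.closedBall 0 C) := by
  obtain ⟨D, hD⟩ := (isCompact_closedBall (0 : E) C).exists_bound_of_continuousOn
    (hF.continuous_fderiv one_ne_zero).continuousOn
  refine ⟨D.toNNReal, (convex_closedBall (0 : E) C).lipschitzOnWith_of_nnnorm_fderiv_le
    (𝕜 := ℝ) (fun p _ => (hF.differentiable one_ne_zero) p) fun p hp => ?_⟩
  rw [← NNReal.coe_le_coe, coe_nnnorm]
  exact (hD p hp).trans (Real.le_coe_toNNReal D)

/-- A `C¹` function of time and state along an absolutely continuous curve is absolutely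
continuous. -/
theorem absolutelyContinuousOnInterval_along {E : Type*} [NormedAddCommGroup E] [NormedSpace ℝ E]
    [ProperSpace E] {W : ℝ → E → ℝ} (hW : ContDiff ℝ 1 (fun p : ℝ × E => W p.1 p.2))
    {x : ℝ → E} {a b : ℝ} (hx : AbsolutelyContinuousOnInterval x a b) :
    AbsolutelyContinuousOnInterval (fun t => W t (x t)) a b := by
  have hp := hx.graph
  obtain ⟨C, hC⟩ := isCompact_uIcc.exists_bound_of_continuousOn hp.continuousOn
  obtain ⟨K, hK⟩ := hW.exists_lipschitzOnWith_closedBall C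
  have h := LipschitzOnWith.comp_absolutelyContinuousOnInterval (f := fun t => (t, x t)) hK hp
    fun t ht => mem_closedBall_zero_iff.mpr (hC t ht)
  exact h

/-! ### Euclidean norms and the structure of A(α) and Λ. -/

theorem vecNorm_sq {ι : Type*} [Fintype ι] (v : ι → ℝ) : vecNorm v ^ 2 = ∑ i, v i ^ 2 := by
  simp [vecNorm, EuclideanSpace.norm_sq_eq]

theorem dotProduct_self_eq_vecNorm_sq {ι : Type*} [Fintype ι] (v : ι → ℝ) :
    v ⬝ᵥ v = vecNorm v ^ 2 := by
  rw [vecNorm_sq]; exact Finset.sum_congr rfl fun i _ => (sq (v i)).symm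

theorem vecNorm_nonneg {ι : Type*} [Fintype ι] (v : ι → ℝ) : 0 ≤ vecNorm v := norm_nonneg _

theorem abs_le_vecNorm {ι : Type*} [Fintype ι] (v : ι → ℝ) (i : ι) : |v i| ≤ vecNorm v := by
  rw [← abs_of_nonneg (vecNorm_nonneg v), ← sq_le_sq, vecNorm_sq]
  exact Finset.single_le_sum (f := fun i => v i ^ 2) (fun _ _ => sq_nonneg _) (Finset.mem_univ i)

theorem vecNorm_comp_le {ι κ : Type*} [Fintype ι] [Fintype κ] (v : ι → ℝ) {e : κ → ι}
    (he : Function.Injective e) : vecNorm (v ∘ e) ≤ vecNorm v := by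
  refine (abs_le_of_sq_le_sq' ?_ (vecNorm_nonneg _)).2
  rw [vecNorm_sq, vecNorm_sq]
  calc ∑ k, (v ∘ e) k ^ 2 = ∑ i ∈ Finset.univ.map ⟨e, he⟩, v i ^ 2 := by
        rw [Finset.sum_map]; rfl
    _ ≤ ∑ i, v i ^ 2 := Finset.sum_le_sum_of_subset_of_nonneg (Finset.subset_univ _)
        fun _ _ _ => sq_nonneg _

theorem abs_dotProduct_le_vecNorm {ι : Type*} [Fintype ι] (v w : ι → ℝ) :
    |v ⬝ᵥ w| ≤ vecNorm v * vecNorm w := by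
  have := abs_real_inner_le_norm (WithLp.toLp 2 w : EuclideanSpace ℝ ι) (WithLp.toLp 2 v)
  rw [mul_comm]
  simpa [vecNorm, EuclideanSpace.inner_eq_star_dotProduct] using this

theorem vecNorm_add_le {ι : Type*} [Fintype ι] (v w : ι → ℝ) :
    vecNorm (v + w) ≤ vecNorm v + vecNorm w := by
  simpa [vecNorm] using norm_add_le (WithLp.toLp 2 v : EuclideanSpace ℝ ι) (WithLp.toLp 2 w)

theorem vecNorm_smul {ι : Type*} [Fintype ι] (c : ℝ) (v : ι → ℝ) :
    vecNorm (c • v) = |c| * vecNorm v := by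
  simpa [vecNorm] using norm_smul c (WithLp.toLp 2 v : EuclideanSpace ℝ ι)

section Nu

variable {s : ℕ}

theorem norm_sq_nu (ν : Nu s) :
    ‖ν‖ ^ 2 = etaOf ν ^ 2 + vecNorm (zetaOf ν) ^ 2 + vecNorm (alphaOf ν) ^ 2 := by
  simp [EuclideanSpace.norm_sq_eq, vecNorm_sq, etaOf, zetaOf, alphaOf, add_assoc]

theorem vecNorm_zetaOf_le (ν : Nu s) : vecNorm (zetaOf ν) ≤ ‖ν‖ :=
  (abs_le_of_sq_le_sq' (by
    rw [norm_sq_nu]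
    nlinarith [sq_nonneg (etaOf ν), sq_nonneg (vecNorm (alphaOf ν))]) (norm_nonneg _)).2

theorem vecNorm_alphaOf_le (ν : Nu s) : vecNorm (alphaOf ν) ≤ ‖ν‖ :=
  (abs_le_of_sq_le_sq' (by
    rw [norm_sq_nu]
    nlinarith [sq_nonneg (etaOf ν), sq_nonneg (vecNorm (zetaOf ν))]) (norm_nonneg _)).2

theorem norm_mkNu_le (η : ℝ) (ζ : Fin (2 * s + 1) → ℝ) (α : Fin s → ℝ) :
    ‖mkNu η ζ α‖ ≤ |η| + vecNorm ζ + vecNorm α := by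
  refine (abs_le_of_sq_le_sq' ?_
    (by have := vecNorm_nonneg ζ; have := vecNorm_nonneg α; positivity)).2
  have h : ‖mkNu η ζ α‖ ^ 2 = η ^ 2 + vecNorm ζ ^ 2 + vecNorm α ^ 2 := norm_sq_nu _
  rw [h, ← sq_abs η]
  have := vecNorm_nonneg ζ; have := vecNorm_nonneg α; have := abs_nonneg η
  nlinarith [mul_nonneg (vecNorm_nonneg ζ) (vecNorm_nonneg α),
    mul_nonneg (abs_nonneg η) (vecNorm_nonneg α), mul_nonneg (abs_nonneg η) (vecNorm_nonneg ζ)]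

theorem vecLam_eq_comp (ζ : Fin (2 * s + 1) → ℝ) :
    vecLam ζ = (fun i : Fin (2 * s) => ζ i.castSucc) ∘
      fun k : Fin s => ⟨2 * (k : ℕ) + 1, by have := k.isLt; omega⟩ := rfl

/-- Λ reads the even positions (one-based), and the last position 2s + 1 is odd. Hence Λ(ζ̃) is
controlled by z alone, which keeps the last entry out of the regression errors. -/
theorem vecNorm_vecLam_le_castSucc (ζ : Fin (2 * s + 1) → ℝ) :
    vecNorm (vecLam ζ) ≤ vecNorm fun i : Fin (2 * s) => ζ i.castSucc := by
  rw [vecLam_eq_comp]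
  refine vecNorm_comp_le _ fun a b h => ?_
  simp only [Fin.mk.injEq] at h
  ext; omega

theorem vecNorm_vecLam_le (ζ : Fin (2 * s + 1) → ℝ) : vecNorm (vecLam ζ) ≤ vecNorm ζ :=
  (vecNorm_vecLam_le_castSucc ζ).trans (vecNorm_comp_le ζ (Fin.castSucc_injective _))

/-- `A(α̂) - A(α)` only has a last row. -/
theorem matA_add_sub_mulVec (a α : Fin s → ℝ) (ζ : Fin (2 * s + 1) → ℝ) :
    (matA (a + α) - matA α) *ᵥ ζ = Pi.single (Fin.last (2 * s)) (a ⬝ᵥ vecLam ζ) := by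
  ext i
  rcases Fin.lastCases (motive := fun i => i = Fin.last (2 * s) ∨ (i : ℕ) < 2 * s) (Or.inl rfl)
    (fun j => Or.inr (by simp)) i with rfl | hi
  · have h : ∀ j : Fin (2 * s + 1), (matA (a + α) - matA α) (Fin.last (2 * s)) j =
        ∑ k : Fin s, if (j : ℕ) = 2 * (k : ℕ) + 1 then a k else 0 := by
      intro j
      rw [Matrix.sub_apply]
      simp only [matA, of_apply, Fin.val_last, lt_irrefl, if_false, ← Finset.sum_sub_distrib]
      refine Finset.sum_congr rfl fun k _ => ?_
      split_ifs <;> simp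
    simp only [mulVec, dotProduct, h, Pi.single_eq_same, Finset.sum_mul]
    rw [Finset.sum_comm]
    refine Finset.sum_congr rfl fun k _ => ?_
    rw [Finset.sum_eq_single ⟨2 * (k : ℕ) + 1, by have := k.isLt; omega⟩]
    · simp [vecLam]
    · intro j _ hj
      rw [if_neg, zero_mul]
      intro h; exact hj (Fin.ext h)
    · simp
  · have hne : i ≠ Fin.last (2 * s) := by
      rintro rfl; simp at hi
    simp [mulVec, dotProduct, matA, hi, hne]

theorem matA_mulVec_of_lt (α : Fin s → ℝ) (ζ : Fin (2 * s + 1) → ℝ) (i : ℕ) (hi : i < 2 * s) :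
    (matA α *ᵥ ζ) ⟨i, by omega⟩ = ζ ⟨i + 1, by omega⟩ := by
  simp only [mulVec, dotProduct, matA, of_apply, hi, if_true]
  rw [Finset.sum_eq_single ⟨i + 1, by omega⟩]
  · simp
  · intro j _ hj
    rw [if_neg, zero_mul]
    intro h; exact hj (Fin.ext h)
  · simp

theorem matA_mulVec_last (α : Fin s → ℝ) (ζ : Fin (2 * s + 1) → ℝ) :
    (matA α *ᵥ ζ) (Fin.last (2 * s)) = α ⬝ᵥ vecLam ζ := by
  -- The last row of A(0) vanishes, so the difference formula with base parameter 0 already computes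
  -- the last row of A(α).
  have h := congrFun (matA_add_sub_mulVec α 0 ζ) (Fin.last (2 * s))
  have h0 : (matA (0 : Fin s → ℝ) *ᵥ ζ) (Fin.last (2 * s)) = 0 := by
    simp [mulVec, dotProduct, matA]
  rw [sub_mulVec, Pi.sub_apply, h0, sub_zero, add_zero] at h
  simpa using h

/-- Changing the parameter alters only the last row of A, and the last entry of R is 1, so the
parameter error enters with weight one. -/
theorem rowAt_add_dotProduct (r : Fin (2 * s) → ℝ) (a α : Fin s → ℝ) (ζ : Fin (2 * s + 1) → ℝ) :
    rowAt r (a + α) ⬝ᵥ ζ = rowAt r α ⬝ᵥ ζ + a ⬝ᵥ vecLam ζ := by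
  have h := matA_add_sub_mulVec a α ζ
  have : rowAt r (a + α) ⬝ᵥ ζ - rowAt r α ⬝ᵥ ζ
      = rowR r ⬝ᵥ ((matA (a + α) - matA α) *ᵥ ζ) := by
    rw [rowAt, rowAt, ← dotProduct_mulVec, ← dotProduct_mulVec, ← dotProduct_sub, ← sub_mulVec,
      add_sub_add_left_eq_sub]
  rw [h, dotProduct_single] at this
  simp only [rowR, Fin.snoc_last, one_mul] at this
  linarith

theorem one_le_vecNorm_rowR (r : Fin (2 * s) → ℝ) : 1 ≤ vecNorm (rowR r) := by
  have := abs_le_vecNorm (rowR r) (Fin.last _)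
  simpa [rowR] using this

end Nu

/-! ### The scalar inequality behind the choice of κ. -/

theorem two_mul_sq_le_kappa_div {c : ℝ} (hc : 1 < c) :
    2 * c ^ 2 + 1 + 3 / (8 * c ^ 2) ≤ Model.kappa c / c + 2 * c - 1 := by
  have h1 : 0 < c ^ 2 - 1 := by nlinarith
  have h0 : 0 < c := by linarith
  have hp : 0 ≤ 8 * c ^ 8 - 16 * c ^ 7 + 12 * c ^ 6 - 12 * c ^ 4 + 13 * c ^ 3 - 2 * c ^ 2
      + 3 * c - 2 := by
    -- Expanded in u = c - 1, the polynomial has only positive coefficients.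
    obtain ⟨u, hu, rfl⟩ : ∃ u : ℝ, 0 < u ∧ c = 1 + u := ⟨c - 1, by linarith, by ring⟩
    ring_nf
    positivity
  have hk : Model.kappa c / c + 2 * c - 1 - (2 * c ^ 2 + 1 + 3 / (8 * c ^ 2)) =
      (8 * c ^ 8 - 16 * c ^ 7 + 12 * c ^ 6 - 12 * c ^ 4 + 13 * c ^ 3 - 2 * c ^ 2 + 3 * c - 2)
        / (8 * c ^ 3 * (c ^ 2 - 1)) := by
    have h2 : c ^ 2 - 1 ≠ 0 := h1.ne'
    have h3 : 2 * c ^ 2 - 2 = 2 * (c ^ 2 - 1) := by ring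
    rw [Model.kappa, h3]
    field_simp
    ring
  have : 0 ≤ (8 * c ^ 8 - 16 * c ^ 7 + 12 * c ^ 6 - 12 * c ^ 4 + 13 * c ^ 3 - 2 * c ^ 2 + 3 * c - 2)
        / (8 * c ^ 3 * (c ^ 2 - 1)) := by positivity
  linarith

/-- The quadratic form that decides the dissipation inequality. -/
theorem dissipation_form_le {c D n o w : ℝ} (hc : 1 < c) (hD : Model.kappa c + 2 * c ^ 2 < D) :
    o * w / c + 2 * (n * o) + n * w / c - D * o ^ 2 / c - n ^ 2 / c ^ 2 ≤
      -(1 / (4 * c ^ 2)) * n ^ 2 - 1 / (2 * c ^ 2) * ((D - Model.kappa c) * o ^ 2) + w ^ 2 := by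
  have h0 : 0 < c := by linarith
  have h1 := two_mul_sq_le_kappa_div hc
  -- The right side increases with D, with slope (2c - 1)/(2c²), so the threshold D = κ + 2c² is the
  -- worst case.
  have hK : 2 * c ^ 2 + 1 + 3 / (8 * c ^ 2) ≤ D / c - (D - Model.kappa c) / (2 * c ^ 2) := by
    have : D / c - (D - Model.kappa c) / (2 * c ^ 2) - (Model.kappa c / c + 2 * c - 1) =
        (D - (Model.kappa c + 2 * c ^ 2)) * (2 * c - 1) / (2 * c ^ 2) := by
      field_simp
      ring
    have h2 : 0 ≤ (D - (Model.kappa c + 2 * c ^ 2)) * (2 * c - 1) / (2 * c ^ 2) := by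
      apply div_nonneg (mul_nonneg _ _) (by positivity) <;> linarith
    linarith
  have hKo := mul_le_mul_of_nonneg_right hK (sq_nonneg o)
  -- Completing the square in w and then in n leaves a multiple of o²; the cost of the two squares
  -- is 2c² + 1 + 3/(8c²).
  have key : -(1 / (4 * c ^ 2)) * n ^ 2 - 1 / (2 * c ^ 2) * ((D - Model.kappa c) * o ^ 2) + w ^ 2
      - (o * w / c + 2 * (n * o) + n * w / c - D * o ^ 2 / c - n ^ 2 / c ^ 2) =
      (w - (o + n) / (2 * c)) ^ 2 + 1 / 2 * (n / c - (2 * c + 1 / (2 * c)) * o) ^ 2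
      + ((D / c - (D - Model.kappa c) / (2 * c ^ 2)) * o ^ 2
        - (2 * c ^ 2 + 1 + 3 / (8 * c ^ 2)) * o ^ 2) := by
    field_simp
    ring
  nlinarith [sq_nonneg (w - (o + n) / (2 * c)), sq_nonneg (n / c - (2 * c + 1 / (2 * c)) * o)]

/-! ### Bounds on the coupling between frequency and internal model. -/

namespace Model

variable {V : Type*} [Fintype V] (S : Model V)

/-- The contribution of φ through the true parameter cancels, so every remaining term has a factor
ζ̃ or α̃. Hence ρ vanishes at ν = 0 and is linearly bounded on bounded sets. -/
theorem rho_eq (j : V) (t : ℝ) (ν : Nu (S.s j)) :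
    S.rho j t ν = -(rowR (S.r j) ⬝ᵥ zetaOf ν) - (rowR (S.r j) ᵥ* matA (S.α j)) ⬝ᵥ zetaOf ν
      - alphaOf ν ⬝ᵥ vecLam (zetaOf ν + S.phi j t) := by
  have h : rowAt (S.r j) (S.α j) ⬝ᵥ zetaOf ν =
      rowR (S.r j) ⬝ᵥ zetaOf ν + (rowR (S.r j) ᵥ* matA (S.α j)) ⬝ᵥ zetaOf ν := by
    rw [rowAt, vecMul_add, vecMul_one, add_dotProduct]
  rw [rho, rowAt_add_dotProduct, dotProduct_add, h]
  ring

theorem rho_zero (j : V) (t : ℝ) : S.rho j t 0 = 0 := by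
  have h1 : zetaOf (0 : Nu (S.s j)) = 0 := rfl
  have h2 : alphaOf (0 : Nu (S.s j)) = 0 := rfl
  rw [rho_eq, h1, h2]
  simp

theorem abs_rho_le {j : V} {t : ℝ} {ν : Nu (S.s j)} {cbar phibar c2 : ℝ} (hν : ‖ν‖ ≤ cbar)
    (hφ : vecNorm (S.phi j t) ≤ phibar)
    (hc2 : vecNorm (rowR (S.r j)) * phibar + vecNorm (rowR (S.r j))
      + vecNorm (rowR (S.r j) ᵥ* matA (S.α j)) ≤ c2) :
    |S.rho j t ν| ≤ c2 * (1 + cbar) * ‖ν‖ := by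
  have h1 := abs_dotProduct_le_vecNorm (rowR (S.r j)) (zetaOf ν)
  have h2 := abs_dotProduct_le_vecNorm (rowR (S.r j) ᵥ* matA (S.α j)) (zetaOf ν)
  have h3 := abs_dotProduct_le_vecNorm (alphaOf ν) (vecLam (zetaOf ν + S.phi j t))
  have h4 : vecNorm (vecLam (zetaOf ν + S.phi j t)) ≤ cbar + phibar :=
    ((vecNorm_vecLam_le _).trans (vecNorm_add_le _ _)).trans
      (add_le_add ((vecNorm_zetaOf_le ν).trans hν) hφ)
  have h5 := vecNorm_zetaOf_le ν
  have h6 := vecNorm_alphaOf_le ν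
  have hR := one_le_vecNorm_rowR (S.r j)
  have hn := norm_nonneg ν
  have hφ0 := (vecNorm_nonneg (S.phi j t)).trans hφ
  have hRA := vecNorm_nonneg (rowR (S.r j) ᵥ* matA (S.α j))
  have h7 : |S.rho j t ν| ≤ vecNorm (rowR (S.r j)) * ‖ν‖
      + vecNorm (rowR (S.r j) ᵥ* matA (S.α j)) * ‖ν‖ + ‖ν‖ * (cbar + phibar) := by
    rw [rho_eq]
    refine (abs_sub _ _).trans (add_le_add ((abs_sub _ _).trans (add_le_add ?_ ?_)) ?_)
    · rw [abs_neg]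
      exact h1.trans (by gcongr)
    · exact h2.trans (by gcongr)
    · exact h3.trans (by gcongr; exact vecNorm_nonneg _)
  refine h7.trans ?_
  rw [← add_mul, mul_comm ‖ν‖, ← add_mul]
  refine mul_le_mul_of_nonneg_right ?_ hn
  have hc0 : 0 ≤ cbar := hn.trans hν
  -- Since ‖R‖ ≥ 1, `c2` dominates `phibar` together with the two row norms, and also `c2 * cbar`
  -- dominates `cbar`.
  nlinarith [mul_nonneg (sub_nonneg.mpr hR) hφ0, mul_nonneg hφ0 hc0]

/-- The field is affine in (ω, w). The only state-dependent coefficient is kα M Λ(ζ), which is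
bounded on the region. -/
theorem norm_nuField_sub_le {j : V} {t : ℝ} {ν : Nu (S.s j)} {cbar phibar c3 : ℝ} (ω w : ℝ)
    (hν : ‖ν‖ ≤ cbar) (hφ : vecNorm (S.phi j t) ≤ phibar)
    (hc3 : S.M j + vecNorm (colG (S.s j) S.g) * S.M j
      + S.kα * S.M j * (cbar + phibar) ≤ c3) :
    ‖S.nuField j t ν ω w - S.nuField j t ν 0 0‖ ≤ c3 * |ω| + |w| := by
  have hdiff : S.nuField j t ν ω w - S.nuField j t ν 0 0 =
      mkNu (-(S.M j * ω) - w) ((-(S.M j * ω)) • colG (S.s j) S.g)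
        ((-(S.kα * (S.M j * ω))) • vecLam (zetaOf ν + S.phi j t)) := by
    ext i
    rcases i with i | i | i <;> simp [nuField, mkNu] <;> ring
  have h4 : vecNorm (vecLam (zetaOf ν + S.phi j t)) ≤ cbar + phibar :=
    ((vecNorm_vecLam_le _).trans (vecNorm_add_le _ _)).trans
      (add_le_add ((vecNorm_zetaOf_le ν).trans hν) hφ)
  rw [hdiff]
  refine (norm_mkNu_le _ _ _).trans ?_
  rw [vecNorm_smul, vecNorm_smul, abs_neg, abs_neg, abs_mul, abs_mul, abs_mul,
    abs_of_pos (S.M_pos j), abs_of_pos S.kα_pos]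
  have h5 : |-(S.M j * ω) - w| ≤ S.M j * |ω| + |w| := by
    refine (abs_sub _ _).trans ?_
    rw [abs_neg, abs_mul, abs_of_pos (S.M_pos j)]
  have h6 : S.kα * (S.M j * |ω|) * vecNorm (vecLam (zetaOf ν + S.phi j t)) ≤
      S.kα * (S.M j * |ω|) * (cbar + phibar) := by
    have := S.kα_pos; have := S.M_pos j
    gcongr
  have h7 := mul_le_mul_of_nonneg_right hc3 (abs_nonneg ω)
  nlinarith

/-! ### Equilibria. -/

section Equilibrium

variable {S} {d : V → ℝ} {xs : S.State}

theorem IsEquilibrium.sub_eq_zero_of_mem (h : S.IsEquilibrium d xs) {i j : V}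
    (hij : (i, j) ∈ S.lines) : xs.2.1 i = xs.2.1 j := by
  have := congrFun (congrArg Prod.fst (h 0 le_rfl)) ⟨(i, j), hij⟩
  simpa [field, sub_eq_zero] using this

theorem IsEquilibrium.mu_eq [DecidableEq V] [DecidableRel S.comm.Adj] (h : S.IsEquilibrium d xs)
    (j : V) : (S.comm.lapMatrix ℝ *ᵥ xs.2.2.1) j = xs.2.1 j / S.β j := by
  have := congrFun (congrArg (fun x : S.State => x.2.2.1) (h 0 le_rfl)) j
  simp only [field] at this
  rw [SimpleGraph.lapMatrix_mulVec_apply]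
  have h2 : ∑ k ∈ S.comm.neighborFinset j, (xs.2.2.1 j - xs.2.2.1 k) =
      S.comm.degree j * xs.2.2.1 j - ∑ k ∈ S.comm.neighborFinset j, xs.2.2.1 k := by
    rw [Finset.sum_sub_distrib]; simp
  rw [← h2]
  have h3 : -(∑ k ∈ S.comm.neighborFinset j, (xs.2.2.1 j - xs.2.2.1 k)) + xs.2.1 j / S.β j = 0 := by
    change _ = (0 : ℝ) at this
    convert this
  linarith

/-- Connectedness of the lines makes ω constant. Summing the μ equation removes the Laplacian and
leaves this constant times ∑ 1/β_j > 0. -/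
theorem IsEquilibrium.omega_eq_zero (h : S.IsEquilibrium d xs) : xs.2.1 = 0 := by
  classical
  have hconst : ∀ i j, xs.2.1 i = xs.2.1 j := by
    intro i j
    obtain ⟨p⟩ := S.lines_connected.preconnected i j
    induction p with
    | nil => rfl
    | cons hadj _ ih =>
      rw [← ih]
      rcases (SimpleGraph.fromRel_adj _ _ _).mp hadj |>.2 with h1 | h1
      · exact h.sub_eq_zero_of_mem h1
      · exact (h.sub_eq_zero_of_mem h1).symm
  ext i
  have hsum : ∑ j, xs.2.1 j / S.β j = 0 := by
    calc ∑ j, xs.2.1 j / S.β j = (fun _ => (1 : ℝ)) ⬝ᵥ (S.comm.lapMatrix ℝ *ᵥ xs.2.2.1) := by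
          simp [dotProduct, h.mu_eq]
      _ = 0 := by
          rw [dotProduct_mulVec, ← mulVec_transpose, (S.comm.isSymm_lapMatrix (R := ℝ)).eq,
            SimpleGraph.lapMatrix_mulVec_const_eq_zero, zero_dotProduct]
  have h2 : xs.2.1 i * ∑ j, 1 / S.β j = 0 := by
    rw [Finset.mul_sum, ← hsum]
    refine Finset.sum_congr rfl fun j _ => ?_
    rw [hconst i j]; ring
  have h3 : 0 < ∑ j, 1 / S.β j :=
    Finset.sum_pos (fun j _ => one_div_pos.mpr (S.β_pos j)) ⟨i, Finset.mem_univ i⟩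
  exact (mul_eq_zero.mp h2).resolve_right h3.ne'

theorem IsEquilibrium.lapMatrix_mulVec [DecidableEq V] [DecidableRel S.comm.Adj]
    (h : S.IsEquilibrium d xs) : S.comm.lapMatrix ℝ *ᵥ xs.2.2.1 = 0 := by
  ext j
  rw [h.mu_eq, h.omega_eq_zero]
  simp

theorem IsLyapunov.nonneg {U : ∀ j, ℝ → Nu (S.s j) → ℝ} {b : V → ℝ} (hU : S.IsLyapunov U b)
    (j : V) {t : ℝ} (ht : 0 ≤ t) (ν : Nu (S.s j)) : 0 ≤ U j t ν := by
  obtain ⟨_, _, ⟨Ul, Uu, hl, _, hb⟩, _⟩ := hU j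
  refine le_trans ?_ (hb t ht ν).1
  by_cases hν : ν = 0
  · rw [hν, hl.2.1]
  · exact (hl.2.2.1 ν hν).le

theorem IsLyapunov.apply_zero {U : ∀ j, ℝ → Nu (S.s j) → ℝ} {b : V → ℝ} (hU : S.IsLyapunov U b)
    (j : V) {t : ℝ} (ht : 0 ≤ t) : U j t 0 = 0 := by
  refine le_antisymm ?_ (hU.nonneg j ht 0)
  obtain ⟨_, _, ⟨Ul, Uu, _, hu, hb⟩, _⟩ := hU j
  exact ((hb t ht 0).2).trans hu.2.1.le

/-- At a permanent rest point `U` would fall forever at the fixed rate ‖ν‖², contradicting its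
nonnegativity. -/
theorem IsLyapunov.eq_zero_of_nuField {U : ∀ j, ℝ → Nu (S.s j) → ℝ} {b : V → ℝ}
    (hU : S.IsLyapunov U b) {j : V} {ν : Nu (S.s j)}
    (h : ∀ t, 0 ≤ t → S.nuField j t ν 0 0 = 0) : ν = 0 := by
  have hC := (hU j).2.1
  have hdiff : Differentiable ℝ (fun t => U j t ν) :=
    (hC.differentiable one_ne_zero).comp (differentiable_id.prodMk (differentiable_const ν))
  have hle : ∀ t, 0 ≤ t → deriv (fun τ => U j τ ν) t ≤ -‖ν‖ ^ 2 := by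
    intro t ht
    have := (hU j).2.2.2.1 t ht ν
    rwa [h t ht, map_zero, add_zero] at this
  by_contra hν
  have hn : 0 < ‖ν‖ ^ 2 := by have := norm_pos_iff.mpr hν; positivity
  have hU0 := hU.nonneg j le_rfl ν
  -- By time T the drop exceeds the initial value by 1.
  set T := (U j 0 ν + 1) / ‖ν‖ ^ 2 with hT
  have hT0 : 0 < T := by positivity
  have := (convex_Icc 0 T).image_sub_le_mul_sub_of_deriv_le (f := fun t => U j t ν)
    hdiff.continuous.continuousOn hdiff.differentiableOn (C := -‖ν‖ ^ 2)
    (fun t ht => hle t (interior_subset ht).1) 0 ⟨le_rfl, hT0.le⟩ T ⟨hT0.le, le_rfl⟩ hT0.le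
  have h3 := hU.nonneg j hT0.le ν
  have h4 : ‖ν‖ ^ 2 * T = U j 0 ν + 1 := by rw [hT]; field_simp
  simp only [sub_zero] at this
  linarith

theorem IsEquilibrium.nu_eq_zero {U : ∀ j, ℝ → Nu (S.s j) → ℝ} {b : V → ℝ}
    (h : S.IsEquilibrium d xs) (hU : S.IsLyapunov U b) : xs.2.2.2 = 0 := by
  ext1 j
  refine hU.eq_zero_of_nuField fun t ht => ?_
  have := congrFun (congrArg (fun x : S.State => x.2.2.2) (h t ht)) j
  simpa [field, h.omega_eq_zero] using this

theorem IsEquilibrium.power_balance {U : ∀ j, ℝ → Nu (S.s j) → ℝ} {b : V → ℝ}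
    (h : S.IsEquilibrium d xs) (hU : S.IsLyapunov U b) (j : V) :
    S.Pbar j + S.inflow xs.1 j - xs.2.2.1 j / S.β j = 0 := by
  have := congrFun (congrArg (fun x : S.State => x.2.1) (h 0 le_rfl)) j
  simp only [field, h.omega_eq_zero, h.nu_eq_zero hU] at this
  have h3 := S.rho_zero j 0
  simpa [h3, (S.M_pos j).ne'] using this

end Equilibrium

end Model

/-! ### The derivative of the storage function. -/

namespace Model

variable {V : Type*} [Fintype V] (S : Model V)

theorem hasDerivAt_sq_line (a b c : ℝ) :
    HasDerivAt (fun h : ℝ => (a + h * b - c) ^ 2) (2 * ((a - c) * b)) 0 := by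
  have h1 : HasDerivAt (fun h : ℝ => a + h * b - c) b 0 := by
    simpa using (((hasDerivAt_id (0 : ℝ)).mul_const b).const_add a).sub_const c
  refine (h1.pow 2).congr_deriv ?_
  simp
  ring

theorem hasDerivAt_V1_line (xs x f : S.State) :
    HasDerivAt (fun h : ℝ => S.V1 xs (x + h • f))
      ((∑ e : {e : V × V // e ∈ S.lines}, S.B e.1 * ((x.1 e - xs.1 e) * f.1 e))
        + (∑ j, S.M j * ((x.2.1 j - xs.2.1 j) * f.2.1 j))
        + ∑ j, (x.2.2.1 j - xs.2.2.1 j) * f.2.2.1 j) 0 := by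
  have h1 := HasDerivAt.fun_sum (u := Finset.univ) fun (e : {e : V × V // e ∈ S.lines}) _ =>
    (hasDerivAt_sq_line (x.1 e) (f.1 e) (xs.1 e)).const_mul (S.B e.1)
  have h2 := HasDerivAt.fun_sum (u := Finset.univ) fun (j : V) _ =>
    (hasDerivAt_sq_line (x.2.1 j) (f.2.1 j) (xs.2.1 j)).const_mul (S.M j)
  have h3 := HasDerivAt.fun_sum (u := Finset.univ) fun (j : V) _ =>
    hasDerivAt_sq_line (x.2.2.1 j) (f.2.2.1 j) (xs.2.2.1 j)
  refine (((h1.add h2).add h3).const_mul (1 / 2 : ℝ)).congr_deriv ?_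
  simp only [mul_add, Finset.mul_sum]
  congr 1; congr 1
  all_goals exact Finset.sum_congr rfl fun _ _ => by ring

theorem contDiff_V2 {U : ∀ j, ℝ → Nu (S.s j) → ℝ} {b : V → ℝ} (hU : S.IsLyapunov U b) :
    ContDiff ℝ 1 (fun p : ℝ × S.State => S.V2 U p.1 p.2.2.2.2) := by
  unfold V2
  refine ContDiff.sum fun j _ => ?_
  have h : ContDiff ℝ 1 (fun p : ℝ × S.State => (p.1, p.2.2.2.2 j)) :=
    contDiff_fst.prodMk <| ContDiff.comp
      (ContinuousLinearMap.proj (R := ℝ) (φ := fun j => Nu (S.s j)) j).contDiff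
      contDiff_snd.snd.snd.snd
  exact (hU j).2.1.comp h

theorem contDiff_storage {U : ∀ j, ℝ → Nu (S.s j) → ℝ} {b : V → ℝ} (hU : S.IsLyapunov U b)
    (c3 : ℝ) (xs : S.State) :
    ContDiff ℝ 1 (fun p : ℝ × S.State => S.storage U c3 xs p.1 p.2) := by
  have h1 : ContDiff ℝ 1 (fun p : ℝ × S.State => S.V1 xs p.2) := by
    unfold V1
    fun_prop
  exact (h1.div_const c3).add ((S.contDiff_V2 hU).div_const (c3 ^ 2))

/-- Both sides are the derivative at h = 0 of the storage at (t + h, x + h f). Uniqueness of that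
derivative splits it into components without computing the Fréchet derivative on the full state
space. -/
theorem derivAlong_storage {U : ∀ j, ℝ → Nu (S.s j) → ℝ} {b : V → ℝ} (hU : S.IsLyapunov U b)
    (d : V → ℝ) (c3 : ℝ) (xs x : S.State) (t : ℝ) (w : V → ℝ) :
    S.derivAlong d (S.storage U c3 xs) t x w =
      ((∑ e : {e : V × V // e ∈ S.lines}, S.B e.1 * ((x.1 e - xs.1 e) * (S.field d t x w).1 e))
        + (∑ j, S.M j * ((x.2.1 j - xs.2.1 j) * (S.field d t x w).2.1 j))
        + ∑ j, (x.2.2.1 j - xs.2.2.1 j) * (S.field d t x w).2.2.1 j) / c3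
      + (∑ j, (deriv (fun τ => U j τ (x.2.2.2 j)) t
          + fderiv ℝ (fun v => U j t v) (x.2.2.2 j)
            (S.nuField j t (x.2.2.2 j) (x.2.1 j) (w j)))) / c3 ^ 2 := by
  have hl := hasDerivAt_line (W := S.storage U c3 xs) (S.field d t x w)
    ((S.contDiff_storage hU c3 xs).differentiable one_ne_zero (t, x))
  refine hl.unique ?_
  refine ((S.hasDerivAt_V1_line xs x _).div_const c3).add (HasDerivAt.div_const ?_ _)
  exact HasDerivAt.fun_sum fun j _ => hasDerivAt_line (W := U j)
    (S.nuField j t (x.2.2.2 j) (x.2.1 j) (w j)) ((hU j).2.1.differentiable one_ne_zero _)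

-- Summation by parts on the graph: each line is counted at its two ends with opposite signs. This
-- is what cancels the power flows in the derivative of V₁.
open scoped Classical in
theorem sum_mul_inflow (θ : {e : V × V // e ∈ S.lines} → ℝ) (ω : V → ℝ) :
    ∑ j, ω j * S.inflow θ j = -∑ e, S.B e.1 * (θ e * (ω e.1.1 - ω e.1.2)) := by
  simp only [inflow, mul_sub, Finset.mul_sum, Finset.sum_sub_distrib]
  rw [Finset.sum_comm, Finset.sum_comm (γ := V), ← Finset.sum_sub_distrib, ← Finset.sum_sub_distrib,
    ← Finset.sum_neg_distrib]
  refine Finset.sum_congr rfl fun e _ => ?_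
  simp
  ring

theorem inflow_sub (θ θ' : {e : V × V // e ∈ S.lines} → ℝ) (j : V) :
    S.inflow (θ - θ') j = S.inflow θ j - S.inflow θ' j := by
  simp only [inflow, ← Finset.sum_sub_distrib]
  refine Finset.sum_congr rfl fun e _ => ?_
  simp only [Pi.sub_apply]
  split_ifs <;> ring

variable {S}

/-- The derivative of `V₁` along the closed loop. -/
theorem IsEquilibrium.deriv_V1_eq [DecidableEq V] [DecidableRel S.comm.Adj]
    {U : ∀ j, ℝ → Nu (S.s j) → ℝ} {b d : V → ℝ}
    {xs : S.State} (h : S.IsEquilibrium d xs) (hU : S.IsLyapunov U b) (t : ℝ) (x : S.State)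
    (w : V → ℝ) :
    (∑ e : {e : V × V // e ∈ S.lines}, S.B e.1 * ((x.1 e - xs.1 e) * (S.field d t x w).1 e))
        + (∑ j, S.M j * ((x.2.1 j - xs.2.1 j) * (S.field d t x w).2.1 j))
        + ∑ j, (x.2.2.1 j - xs.2.2.1 j) * (S.field d t x w).2.2.1 j =
      (∑ j, (x.2.1 j * w j + x.2.1 j * S.rho j t (x.2.2.2 j) - (S.D j + d j) * x.2.1 j ^ 2))
      - (x.2.2.1 - xs.2.2.1) ⬝ᵥ (S.comm.lapMatrix ℝ *ᵥ (x.2.2.1 - xs.2.2.1)) := by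
  obtain ⟨θ, ω, μ, ν⟩ := x
  have hinf := S.sum_mul_inflow (θ - xs.1) ω
  have hω := h.omega_eq_zero
  -- The instance is left arbitrary because `field` uses the classical one. Subtracting the
  -- equilibrium μ is free, as the Laplacian annihilates it.
  have hlap : ∀ (j : V) (_ : Fintype (S.comm.neighborSet j)),
      -(∑ k ∈ S.comm.neighborFinset j, (μ j - μ k)) =
      -(S.comm.lapMatrix ℝ *ᵥ (μ - xs.2.2.1)) j := by
    intro j _
    rw [mulVec_sub, h.lapMatrix_mulVec, sub_zero, SimpleGraph.lapMatrix_mulVec_apply,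
      Finset.sum_sub_distrib]
    simp
    congr!
  have h1 : ∑ j, S.M j * ((ω j - xs.2.1 j) * (S.field d t (θ, ω, μ, ν) w).2.1 j) =
      ∑ j, (ω j * w j + ω j * S.rho j t (ν j) - (S.D j + d j) * ω j ^ 2)
        + (∑ j, ω j * S.inflow (θ - xs.1) j) - ∑ j, (μ j - xs.2.2.1 j) * (ω j / S.β j) := by
    rw [← Finset.sum_add_distrib, ← Finset.sum_sub_distrib]
    refine Finset.sum_congr rfl fun j _ => ?_
    have hb := h.power_balance hU j
    have hM := (S.M_pos j).ne'
    rw [inflow_sub, hω]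
    simp only [field, Pi.zero_apply, sub_zero]
    -- The equilibrium power balance eliminates the constant injection, so only deviations from the
    -- equilibrium remain.
    have : S.Pbar j = xs.2.2.1 j / S.β j - S.inflow xs.1 j := by linarith
    rw [this]
    field_simp
    ring
  have h2 : ∑ j, (μ j - xs.2.2.1 j) * (S.field d t (θ, ω, μ, ν) w).2.2.1 j =
      ∑ j, (μ j - xs.2.2.1 j) * (ω j / S.β j)
        - (μ - xs.2.2.1) ⬝ᵥ (S.comm.lapMatrix ℝ *ᵥ (μ - xs.2.2.1)) := by
    rw [dotProduct, ← Finset.sum_sub_distrib]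
    refine Finset.sum_congr rfl fun j _ => ?_
    simp only [field]
    rw [hlap j _, Pi.sub_apply]
    ring
  simp only at *
  -- The line terms cancel against the θ̃ part, and the terms μω/β cancel between the ω and μ parts.
  rw [h1, h2, hinf]
  simp only [field, Pi.sub_apply]
  ring

theorem dotProduct_lapMatrix_nonneg (G : SimpleGraph V) [DecidableEq V] [DecidableRel G.Adj]
    (v : V → ℝ) : 0 ≤ v ⬝ᵥ (G.lapMatrix ℝ *ᵥ v) := by
  simpa using (SimpleGraph.posSemidef_lapMatrix (R := ℝ) G).dotProduct_mulVec_nonneg v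

/-- The derivative of `U_j` along the perturbed internal-model dynamics. -/
theorem IsLyapunov.deriv_add_fderiv_le {U : ∀ j, ℝ → Nu (S.s j) → ℝ} {b : V → ℝ}
    (hU : S.IsLyapunov U b) {ctil cbar phibar c2 c3 : ℝ}
    (hc : S.Constants U b ctil cbar phibar c2 c3) {t : ℝ} (ht : 0 ≤ t) {j : V} {ν : Nu (S.s j)}
    (hν : ‖ν‖ ≤ cbar) (ω w : ℝ) :
    deriv (fun τ => U j τ ν) t + fderiv ℝ (fun v => U j t v) ν (S.nuField j t ν ω w) ≤
      -‖ν‖ ^ 2 + c3 ^ 2 * (‖ν‖ * |ω|) + c3 * (‖ν‖ * |w|) := by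
  have h1 := (hU j).2.2.2.1 t ht ν
  have h2 := (hU j).2.2.2.2 t ht ν
  have h3 := S.norm_nuField_sub_le ω w hν (hc.phi_le j t ht) (hc.c3_ge_M j)
  have hb := hc.c3_ge_b j
  have hn := norm_nonneg ν
  -- On the region the cubic gradient bound becomes linear, because ‖ν‖ + ‖ν‖³ = (1 + ‖ν‖²)‖ν‖.
  have h4 : ‖fderiv ℝ (fun v => U j t v) ν‖ ≤ c3 * ‖ν‖ := by
    refine h2.trans ?_
    have : b j * (1 + ‖ν‖ ^ 2) ≤ c3 := by
      refine le_trans ?_ hb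
      have := (hU j).1
      gcongr
    calc b j * (‖ν‖ + ‖ν‖ ^ 3) = (b j * (1 + ‖ν‖ ^ 2)) * ‖ν‖ := by ring
      _ ≤ c3 * ‖ν‖ := by gcongr
  have h5 := (fderiv ℝ (fun v => U j t v) ν).le_opNorm
    (S.nuField j t ν ω w - S.nuField j t ν 0 0)
  rw [map_sub, Real.norm_eq_abs] at h5
  have h6 := (le_abs_self _).trans h5
  have hc3 := hc.c3_gt_one
  have h7 : ‖fderiv ℝ (fun v => U j t v) ν‖ * ‖S.nuField j t ν ω w - S.nuField j t ν 0 0‖ ≤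
      c3 * ‖ν‖ * (c3 * |ω| + |w|) := by gcongr
  linarith

/-- The differential dissipation inequality. -/
theorem IsEquilibrium.derivAlong_storage_le [DecidableEq V] [DecidableRel S.comm.Adj]
    {U : ∀ j, ℝ → Nu (S.s j) → ℝ} {b d : V → ℝ} {xs : S.State} (h : S.IsEquilibrium d xs)
    (hU : S.IsLyapunov U b) {ctil cbar phibar c2 c3 : ℝ}
    (hc : S.Constants U b ctil cbar phibar c2 c3) (hd : S.GainAssumption d c3) {t : ℝ}
    (ht : 0 ≤ t) {x : S.State} (w : V → ℝ) (hx : S.V2 U t x.2.2.2 ≤ ctil) :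
    S.derivAlong d (S.storage U c3 xs) t x w ≤
      -(1 / (4 * c3 ^ 2)) * (∑ j, ‖x.2.2.2 j‖ ^ 2)
      - 1 / (2 * c3 ^ 2) * ((x.2.2.1 - xs.2.2.1) ⬝ᵥ
          (S.comm.lapMatrix ℝ *ᵥ (x.2.2.1 - xs.2.2.1)))
      - 1 / (2 * c3 ^ 2) * (∑ j, (S.D j + d j - Model.kappa c3) * (x.2.1 j) ^ 2)
      + (∑ j, w j ^ 2) := by
  have hc3 := hc.c3_gt_one
  have hc0 : 0 < c3 := by linarith
  rw [S.derivAlong_storage hU, h.deriv_V1_eq hU]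
  have hL := dotProduct_lapMatrix_nonneg S.comm (x.2.2.1 - xs.2.2.1)
  set Λ := (x.2.2.1 - xs.2.2.1) ⬝ᵥ (S.comm.lapMatrix ℝ *ᵥ (x.2.2.1 - xs.2.2.1))
  have hΛ : 1 / (2 * c3 ^ 2) * Λ ≤ Λ / c3 := by
    have : 1 / (2 * c3 ^ 2) ≤ 1 / c3 := by
      apply one_div_le_one_div_of_le hc0
      nlinarith
    calc 1 / (2 * c3 ^ 2) * Λ ≤ 1 / c3 * Λ := by gcongr
      _ = Λ / c3 := by ring
  -- Apart from the Laplacian form the inequality decouples over the areas.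
  have key : ∀ j, (x.2.1 j * w j + x.2.1 j * S.rho j t (x.2.2.2 j)
        - (S.D j + d j) * x.2.1 j ^ 2) / c3
      + (deriv (fun τ => U j τ (x.2.2.2 j)) t + fderiv ℝ (fun v => U j t v) (x.2.2.2 j)
            (S.nuField j t (x.2.2.2 j) (x.2.1 j) (w j))) / c3 ^ 2 ≤
      -(1 / (4 * c3 ^ 2)) * ‖x.2.2.2 j‖ ^ 2
      - 1 / (2 * c3 ^ 2) * ((S.D j + d j - Model.kappa c3) * (x.2.1 j) ^ 2) + w j ^ 2 := by
    intro j
    have hν := hc.region t ht x.2.2.2 hx j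
    have hD : Model.kappa c3 + 2 * c3 ^ 2 < S.D j + d j := by
      have := (le_max_right _ _).trans_lt (hd j)
      linarith
    have h1 := hU.deriv_add_fderiv_le hc ht hν (x.2.1 j) (w j)
    have h2 : |S.rho j t (x.2.2.2 j)| ≤ c3 * ‖x.2.2.2 j‖ :=
      (S.abs_rho_le hν (hc.phi_le j t ht) (hc.c2_ge j)).trans
        (mul_le_mul_of_nonneg_right hc.c3_ge_c2 (norm_nonneg _))
    have h3 := dissipation_form_le (n := ‖x.2.2.2 j‖) (o := |x.2.1 j|) (w := |w j|) hc3 hD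
    rw [sq_abs, sq_abs] at h3
    refine le_trans ?_ h3
    have h4 : x.2.1 j * w j ≤ |x.2.1 j| * |w j| := by
      rw [← abs_mul]; exact le_abs_self _
    have h5 : x.2.1 j * S.rho j t (x.2.2.2 j) ≤ |x.2.1 j| * (c3 * ‖x.2.2.2 j‖) := by
      refine (le_abs_self _).trans ?_
      rw [abs_mul]
      gcongr
    -- With the weights 1/c₃ and 1/c₃², the bound on ρ and the bound on the ν field each contribute
    -- exactly ‖ν‖|ω|, which is the coefficient 2 in `dissipation_form_le`.
    calc _ ≤ (|x.2.1 j| * |w j| + |x.2.1 j| * (c3 * ‖x.2.2.2 j‖)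
            - (S.D j + d j) * x.2.1 j ^ 2) / c3
          + (-‖x.2.2.2 j‖ ^ 2 + c3 ^ 2 * (‖x.2.2.2 j‖ * |x.2.1 j|)
            + c3 * (‖x.2.2.2 j‖ * |w j|)) / c3 ^ 2 := by gcongr
      _ = _ := by
        field_simp
        ring
  have hsum := Finset.sum_le_sum fun j (_ : j ∈ Finset.univ) => key j
  simp only [Finset.sum_add_distrib, Finset.sum_sub_distrib, ← Finset.mul_sum,
    ← Finset.sum_div] at hsum
  simp only [Finset.sum_add_distrib, Finset.sum_sub_distrib, sub_div] at hsum ⊢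
  linarith

theorem nonempty_areas (S : Model V) : Nonempty V := S.comm_connected.nonempty

theorem GainAssumption.one_lt {d : V → ℝ} {c3 : ℝ} (hd : S.GainAssumption d c3) (hc3 : 1 < c3)
    (j : V) : 1 < 1 / (2 * c3 ^ 2) * (S.D j + d j - kappa c3) := by
  have := (le_max_right _ _).trans_lt (hd j)
  have h0 : 0 < 2 * c3 ^ 2 := by positivity
  rw [one_div, inv_mul_eq_div, lt_div_iff₀ h0]
  linarith

theorem GainAssumption.one_lt_inv_gain {d : V → ℝ} {c3 : ℝ} (hd : S.GainAssumption d c3)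
    (hc3 : 1 < c3) : 1 < (S.gain d c3)⁻¹ := by
  have := S.nonempty_areas
  rw [gain, inv_inv]
  obtain ⟨j, hj⟩ := exists_eq_ciInf_of_finite
    (f := fun j => 1 / (2 * c3 ^ 2) * (S.D j + d j - kappa c3))
  rw [← hj]
  exact hd.one_lt hc3 j

variable (S) in
theorem inv_gain_le (d : V → ℝ) (c3 : ℝ) (j : V) :
    (S.gain d c3)⁻¹ ≤ 1 / (2 * c3 ^ 2) * (S.D j + d j - kappa c3) := by
  rw [gain, inv_inv]
  exact ciInf_le (Set.finite_range _).bddBelow j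

theorem IsEquilibrium.derivAlong_storage_le_gain [DecidableEq V]
    {U : ∀ j, ℝ → Nu (S.s j) → ℝ} {b d : V → ℝ} {xs : S.State} (h : S.IsEquilibrium d xs)
    (hU : S.IsLyapunov U b) {ctil cbar phibar c2 c3 : ℝ}
    (hc : S.Constants U b ctil cbar phibar c2 c3) (hd : S.GainAssumption d c3) {t : ℝ}
    (ht : 0 ≤ t) {x : S.State} (w : V → ℝ) (hx : S.V2 U t x.2.2.2 ≤ ctil) :
    S.derivAlong d (S.storage U c3 xs) t x w ≤
      (∑ j, w j ^ 2) - (S.gain d c3)⁻¹ * ∑ j, (x.2.1 j) ^ 2 := by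
  classical
  refine (h.derivAlong_storage_le hU hc hd ht w hx).trans ?_
  have hL := dotProduct_lapMatrix_nonneg S.comm (x.2.2.1 - xs.2.2.1)
  have h1 : 0 ≤ 1 / (4 * c3 ^ 2) * ∑ j, ‖x.2.2.2 j‖ ^ 2 := by positivity
  have h2 : 0 ≤ 1 / (2 * c3 ^ 2) * ((x.2.2.1 - xs.2.2.1) ⬝ᵥ
          (S.comm.lapMatrix ℝ *ᵥ (x.2.2.1 - xs.2.2.1))) := by positivity
  have h3 : (S.gain d c3)⁻¹ * ∑ j, (x.2.1 j) ^ 2 ≤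
      1 / (2 * c3 ^ 2) * (∑ j, (S.D j + d j - Model.kappa c3) * (x.2.1 j) ^ 2) := by
    rw [Finset.mul_sum, Finset.mul_sum]
    refine Finset.sum_le_sum fun j _ => ?_
    rw [← mul_assoc]
    exact mul_le_mul_of_nonneg_right (S.inv_gain_le d c3 j) (sq_nonneg _)
  linarith

end Model

/-! ### Trajectories: integrated dissipation, invariance, gain; admissible constants. -/

namespace Model

variable {V : Type*} [Fintype V] {S : Model V}

theorem IsTrajectory.continuousOn {d : V → ℝ} {w : V → ℝ → ℝ} {T : ℝ} {x : ℝ → S.State}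
    (hx : S.IsTrajectory d w T x) (hT : 0 < T) : ContinuousOn x (Set.Icc 0 T) := by
  have := hx.1.continuousOn
  rwa [Set.uIcc_of_le hT.le] at this

theorem intervalIntegrable_sum_sq {w : V → ℝ → ℝ} {T : ℝ} (hT : 0 < T)
    (hw : ∀ j, MemLp (w j) 2 (volume.restrict (Set.Ioc 0 T))) {t₁ t₂ : ℝ} (h1 : 0 ≤ t₁)
    (h12 : t₁ ≤ t₂) (h2 : t₂ ≤ T) :
    IntervalIntegrable (fun t => ∑ j, w j t ^ 2) volume t₁ t₂ := by
  have h : IntervalIntegrable (fun t => ∑ j, w j t ^ 2) volume 0 T := by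
    rw [intervalIntegrable_iff_integrableOn_Ioc_of_le hT.le]
    exact integrable_finsetSum _ fun j _ => (hw j).integrable_sq
  refine h.mono_set ?_
  rw [Set.uIcc_of_le h12, Set.uIcc_of_le hT.le]
  exact Set.Icc_subset_Icc h1 h2

theorem IsTrajectory.intervalIntegrable_omega {d : V → ℝ} {w : V → ℝ → ℝ} {T : ℝ}
    {x : ℝ → S.State} (hx : S.IsTrajectory d w T x) (hT : 0 < T) {t₁ t₂ : ℝ} (h1 : 0 ≤ t₁)
    (h12 : t₁ ≤ t₂) (h2 : t₂ ≤ T) :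
    IntervalIntegrable (fun t => ∑ j, ((x t).2.1 j) ^ 2) volume t₁ t₂ := by
  refine ContinuousOn.intervalIntegrable ?_
  rw [Set.uIcc_of_le h12]
  have hc := (hx.continuousOn hT).mono (Set.Icc_subset_Icc h1 h2)
  fun_prop

/-- The dissipation inequality along a trajectory in the region. -/
theorem IsTrajectory.storage_sub_le {U : ∀ j, ℝ → Nu (S.s j) → ℝ} {b d : V → ℝ} {xs : S.State}
    (h : S.IsEquilibrium d xs) (hU : S.IsLyapunov U b) {ctil cbar phibar c2 c3 : ℝ}
    (hc : S.Constants U b ctil cbar phibar c2 c3) (hd : S.GainAssumption d c3)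
    {w : V → ℝ → ℝ} {T : ℝ} (hT : 0 < T)
    (hw : ∀ j, MemLp (w j) 2 (volume.restrict (Set.Ioc 0 T)))
    {x : ℝ → S.State} (hx : S.IsTrajectory d w T x) {t₁ t₂ : ℝ} (h1 : 0 ≤ t₁)
    (h12 : t₁ ≤ t₂) (h2 : t₂ ≤ T)
    (hreg : ∀ t ∈ Set.Icc t₁ t₂, S.V2 U t (x t).2.2.2 ≤ ctil) :
    S.storage U c3 xs t₂ (x t₂) - S.storage U c3 xs t₁ (x t₁) ≤
      ∫ t in t₁..t₂, ((∑ j, w j t ^ 2) - (S.gain d c3)⁻¹ * ∑ j, ((x t).2.1 j) ^ 2) := by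
  classical
  have hC := S.contDiff_storage hU c3 xs
  have hsub : Set.Icc t₁ t₂ ⊆ Set.Icc 0 T := Set.Icc_subset_Icc h1 h2
  have hac : AbsolutelyContinuousOnInterval (fun t => S.storage U c3 xs t (x t)) t₁ t₂ := by
    refine (absolutelyContinuousOnInterval_along hC hx.1).mono ?_
    rwa [Set.uIcc_of_le h12, Set.uIcc_of_le hT.le]
  -- Absolute continuity turns the increment into the integral of the derivative, so an almost
  -- everywhere bound suffices.
  rw [← hac.integral_deriv_eq_sub]
  refine intervalIntegral.integral_mono_ae_restrict h12 hac.intervalIntegrable_deriv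
    ((intervalIntegrable_sum_sq hT hw h1 h12 h2).sub
      ((hx.intervalIntegrable_omega hT h1 h12 h2).const_mul _)) ?_
  filter_upwards [ae_restrict_of_ae_restrict_of_subset hsub hx.2,
    ae_restrict_mem measurableSet_Icc] with t ht htm
  have hder := hasDerivAt_along (W := S.storage U c3 xs) (c := fun s => s) (γ := x) (s := t)
    (hC.differentiable one_ne_zero _) (hasDerivAt_id t) ht
  rw [hder.deriv]
  exact h.derivAlong_storage_le_gain hU hc hd (h1.trans htm.1) (fun j => w j t) (hreg t htm)

theorem V1_nonneg (xs x : S.State) : 0 ≤ S.V1 xs x := by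
  have h1 : 0 ≤ ∑ e : {e : V × V // e ∈ S.lines}, S.B e.1 * (x.1 e - xs.1 e) ^ 2 :=
    Finset.sum_nonneg fun e _ => mul_nonneg (S.B_pos e.1 e.2).le (sq_nonneg _)
  have h2 : 0 ≤ ∑ j, S.M j * (x.2.1 j - xs.2.1 j) ^ 2 :=
    Finset.sum_nonneg fun j _ => mul_nonneg (S.M_pos j).le (sq_nonneg _)
  have h3 : 0 ≤ ∑ j, (x.2.2.1 j - xs.2.2.1 j) ^ 2 := Finset.sum_nonneg fun j _ => sq_nonneg _
  unfold V1
  positivity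

theorem IsLyapunov.V2_nonneg {U : ∀ j, ℝ → Nu (S.s j) → ℝ} {b : V → ℝ} (hU : S.IsLyapunov U b)
    {t : ℝ} (ht : 0 ≤ t) (ν : ∀ j, Nu (S.s j)) : 0 ≤ S.V2 U t ν :=
  Finset.sum_nonneg fun j _ => hU.nonneg j ht (ν j)

/-- Discarding V₁ ≥ 0. This is the origin of the factor c₃² in the energy budget. -/
theorem V2_le_storage {U : ∀ j, ℝ → Nu (S.s j) → ℝ} {c3 : ℝ} (hc3 : 0 < c3) (xs : S.State)
    (t : ℝ) (x : S.State) : S.V2 U t x.2.2.2 ≤ c3 ^ 2 * S.storage U c3 xs t x := by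
  have h : c3 ^ 2 * S.storage U c3 xs t x = c3 * S.V1 xs x + S.V2 U t x.2.2.2 := by
    rw [storage]; field_simp
  rw [h]
  have := mul_nonneg hc3.le (S.V1_nonneg xs x)
  linarith

theorem IsLyapunov.storage_nonneg {U : ∀ j, ℝ → Nu (S.s j) → ℝ} {b : V → ℝ}
    (hU : S.IsLyapunov U b) {c3 : ℝ} (hc3 : 0 < c3) (xs : S.State) {t : ℝ} (ht : 0 ≤ t)
    (x : S.State) : 0 ≤ S.storage U c3 xs t x :=
  add_nonneg (div_nonneg (S.V1_nonneg xs x) hc3.le)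
    (div_nonneg (hU.V2_nonneg ht _) (sq_nonneg _))

theorem IsEquilibrium.storage_self {U : ∀ j, ℝ → Nu (S.s j) → ℝ} {b d : V → ℝ} {xs : S.State}
    (h : S.IsEquilibrium d xs) (hU : S.IsLyapunov U b) (c3 : ℝ) : S.storage U c3 xs 0 xs = 0 := by
  simp [storage, V1, V2, h.nu_eq_zero hU, hU.apply_zero]

/-- A trajectory with a small energy budget does not leave the region. -/
theorem IsTrajectory.V2_le {U : ∀ j, ℝ → Nu (S.s j) → ℝ} {b d : V → ℝ} {xs : S.State}
    (h : S.IsEquilibrium d xs) (hU : S.IsLyapunov U b) {ctil cbar phibar c2 c3 : ℝ}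
    (hc : S.Constants U b ctil cbar phibar c2 c3) (hd : S.GainAssumption d c3)
    {w : V → ℝ → ℝ} {T : ℝ} (hT : 0 < T)
    (hw : ∀ j, MemLp (w j) 2 (volume.restrict (Set.Ioc 0 T)))
    {x : ℝ → S.State} (hx : S.IsTrajectory d w T x)
    (hlt : c3 ^ 2 * (S.storage U c3 xs 0 (x 0) + ∫ t in (0 : ℝ)..T, ∑ j, w j t ^ 2) < ctil) :
    ∀ t ∈ Set.Icc 0 T, S.V2 U t (x t).2.2.2 ≤ ctil := by
  have hc3 := hc.c3_gt_one
  have hc0 : 0 < c3 := by linarith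
  have hcont : ContinuousOn (fun t => S.V2 U t (x t).2.2.2) (Set.Icc 0 T) :=
    (S.contDiff_V2 hU).continuous.comp_continuousOn
      (continuousOn_id.prodMk (hx.continuousOn hT))
  have hg : 0 ≤ (S.gain d c3)⁻¹ := zero_le_one.trans (hd.one_lt_inv_gain hc3).le
  -- Bootstrap: staying in the closed region up to τ gives the strict inequality at τ, because
  -- dissipation keeps the storage within the budget.
  have hstep : ∀ τ ∈ Set.Icc 0 T, (∀ t ∈ Set.Icc 0 τ, S.V2 U t (x t).2.2.2 ≤ ctil) →
      S.V2 U τ (x τ).2.2.2 < ctil := by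
    intro τ hτ hreg
    have h1 := hx.storage_sub_le h hU hc hd hT hw le_rfl hτ.1 hτ.2 hreg
    have hiw := intervalIntegrable_sum_sq hT hw le_rfl hτ.1 hτ.2
    have hiω := hx.intervalIntegrable_omega hT le_rfl hτ.1 hτ.2
    have h2 : ∫ t in (0 : ℝ)..τ, ((∑ j, w j t ^ 2)
        - (S.gain d c3)⁻¹ * ∑ j, ((x t).2.1 j) ^ 2) ≤ ∫ t in (0 : ℝ)..τ, ∑ j, w j t ^ 2 := by
      refine intervalIntegral.integral_mono_on hτ.1 (hiw.sub (hiω.const_mul _)) hiw fun t _ => ?_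
      have : 0 ≤ ∑ j, ((x t).2.1 j) ^ 2 := Finset.sum_nonneg fun _ _ => sq_nonneg _
      have := mul_nonneg hg this
      linarith
    have h3 : ∫ t in (0 : ℝ)..τ, ∑ j, w j t ^ 2 ≤ ∫ t in (0 : ℝ)..T, ∑ j, w j t ^ 2 := by
      refine intervalIntegral.integral_mono_interval le_rfl hτ.1 hτ.2 ?_
        (intervalIntegrable_sum_sq hT hw le_rfl hT.le le_rfl)
      exact Filter.Eventually.of_forall fun t => Finset.sum_nonneg fun _ _ => sq_nonneg _
    refine (V2_le_storage hc0 xs τ (x τ)).trans_lt (lt_of_le_of_lt ?_ hlt)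
    gcongr
    linarith
  have h0 : S.V2 U 0 (x 0).2.2.2 < ctil := by
    refine (V2_le_storage hc0 xs 0 (x 0)).trans_lt (lt_of_le_of_lt ?_ hlt)
    have : 0 ≤ ∫ t in (0 : ℝ)..T, ∑ j, w j t ^ 2 :=
      intervalIntegral.integral_nonneg hT.le fun t _ => Finset.sum_nonneg fun _ _ => sq_nonneg _
    gcongr
    linarith
  intro t ht
  by_contra! hgt
  -- Compactness provides a first time at which the level `ctil` is reached; the bootstrap
  -- contradicts it.
  have hcl : IsCompact (Set.Icc 0 t ∩ (fun τ => S.V2 U τ (x τ).2.2.2) ⁻¹' Set.Ici ctil) := by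
    have hct := hcont.mono (Set.Icc_subset_Icc le_rfl ht.2)
    exact (isCompact_Icc).of_isClosed_subset
      (hct.preimage_isClosed_of_isClosed isClosed_Icc isClosed_Ici) Set.inter_subset_left
  obtain ⟨τ, ⟨hτ1, hτ2⟩, hmin⟩ := hcl.exists_isLeast ⟨t, ⟨ht.1, le_rfl⟩, hgt.le⟩
  have hτ : τ ∈ Set.Icc 0 T := ⟨hτ1.1, hτ1.2.trans ht.2⟩
  have hbelow : ∀ σ ∈ Set.Ico 0 τ, S.V2 U σ (x σ).2.2.2 ≤ ctil := by
    intro σ hσ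
    by_contra! hlt'
    exact absurd (hmin ⟨⟨hσ.1, (hσ.2.trans_le hτ1.2).le⟩, hlt'.le⟩) (not_le.mpr hσ.2)
  have hτ0 : 0 < τ := by
    rcases hτ1.1.eq_or_lt with h' | h'
    · rw [← h'] at hτ2
      exact absurd hτ2 (not_le.mpr h0)
    · exact h'
  have hτle : ∀ σ ∈ Set.Icc 0 τ, S.V2 U σ (x σ).2.2.2 ≤ ctil := by
    have hct := hcont.mono (Set.Icc_subset_Icc le_rfl hτ.2)
    have hcl' : closure (Set.Ico 0 τ) = Set.Icc 0 τ := closure_Ico hτ0.ne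
    intro σ hσ
    rw [← hcl'] at hct hσ
    have hsub : (fun τ => S.V2 U τ (x τ).2.2.2) '' Set.Ico 0 τ ⊆ Set.Iic ctil := by
      rintro _ ⟨σ', hσ', rfl⟩
      exact hbelow σ' hσ'
    exact closure_minimal hsub isClosed_Iic
      (hct.image_closure ⟨σ, hσ, rfl⟩)
  exact absurd hτ2 (not_le.mpr (hstep τ hτ hτle))

/-- The `L₂`-gain estimate. -/
theorem IsTrajectory.integral_omega_le {U : ∀ j, ℝ → Nu (S.s j) → ℝ} {b d : V → ℝ} {xs : S.State}
    (h : S.IsEquilibrium d xs) (hU : S.IsLyapunov U b) {ctil cbar phibar c2 c3 : ℝ}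
    (hc : S.Constants U b ctil cbar phibar c2 c3) (hd : S.GainAssumption d c3)
    {w : V → ℝ → ℝ} {T : ℝ} (hT : 0 < T)
    (hw : ∀ j, MemLp (w j) 2 (volume.restrict (Set.Ioc 0 T)))
    {x : ℝ → S.State} (hx : S.IsTrajectory d w T x)
    (hreg : ∀ t ∈ Set.Icc 0 T, S.V2 U t (x t).2.2.2 ≤ ctil) :
    (∫ t in (0 : ℝ)..T, ∑ j, ((x t).2.1 j) ^ 2) ≤
      S.gain d c3 * (∫ t in (0 : ℝ)..T, ∑ j, w j t ^ 2)
        + S.gain d c3 * S.storage U c3 xs 0 (x 0) := by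
  have hc3 := hc.c3_gt_one
  have hg : 0 < S.gain d c3 := inv_pos.mp (zero_lt_one.trans (hd.one_lt_inv_gain hc3))
  have h1 := hx.storage_sub_le h hU hc hd hT hw le_rfl hT.le le_rfl hreg
  have h2 := hU.storage_nonneg (by linarith : 0 < c3) xs hT.le (x T)
  rw [intervalIntegral.integral_sub (intervalIntegrable_sum_sq hT hw le_rfl hT.le le_rfl)
    ((hx.intervalIntegrable_omega hT le_rfl hT.le le_rfl).const_mul _),
    intervalIntegral.integral_const_mul] at h1
  have h3 : (S.gain d c3)⁻¹ * (∫ t in (0 : ℝ)..T, ∑ j, ((x t).2.1 j) ^ 2) ≤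
      (∫ t in (0 : ℝ)..T, ∑ j, w j t ^ 2) + S.storage U c3 xs 0 (x 0) := by linarith
  rw [inv_mul_le_iff₀ hg] at h3
  linarith

/-- Admissible constants exist as soon as the exosystem states are bounded. -/
theorem IsLyapunov.exists_constants {U : ∀ j, ℝ → Nu (S.s j) → ℝ} {b : V → ℝ}
    (hU : S.IsLyapunov U b) (hφ : ∀ j, ∃ C, ∀ t, vecNorm (S.phi j t) ≤ C) {ctil : ℝ} :
    ∃ cbar phibar c2 c3 : ℝ, S.Constants U b ctil cbar phibar c2 c3 := by
  have hbound : ∀ f : V → ℝ, ∃ C, ∀ j, f j ≤ C := fun f =>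
    ⟨∑ j, |f j|, fun j => (le_abs_self _).trans
      (Finset.single_le_sum (f := fun j => |f j|) (fun _ _ => abs_nonneg _) (Finset.mem_univ j))⟩
  choose Cφ hCφ using hφ
  have hr : ∀ j, ∃ ϱ : ℝ, ∀ t, 0 ≤ t → ∀ ν, U j t ν ≤ ctil → ‖ν‖ ≤ ϱ := by
    intro j
    obtain ⟨_, _, ⟨Ul, Uu, hl, _, hb⟩, _⟩ := hU j
    -- The level is raised by 1 because radial unboundedness yields only a non-strict inequality.
    obtain ⟨ϱ, hϱ⟩ := hl.2.2.2 (ctil + 1)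
    refine ⟨ϱ, fun t ht ν hν => ?_⟩
    by_contra! hlt
    have h1 := hϱ ν hlt.le
    have h2 := (hb t ht ν).1
    linarith
  choose ϱ hϱ using hr
  obtain ⟨cbar, hcbar⟩ := hbound ϱ
  obtain ⟨phibar, hphibar⟩ := hbound Cφ
  obtain ⟨c2, hc2⟩ := hbound fun j => vecNorm (rowR (S.r j)) * phibar + vecNorm (rowR (S.r j))
    + vecNorm (rowR (S.r j) ᵥ* matA (S.α j))
  obtain ⟨k1, hk1⟩ := hbound fun j => b j * (1 + cbar ^ 2)
  obtain ⟨k2, hk2⟩ := hbound fun j => S.M j + vecNorm (colG (S.s j) S.g) * S.M j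
      + S.kα * S.M j * (cbar + phibar)
  refine ⟨cbar, phibar, c2, max (max 2 (c2 * (1 + cbar))) (max k1 k2), ?_, ?_, hc2, ?_, ?_, ?_, ?_⟩
  · intro t ht ν hν j
    refine (hϱ j t ht (ν j) (le_trans ?_ hν)).trans (hcbar j)
    exact Finset.single_le_sum (f := fun j => U j t (ν j)) (fun j _ => hU.nonneg j ht (ν j))
      (Finset.mem_univ j)
  · exact fun j t _ => (hCφ j t).trans (hphibar j)
  · exact one_lt_two.trans_le ((le_max_left _ _).trans (le_max_left _ _))
  · exact (le_max_right _ _).trans (le_max_left _ _)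
  · exact fun j => (hk1 j).trans ((le_max_left _ _).trans (le_max_right _ _))
  · exact fun j => (hk2 j).trans ((le_max_right _ _).trans (le_max_right _ _))

end Model

theorem vecNorm_le_sum {ι : Type*} [Fintype ι] (v : ι → ℝ) : vecNorm v ≤ ∑ i, |v i| := by
  have h0 : 0 ≤ ∑ i, |v i| := Finset.sum_nonneg fun _ _ => abs_nonneg _
  refine (abs_le_of_sq_le_sq' ?_ h0).2
  rw [vecNorm_sq, sq, Finset.sum_mul]
  refine Finset.sum_le_sum fun i _ => ?_
  rw [← sq_abs, sq]
  exact mul_le_mul_of_nonneg_left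
    (Finset.single_le_sum (f := fun i => |v i|) (fun _ _ => abs_nonneg _) (Finset.mem_univ i))
    (abs_nonneg _)

/-! ### Algebra of the exosystem: eigenvectors of A and invertibility of O. -/

section Exosystem

variable {s : ℕ}

/-- Vieta's formulas for the coefficients of the exosystem. -/
theorem pow_sub_sum_alphaCoef (a : Fin s → ℝ) (z : ℂ) :
    z ^ (2 * s) - ∑ k, (alphaCoef a k : ℂ) * z ^ (2 * (k : ℕ)) = ∏ l, (z ^ 2 + (a l : ℂ) ^ 2) := by
  have h1 : ∏ l, (z ^ 2 + (a l : ℂ) ^ 2) = ∑ j ∈ Finset.range (s + 1),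
      (∑ T ∈ Finset.powersetCard j (Finset.univ : Finset (Fin s)), ∏ l ∈ T, (a l : ℂ) ^ 2)
        * z ^ (2 * (s - j)) := by
    have hc : ∏ l, (z ^ 2 + (a l : ℂ) ^ 2) = ∏ l, ((a l : ℂ) ^ 2 + z ^ 2) :=
      Finset.prod_congr rfl fun _ _ => add_comm _ _
    rw [hc, Finset.prod_add, Finset.sum_powerset]
    simp only [Finset.card_univ, Fintype.card_fin]
    refine Finset.sum_congr rfl fun j _ => ?_
    rw [Finset.sum_mul]
    refine Finset.sum_congr rfl fun T hT => ?_
    rw [Finset.prod_const, Finset.card_sdiff_of_subset (Finset.subset_univ T),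
      (Finset.mem_powersetCard.mp hT).2, Finset.card_univ, Fintype.card_fin, ← pow_mul]
  -- Reversing the order of summation matches e_{s-k} with z^{2k}; the top term, with the empty
  -- subset, is z^{2s}.
  rw [h1, ← Finset.sum_range_reflect, Finset.sum_range_succ]
  simp only [add_tsub_cancel_right, Nat.sub_self, Finset.powersetCard_zero, Finset.sum_singleton,
    Finset.prod_empty, one_mul, Nat.sub_zero]
  rw [sub_eq_iff_eq_add, add_right_comm, eq_comm, add_eq_right, Finset.sum_range,
    ← Finset.sum_add_distrib]
  refine Finset.sum_eq_zero fun k _ => ?_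
  have hk : s - (s - (k : ℕ)) = k := by have := k.isLt; omega
  rw [hk, alphaCoef]
  push_cast
  ring

/-- The vector of imaginary parts of `c, z c, z² c, …`. -/
def imVec (s : ℕ) (z c : ℂ) : Fin (2 * s + 1) → ℝ := fun i => (z ^ (i : ℕ) * c).im

/-- For a characteristic root z, the vector (1, z, z², …) is an eigenvector of the companion matrix.
Since A is real, imaginary parts may be taken. -/
theorem matA_mulVec_imVec {α : Fin s → ℝ} {z : ℂ}
    (hz : z * (z ^ (2 * s) - ∑ k, (α k : ℂ) * z ^ (2 * (k : ℕ))) = 0) (c : ℂ) :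
    matA α *ᵥ imVec s z c = imVec s z (z * c) := by
  ext i
  induction i using Fin.lastCases with
  | last =>
    rw [matA_mulVec_last]
    have h : z ^ (2 * s) * (z * c) = ∑ k, (α k : ℂ) * (z ^ (2 * (k : ℕ) + 1) * c) := by
      have h2 : z * z ^ (2 * s) = ∑ k, (α k : ℂ) * z ^ (2 * (k : ℕ) + 1) := by
        rw [mul_sub, sub_eq_zero] at hz
        rw [hz, Finset.mul_sum]
        exact Finset.sum_congr rfl fun k _ => by ring
      calc z ^ (2 * s) * (z * c) = (z * z ^ (2 * s)) * c := by ring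
        _ = _ := by
          rw [h2, Finset.sum_mul]
          exact Finset.sum_congr rfl fun k _ => by ring
    simp only [imVec, Fin.val_last, dotProduct, vecLam]
    rw [h, Complex.im_sum]
    exact Finset.sum_congr rfl fun k _ => by rw [Complex.im_ofReal_mul]
  | cast i =>
    have := matA_mulVec_of_lt α (imVec s z c) i i.isLt
    have h2 : (⟨(i : ℕ), by omega⟩ : Fin (2 * s + 1)) = i.castSucc := rfl
    rw [h2] at this
    rw [this]
    simp only [imVec, Fin.val_castSucc]
    congr 1
    ring

/-- The polynomial with coefficients `r`, as a function. -/
def evalR (r : Fin (2 * s) → ℝ) (z : ℂ) : ℂ := z ^ (2 * s) + ∑ i, (r i : ℂ) * z ^ (i : ℕ)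

theorem rowR_dotProduct_imVec (r : Fin (2 * s) → ℝ) (z c : ℂ) :
    rowR r ⬝ᵥ imVec s z c = (evalR r z * c).im := by
  rw [dotProduct, Fin.sum_univ_castSucc, evalR, add_mul, add_comm, Complex.add_im, Finset.sum_mul,
    Complex.im_sum]
  simp only [rowR, Fin.snoc_last, Fin.snoc_castSucc, imVec, Fin.val_last, one_mul,
    Fin.val_castSucc]
  congr 1
  exact Finset.sum_congr rfl fun i _ => by rw [mul_assoc, Complex.im_ofReal_mul]

theorem imVec_add (z c c' : ℂ) : imVec s z (c + c') = imVec s z c + imVec s z c' := by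
  ext i; simp only [imVec, mul_add, Complex.add_im, Pi.add_apply]

theorem matA_pow_mulVec_imVec {α : Fin s → ℝ} {z : ℂ}
    (hz : z * (z ^ (2 * s) - ∑ k, (α k : ℂ) * z ^ (2 * (k : ℕ))) = 0) (c : ℂ) (n : ℕ) :
    matA α ^ n *ᵥ imVec s z c = imVec s z (z ^ n * c) := by
  induction n with
  | zero => simp
  | succ n ih =>
    rw [pow_succ', ← mulVec_mulVec, ih, matA_mulVec_imVec hz]
    congr 1; ring

/-- On an eigenmode, R(I + A)Aⁱ acts as multiplication by p_R(z)(1 + z)zⁱ, so O only rescales the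
amplitude of the mode. -/
theorem matO_mulVec_imVec (r : Fin (2 * s) → ℝ) {α : Fin s → ℝ} {z : ℂ}
    (hz : z * (z ^ (2 * s) - ∑ k, (α k : ℂ) * z ^ (2 * (k : ℕ))) = 0) (c : ℂ) :
    matO r α *ᵥ imVec s z c = imVec s z ((1 + z) * evalR r z * c) := by
  ext i
  have h : (matO r α *ᵥ imVec s z c) i = (rowAt r α ᵥ* matA α ^ (i : ℕ)) ⬝ᵥ imVec s z c := rfl
  rw [h, ← dotProduct_mulVec, matA_pow_mulVec_imVec hz, rowAt, ← dotProduct_mulVec, add_mulVec,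
    one_mulVec, matA_mulVec_imVec hz, ← imVec_add, rowR_dotProduct_imVec, imVec]
  congr 1; ring

open Polynomial in
/-- The polynomial `τ^{2s} + r_{2s} τ^{2s-1} + ⋯ + r₁`. -/
def polyR (r : Fin (2 * s) → ℝ) : ℝ[X] := X ^ (2 * s) + ∑ i, C (r i) * X ^ (i : ℕ)

open Polynomial in
/-- The characteristic polynomial of `A(α)`. -/
def polyA (α : Fin s → ℝ) : ℝ[X] := X ^ (2 * s + 1) - ∑ k, C (α k) * X ^ (2 * (k : ℕ) + 1)

theorem aeval_polyR (r : Fin (2 * s) → ℝ) (z : ℂ) : Polynomial.aeval z (polyR r) = evalR r z := by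
  simp [polyR, evalR]

theorem aeval_polyA (α : Fin s → ℝ) (z : ℂ) : Polynomial.aeval z (polyA α) =
    z * (z ^ (2 * s) - ∑ k, (α k : ℂ) * z ^ (2 * (k : ℕ))) := by
  simp only [polyA, map_sub, map_pow, Polynomial.aeval_X, map_sum, map_mul, Polynomial.aeval_C,
    Complex.coe_algebraMap, mul_sub, Finset.mul_sum]
  congr 1
  · ring
  · exact Finset.sum_congr rfl fun k _ => by ring

/-- The superdiagonal shifts basis rows, so the first one is cyclic. -/
theorem single_zero_vecMul_matA_pow (α : Fin s → ℝ) (i : ℕ) (hi : i < 2 * s + 1) :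
    (Pi.single 0 1 : Fin (2 * s + 1) → ℝ) ᵥ* matA α ^ i = Pi.single ⟨i, hi⟩ 1 := by
  induction i with
  | zero => rw [pow_zero, vecMul_one]; rfl
  | succ i ih =>
    rw [pow_succ, ← vecMul_vecMul, ih (by omega), single_one_vecMul]
    ext j
    have h : i < 2 * s := by omega
    simp only [row, matA, of_apply, h, if_true, Pi.single_apply, Fin.ext_iff]

theorem single_zero_vecMul_aeval_polyR (r : Fin (2 * s) → ℝ) (α : Fin s → ℝ) :
    (Pi.single 0 1 : Fin (2 * s + 1) → ℝ) ᵥ* Polynomial.aeval (matA α) (polyR r) = rowR r := by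
  simp only [polyR, map_add, map_pow, Polynomial.aeval_X, map_sum, map_mul, Polynomial.aeval_C,
    vecMul_add, vecMul_sum, Algebra.algebraMap_eq_smul_one, smul_mul_assoc, one_mul, vecMul_smul]
  rw [single_zero_vecMul_matA_pow α (2 * s) (by omega)]
  have h : ∀ i : Fin (2 * s), (Pi.single 0 1 : Fin (2 * s + 1) → ℝ) ᵥ* matA α ^ (i : ℕ) =
      Pi.single i.castSucc 1 := fun i =>
    single_zero_vecMul_matA_pow α i (by omega)
  simp only [h]
  ext j
  induction j using Fin.lastCases with
  | last =>
    have : (⟨2 * s, by omega⟩ : Fin (2 * s + 1)) = Fin.last (2 * s) := rfl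
    have hne : ∀ i : Fin (2 * s), Fin.last (2 * s) ≠ i.castSucc := fun i =>
      (Fin.castSucc_lt_last i).ne'
    simp [rowR, this, hne]
  | cast j =>
    have : (⟨2 * s, by omega⟩ : Fin (2 * s + 1)) = Fin.last (2 * s) := rfl
    simp [rowR, this, Pi.single_apply, Fin.castSucc_ne_last]

theorem single_zero_vecMul_aeval_polyA (α : Fin s → ℝ) :
    (Pi.single 0 1 : Fin (2 * s + 1) → ℝ) ᵥ* Polynomial.aeval (matA α) (polyA α) = 0 := by
  simp only [polyA, map_sub, map_pow, Polynomial.aeval_X, map_sum, map_mul, Polynomial.aeval_C,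
    vecMul_sub, vecMul_sum, Algebra.algebraMap_eq_smul_one, smul_mul_assoc, one_mul, vecMul_smul]
  have h : ∀ k : Fin s, (Pi.single 0 1 : Fin (2 * s + 1) → ℝ) ᵥ* matA α ^ (2 * (k : ℕ) + 1) =
      Pi.single ⟨2 * (k : ℕ) + 1, by have := k.isLt; omega⟩ 1 := fun k =>
    single_zero_vecMul_matA_pow α _ _
  simp only [h]
  rw [pow_succ, ← vecMul_vecMul, single_zero_vecMul_matA_pow α (2 * s) (by omega),
    single_one_vecMul]
  ext j
  simp [row, matA, Pi.single_apply, Fin.ext_iff]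

/-- By cyclicity and commutation, e₀AⁱP(A) = e₀P(A)Aⁱ: a polynomial in A is determined by its first
row. This gives both Cayley–Hamilton for A and the formula for O. -/
theorem row_eq_single_zero_vecMul (α : Fin s → ℝ) (P : Polynomial ℝ) (i : Fin (2 * s + 1)) :
    (Polynomial.aeval (matA α) P).row i =
      ((Pi.single 0 1 : Fin (2 * s + 1) → ℝ) ᵥ* Polynomial.aeval (matA α) P) ᵥ*
        matA α ^ (i : ℕ) := by
  have hc : Polynomial.aeval (matA α) P * matA α ^ (i : ℕ) =
      matA α ^ (i : ℕ) * Polynomial.aeval (matA α) P := by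
    have := Polynomial.aeval_X_pow (R := ℝ) (n := (i : ℕ)) (matA α)
    rw [← this, ← map_mul, ← map_mul, mul_comm P]
  rw [vecMul_vecMul, hc, ← vecMul_vecMul, single_zero_vecMul_matA_pow α i i.isLt,
    single_one_vecMul]

theorem aeval_polyA_matA (α : Fin s → ℝ) : Polynomial.aeval (matA α) (polyA α) = 0 := by
  ext i j
  have := row_eq_single_zero_vecMul α (polyA α) i
  rw [single_zero_vecMul_aeval_polyA, zero_vecMul] at this
  exact congrFun this j

theorem matO_eq_aeval (r : Fin (2 * s) → ℝ) (α : Fin s → ℝ) :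
    matO r α = Polynomial.aeval (matA α) (polyR r * (1 + Polynomial.X)) := by
  ext i j
  have hrow : (Pi.single 0 1 : Fin (2 * s + 1) → ℝ) ᵥ*
      Polynomial.aeval (matA α) (polyR r * (1 + Polynomial.X)) = rowAt r α := by
    rw [map_mul, ← vecMul_vecMul, single_zero_vecMul_aeval_polyR, map_add, map_one,
      Polynomial.aeval_X, rowAt]
  have := row_eq_single_zero_vecMul α (polyR r * (1 + Polynomial.X)) i
  rw [hrow] at this
  exact (congrFun this j).symm

/-- The roots of p_R(τ)(1 + τ) have negative real part, while those of the characteristic polynomial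
are 0 and ±i a_l. A Bézout identity evaluated at A inverts O. -/
theorem isUnit_matO {r : Fin (2 * s) → ℝ} (hr : ∀ z : ℂ, evalR r z = 0 → z.re < 0)
    (a : Fin s → ℝ) : IsUnit (matO r (alphaCoef a)) := by
  have hcop : IsCoprime (polyR r * (1 + Polynomial.X)) (polyA (alphaCoef a)) := by
    rw [Polynomial.isCoprime_iff_aeval_ne_zero_of_isAlgClosed ℝ ℂ]
    intro z
    by_contra! h
    obtain ⟨h1, h2⟩ := h
    have hre : z.re < 0 := by
      rw [map_mul, mul_eq_zero, aeval_polyR] at h1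
      rcases h1 with h1 | h1
      · exact hr z h1
      · have : z = -1 := by
          simp only [map_add, map_one, Polynomial.aeval_X] at h1
          linear_combination h1
        rw [this]; simp
    rw [aeval_polyA, pow_sub_sum_alphaCoef, mul_eq_zero, Finset.prod_eq_zero_iff] at h2
    rcases h2 with h2 | ⟨l, _, h2⟩
    · rw [h2] at hre; simp at hre
    · have h3 : (z - Complex.I * a l) * (z + Complex.I * a l) = 0 := by
        linear_combination h2 - (a l : ℂ) ^ 2 * (Complex.I_sq)
      rcases mul_eq_zero.mp h3 with h4 | h4
      · rw [sub_eq_zero] at h4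
        rw [h4] at hre; simp at hre
      · rw [add_eq_zero_iff_eq_neg] at h4
        rw [h4] at hre; simp at hre
  obtain ⟨u, v, huv⟩ := hcop
  have h := congrArg (Polynomial.aeval (matA (alphaCoef a))) huv
  rw [map_add, map_mul, map_mul _ v, aeval_polyA_matA, mul_zero, add_zero, ← matO_eq_aeval,
    map_one] at h
  exact IsUnit.of_mul_eq_one_right _ h

theorem hasDerivAt_imVec_exp (z c : ℂ) (i : ℕ) (t : ℝ) :
    HasDerivAt (fun t : ℝ => (z ^ i * (c * Complex.exp (z * t))).im)
      (z ^ (i + 1) * (c * Complex.exp (z * t))).im t := by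
  have h1 : HasDerivAt (fun t : ℝ => z * (t : ℂ)) z t := by
    simpa using (Complex.ofRealCLM.hasDerivAt (x := t)).const_mul z
  have h2 := (h1.cexp.const_mul c).const_mul (z ^ i)
  have h3 := Complex.imCLM.hasFDerivAt.comp_hasDerivAt t h2
  refine h3.congr_deriv ?_
  simp only [Complex.imCLM_apply]
  congr 1; ring

end Exosystem

/-! ### The exosystem state as a trigonometric sum. -/

namespace Model

variable {V : Type*} [Fintype V] (S : Model V)

theorem evalR_ne_zero (j : V) {z : ℂ} (hz : 0 ≤ z.re) : evalR (S.r j) z ≠ 0 := fun h =>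
  absurd (S.r_hurwitz j z h) (not_lt.mpr hz)

/-- The frequencies of the exosystem, on the imaginary axis. -/
def imFreq (j : V) (k : Fin (S.s j)) : ℂ := Complex.I * S.freq j k

/-- The complex amplitudes of the power variation. -/
def cAmp (j : V) (k : Fin (S.s j)) : ℂ := S.amp j k * Complex.exp (Complex.I * S.phase j k)

/-- The offset is treated as a mode of frequency 0 and amplitude i q₀, with 0⁰ = 1, so that it fits
the eigenvector calculus. -/
theorem iteratedDeriv_q (j : V) (i : ℕ) (t : ℝ) : iteratedDeriv i (S.q j) t =
    ((0 : ℂ) ^ i * (Complex.I * S.q0 j)).im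
      + ∑ k, (S.imFreq j k ^ i * (S.cAmp j k * Complex.exp (S.imFreq j k * t))).im := by
  induction i generalizing t with
  | zero =>
    simp only [iteratedDeriv_zero, q, pow_zero, one_mul]
    congr 1
    · simp
    · refine Finset.sum_congr rfl fun k _ => ?_
      have h : S.cAmp j k * Complex.exp (S.imFreq j k * t) =
          S.amp j k * Complex.exp ((S.freq j k * t + S.phase j k : ℝ) * Complex.I) := by
        rw [cAmp, imFreq, mul_assoc, ← Complex.exp_add]
        congr 2
        push_cast
        ring
      rw [h, Complex.im_ofReal_mul, Complex.exp_ofReal_mul_I_im]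
  | succ i ih =>
    rw [iteratedDeriv_succ, funext ih]
    have h := (HasDerivAt.fun_sum (u := Finset.univ) fun (k : Fin (S.s j)) _ =>
      hasDerivAt_imVec_exp (S.imFreq j k) (S.cAmp j k) i t).const_add
        ((0 : ℂ) ^ i * (Complex.I * S.q0 j)).im
    rw [h.deriv]
    simp

/-- The complex amplitudes of the exosystem state. -/
def phiAmp (j : V) (k : Fin (S.s j)) : ℂ :=
  S.cAmp j k / ((1 + S.imFreq j k) * evalR (S.r j) (S.imFreq j k))

theorem one_add_mul_evalR_ne_zero (j : V) {z : ℂ} (hz : z.re = 0) :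
    (1 + z) * evalR (S.r j) z ≠ 0 := by
  refine mul_ne_zero (fun h => ?_) (S.evalR_ne_zero j hz.ge)
  have := congrArg Complex.re h
  simp [hz] at this

theorem imFreq_re (j : V) (k : Fin (S.s j)) : (S.imFreq j k).re = 0 := by simp [imFreq]

/-- O multiplies each mode by (1 + z)p_R(z), which is nonzero on the imaginary axis; inverting O
divides the amplitudes by these factors. -/
theorem phi_eq (j : V) (t : ℝ) : S.phi j t =
    imVec (S.s j) 0 (Complex.I * S.q0 j / ((1 + 0) * evalR (S.r j) 0))
      + ∑ k, imVec (S.s j) (S.imFreq j k)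
        (S.phiAmp j k * Complex.exp (S.imFreq j k * t)) := by
  have hlam : S.lam j t = matO (S.r j) (S.α j) *ᵥ
      (imVec (S.s j) 0 (Complex.I * S.q0 j / ((1 + 0) * evalR (S.r j) 0))
      + ∑ k, imVec (S.s j) (S.imFreq j k)
        (S.phiAmp j k * Complex.exp (S.imFreq j k * t))) := by
    rw [mulVec_add, mulVec_sum, matO_mulVec_imVec _ (by simp),
      mul_div_cancel₀ _ (S.one_add_mul_evalR_ne_zero j (by simp))]
    ext i
    rw [lam, iteratedDeriv_q, Pi.add_apply, Finset.sum_apply]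
    congr 1
    refine Finset.sum_congr rfl fun k _ => ?_
    rw [matO_mulVec_imVec, phiAmp, ← mul_assoc (_ * evalR _ _),
      mul_div_cancel₀ _ (S.one_add_mul_evalR_ne_zero j (S.imFreq_re j k)), imVec]
    rw [α, pow_sub_sum_alphaCoef, mul_eq_zero, Finset.prod_eq_zero_iff]
    refine Or.inr ⟨k, Finset.mem_univ k, ?_⟩
    rw [imFreq, mul_pow, Complex.I_sq]
    ring
  have hu : IsUnit (matO (S.r j) (S.α j)) := isUnit_matO (fun z => S.r_hurwitz j z) (S.freq j)
  rw [phi, hlam, mulVec_mulVec, nonsing_inv_mul _ ((isUnit_iff_isUnit_det _).mp hu), one_mulVec]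

theorem norm_exp_imFreq (j : V) (k : Fin (S.s j)) (t : ℝ) :
    ‖Complex.exp (S.imFreq j k * t)‖ = 1 := by
  rw [Complex.norm_exp]; simp [imFreq]

theorem exists_vecNorm_phi_le (j : V) : ∃ C, ∀ t, vecNorm (S.phi j t) ≤ C := by
  refine ⟨∑ i : Fin (2 * S.s j + 1),
    (|imVec (S.s j) 0 (Complex.I * S.q0 j / ((1 + 0) * evalR (S.r j) 0)) i|
      + ∑ k, ‖S.imFreq j k ^ (i : ℕ)‖ * ‖S.phiAmp j k‖), fun t => ?_⟩
  refine (vecNorm_le_sum _).trans (Finset.sum_le_sum fun i _ => ?_)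
  rw [phi_eq, Pi.add_apply, Finset.sum_apply]
  refine (abs_add_le _ _).trans (add_le_add le_rfl ((Finset.abs_sum_le_sum_abs _ _).trans
    (Finset.sum_le_sum fun k _ => ?_)))
  refine (Complex.abs_im_le_norm _).trans ?_
  rw [norm_mul, norm_mul, norm_exp_imFreq, mul_one]

/-- The regressor `Λ(φ)` is a combination of cosines with distinct frequencies and an
invertible coefficient matrix. -/
theorem exists_vecLam_phi_eq (j : V) :
    ∃ (W : Matrix (Fin (S.s j)) (Fin (S.s j)) ℝ) (ψ : Fin (S.s j) → ℝ),
      (∀ v, W *ᵥ v = 0 → v = 0) ∧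
      ∀ t k, vecLam (S.phi j t) k = ∑ l, W l k * Real.cos (S.freq j l * t + ψ l) := by
  refine ⟨Matrix.of fun l k => S.freq j l * ‖S.phiAmp j l‖ * (-(S.freq j l) ^ 2) ^ (k : ℕ),
    fun l => (S.phiAmp j l).arg, fun v hv => ?_, fun t k => ?_⟩
  -- W is a Vandermonde matrix in the distinct nodes -a_l², with rows scaled by nonzero factors
  -- since the amplitudes are nonzero.
  · refine eq_zero_of_forall_index_sum_pow_mul_eq_zero
      (f := fun l => -(S.freq j l) ^ 2) (fun l l' h => S.freq_inj j ?_) fun l => ?_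
    · have := S.freq_pos j l; have := S.freq_pos j l'
      simpa [sq_eq_sq₀ (S.freq_pos j l).le (S.freq_pos j l').le] using h
    · have h := congrFun hv l
      simp only [mulVec, dotProduct, of_apply, mul_assoc, ← Finset.mul_sum, Pi.zero_apply] at h
      refine (mul_eq_zero.mp ((mul_eq_zero.mp h).resolve_left (S.freq_pos j l).ne')).resolve_left ?_
      rw [norm_eq_zero, ← ne_eq]
      refine div_ne_zero (mul_ne_zero ?_ (Complex.exp_ne_zero _))
        (S.one_add_mul_evalR_ne_zero j (S.imFreq_re j l))
      exact_mod_cast S.amp_ne j l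
  · rw [vecLam, phi_eq, Pi.add_apply, Finset.sum_apply]
    simp only [imVec, of_apply]
    -- Λ reads only odd powers of the frequency, so the constant mode drops out; the leftover factor
    -- i in (i a)^{2k+1} turns sines into cosines.
    rw [zero_pow (by omega), zero_mul, Complex.zero_im, zero_add]
    refine Finset.sum_congr rfl fun l _ => ?_
    have h1 : S.imFreq j l ^ (2 * (k : ℕ) + 1) =
        ((S.freq j l * (-(S.freq j l) ^ 2) ^ (k : ℕ) : ℝ) : ℂ) * Complex.I := by
      rw [imFreq, pow_succ, pow_mul, mul_pow, Complex.I_sq]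
      push_cast
      ring
    have h2 : S.phiAmp j l * Complex.exp (S.imFreq j l * t) = (‖S.phiAmp j l‖ : ℂ) *
        Complex.exp ((S.freq j l * t + (S.phiAmp j l).arg : ℝ) * Complex.I) := by
      conv_lhs => rw [← Complex.norm_mul_exp_arg_mul_I (S.phiAmp j l)]
      rw [mul_assoc, ← Complex.exp_add, imFreq]
      congr 2
      push_cast
      ring
    rw [h1, h2, mul_assoc, Complex.im_ofReal_mul, Complex.I_mul_im, Complex.re_ofReal_mul,
      Complex.exp_ofReal_mul_I_re]
    ring

end Model

theorem isPosDefRadUnbdd_of_le {E : Type*} [NormedAddCommGroup E] {f : E → ℝ} (hf : Continuous f) (h0 : f 0 = 0) {c : ℝ}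
    (hc : 0 < c) (hle : ∀ v, c * ‖v‖ ^ 2 ≤ f v) : Model.IsPosDefRadUnbdd f := by
  refine ⟨hf, h0, fun v hv => lt_of_lt_of_le ?_ (hle v), fun K => ⟨|K| / c + 1, fun v hv => ?_⟩⟩
  · have := norm_pos_iff.mpr hv
    positivity
  · have h1 : 0 ≤ |K| / c := by positivity
    have h2 : |K| / c ≤ ‖v‖ ^ 2 := by nlinarith
    rw [div_le_iff₀ hc] at h2
    exact ((le_abs_self K).trans (by linarith)).trans (hle v)

/-! ### Functions of quadratic growth and the strict Lyapunov construction. -/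

section TVQuad

variable {E : Type*} [NormedAddCommGroup E] [NormedSpace ℝ E]

/-- A `C¹` function of time and state with the growth of a quadratic form, uniformly in time. -/
def IsTVQuad (W : ℝ → E → ℝ) : Prop :=
  ContDiff ℝ 1 (fun p : ℝ × E => W p.1 p.2) ∧
    ∃ C, 0 ≤ C ∧ ∀ t ν, |W t ν| ≤ C * ‖ν‖ ^ 2 ∧ ‖fderiv ℝ (fun v => W t v) ν‖ ≤ C * ‖ν‖

theorem differentiable_slice {W : ℝ → E → ℝ} (hW : ContDiff ℝ 1 (fun p : ℝ × E => W p.1 p.2))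
    (t : ℝ) : Differentiable ℝ (fun v => W t v) :=
  (hW.differentiable one_ne_zero).comp ((differentiable_const t).prodMk differentiable_id)

theorem differentiable_slice_time {W : ℝ → E → ℝ}
    (hW : ContDiff ℝ 1 (fun p : ℝ × E => W p.1 p.2)) (ν : E) :
    Differentiable ℝ (fun τ => W τ ν) :=
  (hW.differentiable one_ne_zero).comp (differentiable_id.prodMk (differentiable_const ν))

theorem IsTVQuad.add {W W' : ℝ → E → ℝ} (h : IsTVQuad W) (h' : IsTVQuad W') :
    IsTVQuad (fun t ν => W t ν + W' t ν) := by
  obtain ⟨hW, C, hC, hb⟩ := h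
  obtain ⟨hW', C', hC', hb'⟩ := h'
  refine ⟨hW.add hW', C + C', add_nonneg hC hC', fun t ν => ⟨?_, ?_⟩⟩
  · rw [add_mul]
    exact (abs_add_le _ _).trans (add_le_add (hb t ν).1 (hb' t ν).1)
  · rw [fderiv_fun_add (differentiable_slice hW t ν) (differentiable_slice hW' t ν), add_mul]
    exact (norm_add_le _ _).trans (add_le_add (hb t ν).2 (hb' t ν).2)

theorem isTVQuad_zero : IsTVQuad (fun (_ : ℝ) (_ : E) => (0 : ℝ)) :=
  ⟨contDiff_const, 0, le_rfl, fun t ν => by simp⟩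

theorem IsTVQuad.sum {ι : Type*} (u : Finset ι) {W : ι → ℝ → E → ℝ}
    (h : ∀ i ∈ u, IsTVQuad (W i)) : IsTVQuad (fun t ν => ∑ i ∈ u, W i t ν) := by
  classical
  induction u using Finset.induction_on with
  | empty => simpa using isTVQuad_zero
  | insert i u hi ih =>
    simp only [Finset.sum_insert hi]
    exact (h i (Finset.mem_insert_self i u)).add
      (ih fun k hk => h k (Finset.mem_insert_of_mem hk))

theorem isTVQuad_mul {f : ℝ → ℝ} (hf : ContDiff ℝ 1 f) {B : ℝ} (hB : ∀ t, |f t| ≤ B)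
    (p q : E →L[ℝ] ℝ) : IsTVQuad (fun t ν => f t * (p ν * q ν)) := by
  have hB0 : 0 ≤ B := (abs_nonneg _).trans (hB 0)
  refine ⟨?_, 2 * (B * (‖p‖ * ‖q‖)), by positivity, fun t ν => ⟨?_, ?_⟩⟩
  · exact (hf.comp contDiff_fst).mul
      ((p.contDiff.comp contDiff_snd).mul (q.contDiff.comp contDiff_snd))
  · have h1 := p.le_opNorm ν
    have h2 := q.le_opNorm ν
    rw [Real.norm_eq_abs] at h1 h2
    rw [abs_mul, abs_mul]
    calc |f t| * (|p ν| * |q ν|) ≤ B * ((‖p‖ * ‖ν‖) * (‖q‖ * ‖ν‖)) := by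
          gcongr
          exact hB t
      _ = B * (‖p‖ * ‖q‖) * ‖ν‖ ^ 2 := by ring
      _ ≤ 2 * (B * (‖p‖ * ‖q‖)) * ‖ν‖ ^ 2 := by
          have : 0 ≤ B * (‖p‖ * ‖q‖) * ‖ν‖ ^ 2 := by positivity
          linarith
  · have hd : HasFDerivAt (fun v => f t * (p v * q v)) (f t • (p ν • q + q ν • p)) ν :=
      (p.hasFDerivAt.mul q.hasFDerivAt).const_mul (f t)
    have h1 := p.le_opNorm ν
    have h2 := q.le_opNorm ν
    rw [hd.fderiv, norm_smul]
    calc ‖f t‖ * ‖p ν • q + q ν • p‖ ≤ B * ((‖p‖ * ‖ν‖) * ‖q‖ + (‖q‖ * ‖ν‖) * ‖p‖) := by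
          refine mul_le_mul (hB t) ((norm_add_le _ _).trans ?_) (norm_nonneg _) hB0
          rw [norm_smul, norm_smul]
          gcongr
      _ = 2 * (B * (‖p‖ * ‖q‖)) * ‖ν‖ := by ring

theorem isTVQuad_const_mul (c : ℝ) (p q : E →L[ℝ] ℝ) :
    IsTVQuad (fun (_ : ℝ) ν => c * (p ν * q ν)) :=
  isTVQuad_mul (f := fun _ => c) contDiff_const (fun _ => le_rfl) p q

/-- Construction of a strict Lyapunov function from a non-strict one, `W₀`, and an auxiliary
function `W₁`. -/
theorem exists_strict_lyapunov {F : ℝ → E → E} {W₀ W₁ : ℝ → E → ℝ} (h₀ : IsTVQuad W₀)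
    (h₁ : IsTVQuad W₁) {P A : E → ℝ} (hP : ∀ ν, 0 ≤ P ν) {c₀ m c C c₁ : ℝ}
    (hc₀ : 0 < c₀) (hm : 0 < m) (hC : 0 < C) (hc₁ : 0 < c₁)
    (hW₀ : ∀ t ν, c₀ * ‖ν‖ ^ 2 ≤ W₀ t ν)
    (hD₀ : ∀ t ν, deriv (fun τ => W₀ τ ν) t + fderiv ℝ (fun v => W₀ t v) ν (F t ν) ≤ -(m * P ν))
    (hD₁ : ∀ t ν, deriv (fun τ => W₁ τ ν) t + fderiv ℝ (fun v => W₁ t v) ν (F t ν) ≤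
      -(c * A ν) + C * (P ν * (1 + ‖ν‖ ^ 2)))
    (hPA : ∀ ν, c₁ * ‖ν‖ ^ 2 ≤ P ν + c * A ν) :
    ∃ (U : ℝ → E → ℝ) (b : ℝ), 0 < b ∧ ContDiff ℝ 1 (fun p : ℝ × E => U p.1 p.2) ∧
      (∃ Ulow Uup : E → ℝ, Model.IsPosDefRadUnbdd Ulow ∧ Model.IsPosDefRadUnbdd Uup ∧
        ∀ t, 0 ≤ t → ∀ ν, Ulow ν ≤ U t ν ∧ U t ν ≤ Uup ν) ∧
      (∀ t, 0 ≤ t → ∀ ν, deriv (fun τ => U τ ν) t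
        + fderiv ℝ (fun v => U t v) ν (F t ν) ≤ -‖ν‖ ^ 2) ∧
      (∀ t, 0 ≤ t → ∀ ν, ‖fderiv ℝ (fun v => U t v) ν‖ ≤ b * (‖ν‖ + ‖ν‖ ^ 3)) := by
  obtain ⟨hC0, C0, hC0n, hb0⟩ := h₀
  obtain ⟨hC1, C1, hC1n, hb1⟩ := h₁
  -- The first summand dominates the error of W₁ with one P to spare; the second absorbs |W₁| and
  -- leaves one W₀ for the lower bound.
  set K : ℝ := (C + C / c₀ + 1) / m + (C1 / c₀ + 1) with hK
  have hKpos : 0 < K := by positivity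
  have hKm : C + C / c₀ + 1 ≤ K * m := by
    have : (C + C / c₀ + 1) / m * m = C + C / c₀ + 1 := by field_simp
    rw [hK, add_mul, this]
    have : 0 ≤ (C1 / c₀ + 1) * m := by positivity
    linarith
  have hK1 : C1 / c₀ + 1 ≤ K := by
    have : 0 ≤ (C + C / c₀ + 1) / m := by positivity
    linarith
  have hW₀n : ∀ t ν, 0 ≤ W₀ t ν := fun t ν => le_trans (by positivity) (hW₀ t ν)
  have hW₀u : ∀ t ν, W₀ t ν ≤ C0 * ‖ν‖ ^ 2 := fun t ν => (le_abs_self _).trans (hb0 t ν).1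
  have hνW : ∀ t ν, ‖ν‖ ^ 2 ≤ W₀ t ν / c₀ := fun t ν => by
    rw [le_div_iff₀ hc₀]; linarith [hW₀ t ν]
  -- Differentiating W₀ + W₀² multiplies the decay by 1 + 2W₀, which matches the factor 1 + ‖ν‖² in
  -- the error of W₁. The factor c₁⁻¹ normalises the rate to ‖ν‖².
  set U : ℝ → E → ℝ := fun t ν => c₁⁻¹ * (K * (W₀ t ν + W₀ t ν ^ 2) + W₁ t ν) with hU
  have hfd : ∀ t ν, HasFDerivAt (fun v => U t v) (c₁⁻¹ • (K • (fderiv ℝ (fun v => W₀ t v) ν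
      + (2 * W₀ t ν) • fderiv ℝ (fun v => W₀ t v) ν) + fderiv ℝ (fun v => W₁ t v) ν)) ν := by
    intro t ν
    have e0 := (differentiable_slice hC0 t ν).hasFDerivAt
    have e1 := (differentiable_slice hC1 t ν).hasFDerivAt
    have e2 : HasFDerivAt (fun v => W₀ t v ^ 2) ((2 * W₀ t ν) • fderiv ℝ (fun v => W₀ t v) ν) ν := by
      refine (e0.pow 2).congr_fderiv ?_
      simp
    exact (((e0.add e2).const_mul K).add e1).const_mul c₁⁻¹
  have htd : ∀ t ν, HasDerivAt (fun τ => U τ ν) (c₁⁻¹ * (K * (deriv (fun τ => W₀ τ ν) t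
      + 2 * W₀ t ν * deriv (fun τ => W₀ τ ν) t) + deriv (fun τ => W₁ τ ν) t)) t := by
    intro t ν
    have e0 := (differentiable_slice_time hC0 ν t).hasDerivAt
    have e1 := (differentiable_slice_time hC1 ν t).hasDerivAt
    have e2 : HasDerivAt (fun τ => W₀ τ ν ^ 2) (2 * W₀ t ν * deriv (fun τ => W₀ τ ν) t) t := by
      refine (e0.pow 2).congr_deriv ?_
      simp
    exact (((e0.add e2).const_mul K).add e1).const_mul c₁⁻¹
  refine ⟨U, c₁⁻¹ * (K * (C0 + 2 * C0 ^ 2) + C1) + 1, by positivity, ?_, ?_, ?_, ?_⟩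
  · exact contDiff_const.mul ((contDiff_const.mul (hC0.add (hC0.pow 2))).add hC1)
  · refine ⟨fun ν => c₁⁻¹ * c₀ * ‖ν‖ ^ 2,
      -- The extra ‖ν‖² makes positive definiteness immediate, since C0 and C1 are only known to be
      -- nonnegative.
      fun ν => (c₁⁻¹ * (K * C0 + C1) + 1) * ‖ν‖ ^ 2 + c₁⁻¹ * K * C0 ^ 2 * ‖ν‖ ^ 4,
      isPosDefRadUnbdd_of_le (by fun_prop) (by simp) (by positivity : 0 < c₁⁻¹ * c₀)
        fun v => le_rfl,
      isPosDefRadUnbdd_of_le (by fun_prop) (by simp) one_pos fun v => ?_,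
      fun t _ ν => ⟨?_, ?_⟩⟩
    · have h1 : 0 ≤ c₁⁻¹ * (K * C0 + C1) * ‖v‖ ^ 2 := by positivity
      have h2 : 0 ≤ c₁⁻¹ * K * C0 ^ 2 * ‖v‖ ^ 4 := by positivity
      linarith
    · change c₁⁻¹ * c₀ * ‖ν‖ ^ 2 ≤ c₁⁻¹ * (K * (W₀ t ν + W₀ t ν ^ 2) + W₁ t ν)
      rw [mul_assoc]
      refine mul_le_mul_of_nonneg_left ?_ (by positivity)
      have h1 : -(C1 * ‖ν‖ ^ 2) ≤ W₁ t ν := (neg_le_neg (hb1 t ν).1).trans (neg_abs_le _)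
      have h2 : C1 * ‖ν‖ ^ 2 ≤ C1 / c₀ * W₀ t ν := by
        calc C1 * ‖ν‖ ^ 2 ≤ C1 * (W₀ t ν / c₀) := by gcongr; exact hνW t ν
          _ = _ := by ring
      have h3 := mul_le_mul_of_nonneg_right hK1 (hW₀n t ν)
      have h4 : 0 ≤ K * W₀ t ν ^ 2 := by positivity
      have h5 := hW₀ t ν
      linarith
    · have h1 : W₁ t ν ≤ C1 * ‖ν‖ ^ 2 := (le_abs_self _).trans (hb1 t ν).1
      have h2 : W₀ t ν ^ 2 ≤ (C0 * ‖ν‖ ^ 2) ^ 2 :=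
        pow_le_pow_left₀ (hW₀n t ν) (hW₀u t ν) 2
      have h3 := hW₀u t ν
      calc U t ν ≤ c₁⁻¹ * (K * (C0 * ‖ν‖ ^ 2 + (C0 * ‖ν‖ ^ 2) ^ 2) + C1 * ‖ν‖ ^ 2) := by
            change c₁⁻¹ * (K * (W₀ t ν + W₀ t ν ^ 2) + W₁ t ν) ≤ _
            gcongr
        _ ≤ c₁⁻¹ * (K * (C0 * ‖ν‖ ^ 2 + (C0 * ‖ν‖ ^ 2) ^ 2) + C1 * ‖ν‖ ^ 2) + ‖ν‖ ^ 2 :=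
            le_add_of_nonneg_right (by positivity)
        _ = _ := by ring
  · intro t _ ν
    rw [(hfd t ν).fderiv, (htd t ν).deriv]
    have hd0 := hD₀ t ν
    have hd1 := hD₁ t ν
    set D0 := deriv (fun τ => W₀ τ ν) t
    set D1 := deriv (fun τ => W₁ τ ν) t
    set G0 := fderiv ℝ (fun v => W₀ t v) ν (F t ν) with hG0
    set G1 := fderiv ℝ (fun v => W₁ t v) ν (F t ν) with hG1
    have happ : (c₁⁻¹ • (K • (fderiv ℝ (fun v => W₀ t v) ν
        + (2 * W₀ t ν) • fderiv ℝ (fun v => W₀ t v) ν) + fderiv ℝ (fun v => W₁ t v) ν)) (F t ν) =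
        c₁⁻¹ * (K * (G0 + 2 * W₀ t ν * G0) + G1) := rfl
    rw [happ, ← mul_add]
    have h1 : K * (D0 + 2 * W₀ t ν * D0) + D1 + (K * (G0 + 2 * W₀ t ν * G0) + G1) =
        K * (1 + 2 * W₀ t ν) * (D0 + G0) + (D1 + G1) := by ring
    rw [h1, inv_mul_le_iff₀ hc₁]
    have hw := hW₀n t ν
    have h2 : K * (1 + 2 * W₀ t ν) * (D0 + G0) ≤ K * (1 + 2 * W₀ t ν) * (-(m * P ν)) := by
      gcongr
    have h3 : (C + C / c₀ + 1) * (P ν * (1 + 2 * W₀ t ν)) ≤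
        K * m * (P ν * (1 + 2 * W₀ t ν)) := by
      have := hP ν
      gcongr
    have h4 : C * (P ν * (1 + ‖ν‖ ^ 2)) ≤ C * (P ν * (1 + W₀ t ν / c₀)) := by
      have := hP ν
      have := hνW t ν
      gcongr
    have h5 : 0 ≤ P ν * W₀ t ν := mul_nonneg (hP ν) hw
    have h6 : C * (P ν * (1 + W₀ t ν / c₀)) = C * P ν + C / c₀ * (P ν * W₀ t ν) := by ring
    have h7 : 0 ≤ C / c₀ * (P ν * W₀ t ν) := by positivity
    have h8 : 0 ≤ C / c₀ * P ν := by have := hP ν; positivity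
    have h9 : 0 ≤ C * (P ν * W₀ t ν) := by positivity
    have h10 := hPA ν
    nlinarith
  · intro t _ ν
    rw [(hfd t ν).fderiv, norm_smul, Real.norm_eq_abs, abs_of_pos (inv_pos.mpr hc₁)]
    have h0 := (hb0 t ν).2
    have h1 := (hb1 t ν).2
    have hn : ‖K • (fderiv ℝ (fun v => W₀ t v) ν
        + (2 * W₀ t ν) • fderiv ℝ (fun v => W₀ t v) ν) + fderiv ℝ (fun v => W₁ t v) ν‖ ≤
        K * (C0 * ‖ν‖ + 2 * (C0 * ‖ν‖ ^ 2) * (C0 * ‖ν‖)) + C1 * ‖ν‖ := by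
      refine (norm_add_le _ _).trans (add_le_add ?_ h1)
      rw [norm_smul, Real.norm_eq_abs, abs_of_pos hKpos]
      refine mul_le_mul_of_nonneg_left ((norm_add_le _ _).trans (add_le_add h0 ?_)) hKpos.le
      rw [norm_smul, Real.norm_eq_abs, abs_of_nonneg (by have := hW₀n t ν; positivity)]
      have := hW₀u t ν
      gcongr
    have hν := norm_nonneg ν
    calc _ ≤ c₁⁻¹ * (K * (C0 * ‖ν‖ + 2 * (C0 * ‖ν‖ ^ 2) * (C0 * ‖ν‖)) + C1 * ‖ν‖) := by gcongr
      _ ≤ c₁⁻¹ * (K * (C0 * ‖ν‖ + 2 * (C0 * ‖ν‖ ^ 2) * (C0 * ‖ν‖)) + C1 * ‖ν‖)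
        + (c₁⁻¹ * (K * C0 * ‖ν‖ ^ 3 + K * (2 * C0 ^ 2) * ‖ν‖ + C1 * ‖ν‖ ^ 3)
          + (‖ν‖ + ‖ν‖ ^ 3)) := le_add_of_nonneg_right (by positivity)
      _ = _ := by ring

end TVQuad

/-! ### Quadratic Lyapunov forms for Hurwitz companion systems. -/

section Hurwitz

/-- An injective matrix is bounded below. -/
theorem exists_mul_dotProduct_le_mulVec {m n : Type*} [Fintype m] [Fintype n]
    (A : Matrix m n ℝ) (hA : ∀ x, A *ᵥ x = 0 → x = 0) :
    ∃ ε : ℝ, 0 < ε ∧ ∀ x, ε * (x ⬝ᵥ x) ≤ (A *ᵥ x) ⬝ᵥ (A *ᵥ x) := by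
  classical
  obtain ⟨K, hK, hlip⟩ := (Matrix.mulVecLin A).exists_antilipschitzWith
    (LinearMap.ker_eq_bot'.mpr fun x hx => hA x hx)
  have hsq : ∀ {ι : Type _} [Fintype ι] (v : ι → ℝ), ‖v‖ ^ 2 ≤ v ⬝ᵥ v := by
    intro ι _ v
    have h : ‖v‖ ≤ vecNorm v := (pi_norm_le_iff_of_nonneg (vecNorm_nonneg v)).mpr fun i => by
      rw [Real.norm_eq_abs]; exact abs_le_vecNorm v i
    rw [dotProduct_self_eq_vecNorm_sq]
    exact pow_le_pow_left₀ (norm_nonneg _) h 2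
  have hle : ∀ x : n → ℝ, x ⬝ᵥ x ≤ (Fintype.card n : ℝ) * ‖x‖ ^ 2 := by
    intro x
    calc x ⬝ᵥ x ≤ ∑ _i : n, ‖x‖ ^ 2 := Finset.sum_le_sum fun i _ => by
          have := norm_le_pi_norm x i
          rw [← sq, ← sq_abs, ← Real.norm_eq_abs]
          exact pow_le_pow_left₀ (norm_nonneg _) this 2
      _ = _ := by simp
  have hKpos : (0 : ℝ) < K := hK
  -- The +1 covers an empty index type.
  refine ⟨1 / ((Fintype.card n + 1) * (K : ℝ) ^ 2), by positivity, fun x => ?_⟩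
  have h1 : ‖x‖ ≤ K * ‖A *ᵥ x‖ := by
    simpa using hlip.le_mul_dist x 0
  have h2 : ‖x‖ ^ 2 ≤ (K : ℝ) ^ 2 * ‖A *ᵥ x‖ ^ 2 := by
    rw [← mul_pow]; exact pow_le_pow_left₀ (norm_nonneg _) h1 2
  rw [one_div, inv_mul_le_iff₀ (by positivity)]
  calc x ⬝ᵥ x ≤ (Fintype.card n : ℝ) * ‖x‖ ^ 2 := hle x
    _ ≤ (Fintype.card n + 1) * ((K : ℝ) ^ 2 * ((A *ᵥ x) ⬝ᵥ (A *ᵥ x))) := by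
      refine mul_le_mul (by linarith) (h2.trans ?_) (by positivity) (by positivity)
      gcongr
      exact hsq _
    _ = _ := by ring

open Polynomial

/-- An ordering of the roots is fixed because the cascade uses products over initial segments. -/
theorem exists_prod_X_sub_C (n : ℕ) (P : ℂ[X]) (hm : P.Monic) (hd : P.natDegree = n) :
    ∃ z : ℕ → ℂ, P = ∏ i ∈ Finset.range n, (X - C (z i)) := by
  induction n generalizing P with
  | zero => exact ⟨0, by simpa using hm.natDegree_eq_zero.mp hd⟩
  | succ n ih =>
    obtain ⟨a, ha⟩ := IsAlgClosed.exists_root P (by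
      rw [degree_eq_natDegree hm.ne_zero, hd]
      exact_mod_cast Nat.succ_ne_zero n)
    obtain ⟨Q, hQ⟩ := dvd_iff_isRoot.mpr ha
    have hQm : Q.Monic := (monic_X_sub_C a).of_mul_monic_left (hQ ▸ hm)
    have hQd : Q.natDegree = n := by
      have := (monic_X_sub_C a).natDegree_mul hQm
      rw [← hQ, hd, natDegree_X_sub_C] at this
      omega
    obtain ⟨z, hz⟩ := ih Q hQm hQd
    refine ⟨Function.update z n a, ?_⟩
    rw [Finset.prod_range_succ, Function.update_self, hQ, hz, mul_comm]
    congr 1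
    refine Finset.prod_congr rfl fun i hi => ?_
    rw [Function.update_of_ne (Finset.mem_range.mp hi).ne]

/-- Partial products of linear factors. -/
def partialProd (z : ℕ → ℂ) (m : ℕ) : ℂ[X] := ∏ i ∈ Finset.range m, (X - C (z i))

theorem partialProd_monic (z : ℕ → ℂ) (m : ℕ) : (partialProd z m).Monic :=
  monic_prod_of_monic _ _ fun i _ => monic_X_sub_C (z i)

theorem natDegree_partialProd (z : ℕ → ℂ) (m : ℕ) : (partialProd z m).natDegree = m := by
  rw [partialProd, natDegree_prod_of_monic _ _ fun i _ => monic_X_sub_C (z i)]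
  simp

theorem coeff_partialProd_self (z : ℕ → ℂ) (m : ℕ) : (partialProd z m).coeff m = 1 := by
  have := (partialProd_monic z m).coeff_natDegree
  rwa [natDegree_partialProd] at this

theorem coeff_partialProd_of_lt (z : ℕ → ℂ) {m i : ℕ} (h : m < i) :
    (partialProd z m).coeff i = 0 :=
  coeff_eq_zero_of_natDegree_lt (by rwa [natDegree_partialProd])

theorem X_mul_partialProd (z : ℕ → ℂ) (m : ℕ) :
    X * partialProd z m = partialProd z (m + 1) + C (z m) * partialProd z m := by
  rw [partialProd, partialProd, Finset.prod_range_succ]; ring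

/-- The combination `∑ p_i x_i` of the coordinates. -/
def polyComb (n : ℕ) (p : ℂ[X]) (x : ℕ → ℝ) : ℂ := ∑ i ∈ Finset.range n, p.coeff i * x i

/-- A companion system is a cascade of first order systems. -/
theorem polyComb_cascade {z : ℕ → ℂ} {n : ℕ} {x x' : ℕ → ℝ} {η : ℝ}
    (hx : ∀ i, i < n → x' i = x (i + 1) - if i + 1 = n then η else 0)
    (hP : polyComb (n + 1) (partialProd z n) x = 0) {m : ℕ} (hm : m < n) :
    polyComb n (partialProd z m) x' =
      (if m + 1 = n then -(η : ℂ) else polyComb n (partialProd z (m + 1)) x)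
        + z m * polyComb n (partialProd z m) x := by
  -- The dynamics shift the coordinates, that is, multiply p_m by X, and X p_m = p_{m+1} + z_m p_m.
  -- The input enters through the coefficient of index n - 1, which is 1 for m = n - 1 and 0 below.
  have h1 : polyComb n (partialProd z m) x' =
      ∑ i ∈ Finset.range n, (partialProd z m).coeff i * x (i + 1)
        - (partialProd z m).coeff (n - 1) * η := by
    have hη : (partialProd z m).coeff (n - 1) * η =
        ∑ i ∈ Finset.range n, (partialProd z m).coeff i * ((if i + 1 = n then η else 0 : ℝ) : ℂ) := by
      rw [Finset.sum_eq_single (n - 1)]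
      · rw [if_pos (by omega)]
      · intro i hi hne
        rw [if_neg (by omega)]; simp
      · intro h; exact absurd (Finset.mem_range.mpr (by omega)) h
    rw [hη, ← Finset.sum_sub_distrib]
    refine Finset.sum_congr rfl fun i hi => ?_
    rw [hx i (Finset.mem_range.mp hi)]
    push_cast
    ring
  have h2 : ∑ i ∈ Finset.range n, (partialProd z m).coeff i * x (i + 1) =
      polyComb (n + 1) (X * partialProd z m) x := by
    rw [polyComb, Finset.sum_range_succ']
    simp [coeff_X_mul]
  have h3 : polyComb (n + 1) (X * partialProd z m) x =
      polyComb (n + 1) (partialProd z (m + 1)) x + z m * polyComb (n + 1) (partialProd z m) x := by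
    rw [X_mul_partialProd, polyComb, polyComb, polyComb, Finset.mul_sum, ← Finset.sum_add_distrib]
    refine Finset.sum_congr rfl fun i _ => ?_
    rw [coeff_add, coeff_C_mul]
    ring
  have h4 : ∀ k, k < n → polyComb (n + 1) (partialProd z k) x = polyComb n (partialProd z k) x := by
    intro k hk
    rw [polyComb, Finset.sum_range_succ, coeff_partialProd_of_lt z hk, zero_mul, add_zero, polyComb]
  rw [h1, h2, h3, h4 m hm]
  by_cases hmn : m + 1 = n
  · have : n - 1 = m := by omega
    rw [if_pos hmn, this, coeff_partialProd_self, hmn, hP]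
    ring
  · rw [if_neg hmn, coeff_partialProd_of_lt z (by omega : m < n - 1), h4 (m + 1) (by omega)]
    ring

/-- Triangularity: p_m is monic of degree m. -/
theorem polyComb_injective {z : ℕ → ℂ} {n : ℕ} {x : ℕ → ℝ}
    (h : ∀ m, m < n → polyComb n (partialProd z m) x = 0) : ∀ i, i < n → x i = 0 := by
  intro i
  induction i using Nat.strong_induction_on with
  | _ i ih =>
    intro hi
    have h1 := h i hi
    rw [polyComb, Finset.sum_eq_single i] at h1
    · rw [coeff_partialProd_self, one_mul] at h1
      exact_mod_cast h1
    · intro k hk hne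
      rcases lt_or_gt_of_ne hne with hlt | hgt
      · rw [ih k hlt (hlt.trans hi)]; simp
      · rw [coeff_partialProd_of_lt z hgt, zero_mul]
    · intro hni; exact absurd (Finset.mem_range.mpr hi) hni

/-- Weighted sums of squares decrease along a cascade. -/
theorem sum_cascade_le {δ θ : ℝ} (hδ : 0 < δ) (hθ : θ * δ ^ 2 = 2) (n : ℕ) (e : ℕ → ℝ)
    (he : 0 ≤ e 0) :
    ∑ m ∈ Finset.range n, θ ^ m * (-δ * e m + e (m + 1) / δ) ≤
      -(δ / 2) * ∑ m ∈ Finset.range n, θ ^ m * e m + δ / 2 * (θ ^ n * e n) := by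
  -- By the choice of θ, the coupling to level m + 1 costs exactly half of the damping available
  -- there.
  have h1 : ∑ m ∈ Finset.range n, θ ^ m * (e (m + 1) / δ) =
      δ / 2 * ∑ m ∈ Finset.range n, θ ^ (m + 1) * e (m + 1) := by
    rw [Finset.mul_sum]
    refine Finset.sum_congr rfl fun m _ => ?_
    field_simp
    rw [pow_succ]
    linear_combination -(θ ^ m * e (m + 1)) * hθ
  have h2 : ∑ m ∈ Finset.range n, θ ^ (m + 1) * e (m + 1) =
      ∑ m ∈ Finset.range n, θ ^ m * e m + θ ^ n * e n - e 0 := by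
    have := Finset.sum_range_succ' (fun m => θ ^ m * e m) n
    rw [Finset.sum_range_succ] at this
    simp only [pow_zero, one_mul] at this
    linarith
  simp only [mul_add, Finset.sum_add_distrib]
  rw [h1, h2]
  have h3 : ∑ m ∈ Finset.range n, θ ^ m * (-δ * e m) =
      -δ * ∑ m ∈ Finset.range n, θ ^ m * e m := by
    rw [Finset.mul_sum]; exact Finset.sum_congr rfl fun m _ => by ring
  rw [h3]
  nlinarith

/-- The damping is at least 2δ‖y‖²; Young's inequality spends half of it on the input w. -/
theorem two_mul_re_conj_mul_le {δ : ℝ} (hδ : 0 < δ) {z y w : ℂ} (hz : z.re ≤ -δ) :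
    2 * (y.re * (w + z * y).re + y.im * (w + z * y).im) ≤ -δ * ‖y‖ ^ 2 + ‖w‖ ^ 2 / δ := by
  rw [← Complex.normSq_eq_norm_sq, ← Complex.normSq_eq_norm_sq, Complex.normSq_apply,
    Complex.normSq_apply]
  simp only [Complex.add_re, Complex.add_im, Complex.mul_re, Complex.mul_im]
  have h1 : 2 * (y.re * w.re) ≤ δ * (y.re * y.re) + w.re * w.re / δ := by
    have : 0 ≤ (δ * y.re - w.re) ^ 2 / δ := by positivity
    have h2 : (δ * y.re - w.re) ^ 2 / δ = δ * (y.re * y.re) + w.re * w.re / δ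
      - 2 * (y.re * w.re) := by field_simp; ring
    linarith
  have h1' : 2 * (y.im * w.im) ≤ δ * (y.im * y.im) + w.im * w.im / δ := by
    have : 0 ≤ (δ * y.im - w.im) ^ 2 / δ := by positivity
    have h2 : (δ * y.im - w.im) ^ 2 / δ = δ * (y.im * y.im) + w.im * w.im / δ
      - 2 * (y.im * w.im) := by field_simp; ring
    linarith
  have h3 := mul_le_mul_of_nonneg_right hz (mul_self_nonneg y.re)
  have h4 := mul_le_mul_of_nonneg_right hz (mul_self_nonneg y.im)
  rw [add_div]
  nlinarith

/-- A quadratic Lyapunov function for a Hurwitz companion system with an input. -/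
theorem exists_hurwitz_form {n : ℕ} (r : Fin n → ℝ)
    (hr : ∀ z : ℂ, z ^ n + ∑ i, (r i : ℂ) * z ^ (i : ℕ) = 0 → z.re < 0) :
    ∃ (A : Matrix (Fin n ⊕ Fin n) (Fin n) ℝ) (ε C : ℝ), 0 < ε ∧ 0 < C ∧
      (∀ x, ε * (x ⬝ᵥ x) ≤ (A *ᵥ x) ⬝ᵥ (A *ᵥ x)) ∧
      ∀ (x x' : Fin n → ℝ) (η : ℝ), (∀ i (h : i + 1 < n), x' ⟨i, by omega⟩ = x ⟨i + 1, h⟩) →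
        (∀ h : 0 < n, x' ⟨n - 1, by omega⟩ = -(r ⬝ᵥ x) - η) →
        2 * ((A *ᵥ x) ⬝ᵥ (A *ᵥ x')) ≤ -ε * (x ⬝ᵥ x) + C * η ^ 2 := by
  classical
  set P : ℂ[X] := X ^ n + ∑ i, C (r i : ℂ) * X ^ (i : ℕ) with hPdef
  have hdeg : (∑ i, C (r i : ℂ) * X ^ (i : ℕ)).degree < (n : WithBot ℕ) := by
    rw [degree_lt_iff_coeff_zero]
    intro k hk
    rw [finsetSum_coeff]
    refine Finset.sum_eq_zero fun i _ => ?_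
    rw [coeff_C_mul_X_pow, if_neg (by omega)]
  have hPm : P.Monic := monic_X_pow_add hdeg
  have hPd : P.natDegree = n := by
    rw [hPdef, natDegree_add_eq_left_of_degree_lt (by rwa [degree_X_pow]), natDegree_X_pow]
  obtain ⟨z, hz⟩ := exists_prod_X_sub_C n P hPm hPd
  have hroot : ∀ i, i < n → (z i).re < 0 := by
    intro i hi
    refine hr (z i) ?_
    have h1 : P.eval (z i) = 0 := by
      rw [hz, eval_prod]
      exact Finset.prod_eq_zero (Finset.mem_range.mpr hi) (by simp)
    rw [hPdef] at h1
    simpa [eval_finsetSum] using h1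
  obtain ⟨δ, hδ, hzδ⟩ : ∃ δ : ℝ, 0 < δ ∧ ∀ i, i < n → (z i).re ≤ -δ := by
    rcases Nat.eq_zero_or_pos n with rfl | hn
    · exact ⟨1, one_pos, fun i hi => absurd hi (Nat.not_lt_zero i)⟩
    · obtain ⟨i, hi, hmax⟩ := Finset.exists_max_image (Finset.range n) (fun i => (z i).re)
        ⟨0, Finset.mem_range.mpr hn⟩
      exact ⟨-(z i).re, neg_pos.mpr (hroot i (Finset.mem_range.mp hi)), fun k hk => by
        rw [neg_neg]; exact hmax k (Finset.mem_range.mpr hk)⟩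
  set θ : ℝ := 2 / δ ^ 2 with hθdef
  have hθ : θ * δ ^ 2 = 2 := by rw [hθdef]; field_simp
  have hθ0 : 0 < θ := by positivity
  -- Weighted real and imaginary parts of the cascade variables y_m, so that |Ax|² = ∑ θ^m |y_m|².
  set A : Matrix (Fin n ⊕ Fin n) (Fin n) ℝ := Matrix.of fun m i => Sum.elim
    (fun m : Fin n => Real.sqrt (θ ^ (m : ℕ)) * ((partialProd z m).coeff i).re)
    (fun m : Fin n => Real.sqrt (θ ^ (m : ℕ)) * ((partialProd z m).coeff i).im) m with hA
  -- The default value makes the combination of x₀, …, x_n with the coefficients of P vanish.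
  let ext : (Fin n → ℝ) → ℕ → ℝ := fun x i => if h : i < n then x ⟨i, h⟩ else -(r ⬝ᵥ x)
  have hcomb : ∀ (m : ℕ) (x : Fin n → ℝ), polyComb n (partialProd z m) (ext x) =
      ∑ i : Fin n, (partialProd z m).coeff i * x i := by
    intro m x
    rw [polyComb, Finset.sum_range]
    refine Finset.sum_congr rfl fun i _ => ?_
    simp [ext]
  have hAl : ∀ (m : Fin n) (x : Fin n → ℝ), (A *ᵥ x) (Sum.inl m) =
      Real.sqrt (θ ^ (m : ℕ)) * (polyComb n (partialProd z m) (ext x)).re := by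
    intro m x
    rw [hcomb, Complex.re_sum, Finset.mul_sum]
    change ∑ i, A (Sum.inl m) i * x i = _
    refine Finset.sum_congr rfl fun i _ => ?_
    rw [hA, Complex.re_mul_ofReal]
    simp [mul_assoc]
  have hAr : ∀ (m : Fin n) (x : Fin n → ℝ), (A *ᵥ x) (Sum.inr m) =
      Real.sqrt (θ ^ (m : ℕ)) * (polyComb n (partialProd z m) (ext x)).im := by
    intro m x
    rw [hcomb, Complex.im_sum, Finset.mul_sum]
    change ∑ i, A (Sum.inr m) i * x i = _
    refine Finset.sum_congr rfl fun i _ => ?_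
    rw [hA, Complex.im_mul_ofReal]
    simp [mul_assoc]
  have hdot : ∀ x x' : Fin n → ℝ, (A *ᵥ x) ⬝ᵥ (A *ᵥ x') = ∑ m ∈ Finset.range n, θ ^ m *
      ((polyComb n (partialProd z m) (ext x)).re * (polyComb n (partialProd z m) (ext x')).re
      + (polyComb n (partialProd z m) (ext x)).im
        * (polyComb n (partialProd z m) (ext x')).im) := by
    intro x x'
    rw [dotProduct, Fintype.sum_sum_type, ← Finset.sum_add_distrib, Finset.sum_range]
    refine Finset.sum_congr rfl fun m _ => ?_
    have hs : Real.sqrt (θ ^ (m : ℕ)) * Real.sqrt (θ ^ (m : ℕ)) = θ ^ (m : ℕ) :=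
      Real.mul_self_sqrt (by positivity)
    rw [hAl, hAl, hAr, hAr]
    linear_combination ((polyComb n (partialProd z m) (ext x)).re
      * (polyComb n (partialProd z m) (ext x')).re
      + (polyComb n (partialProd z m) (ext x)).im
        * (polyComb n (partialProd z m) (ext x')).im) * hs
  have hinj : ∀ x, A *ᵥ x = 0 → x = 0 := by
    intro x hx
    ext i
    have := polyComb_injective (z := z) (n := n) (x := ext x) (fun m hm => by
      have hs : Real.sqrt (θ ^ m) ≠ 0 := (Real.sqrt_pos.mpr (by positivity)).ne'
      have h1 := hAl ⟨m, hm⟩ x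
      have h2 := hAr ⟨m, hm⟩ x
      rw [hx] at h1 h2
      refine Complex.ext ?_ ?_
      · exact (mul_eq_zero.mp h1.symm).resolve_left hs
      · exact (mul_eq_zero.mp h2.symm).resolve_left hs) i i.isLt
    simpa [ext] using this
  obtain ⟨ε, hε, hlow⟩ := exists_mul_dotProduct_le_mulVec A hinj
  refine ⟨A, min ε (δ / 2 * ε), δ / 2 * θ ^ n, by positivity, by positivity, fun x => ?_, ?_⟩
  · refine le_trans ?_ (hlow x)
    gcongr
    · exact Finset.sum_nonneg fun i _ => mul_self_nonneg _
    · exact min_le_left _ _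
  · intro x x' η hx hlast
    -- The input is treated as the terminal level of the cascade.
    set y : ℕ → ℂ := fun m => if m = n then -(η : ℂ) else polyComb n (partialProd z m) (ext x)
      with hy
    have hP0 : polyComb (n + 1) (partialProd z n) (ext x) = 0 := by
      have hPp : partialProd z n = P := hz.symm
      rw [polyComb, Finset.sum_range_succ, coeff_partialProd_self, Finset.sum_range, hPp]
      have hco : ∀ i : Fin n, P.coeff i = r i := by
        intro i
        rw [hPdef, coeff_add, coeff_X_pow, if_neg (by have := i.isLt; omega), finsetSum_coeff,
          Finset.sum_eq_single i]
        · simp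
        · intro k _ hk
          rw [coeff_C_mul_X_pow, if_neg (fun h => hk (Fin.ext h.symm))]
        · simp
      simp only [hco, ext, Fin.is_lt, dite_true, lt_irrefl, dite_false, one_mul, dotProduct]
      push_cast
      exact add_neg_cancel _
    have hx' : ∀ i, i < n → ext x' i = ext x (i + 1) - if i + 1 = n then η else 0 := by
      intro i hi
      by_cases h : i + 1 = n
      · have h1 := hlast (by omega)
        have h2 : (⟨n - 1, by omega⟩ : Fin n) = ⟨i, hi⟩ := Fin.ext (by simp; omega)
        rw [h2] at h1
        simp only [ext, hi, dite_true, h, lt_irrefl, dite_false, if_true, h1]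
      · have h3 : i + 1 < n := by omega
        simp only [ext, hi, dite_true, h, if_false, h3, sub_zero]
        exact hx i h3
    have hstep : ∀ m ∈ Finset.range n, 2 * (θ ^ m *
        ((polyComb n (partialProd z m) (ext x)).re * (polyComb n (partialProd z m) (ext x')).re
        + (polyComb n (partialProd z m) (ext x)).im
          * (polyComb n (partialProd z m) (ext x')).im)) ≤
        θ ^ m * (-δ * ‖y m‖ ^ 2 + ‖y (m + 1)‖ ^ 2 / δ) := by
      intro m hm
      have hmn := Finset.mem_range.mp hm
      have hym : polyComb n (partialProd z m) (ext x) = y m := by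
        rw [hy]; simp [hmn.ne]
      have hc := polyComb_cascade hx' hP0 hmn
      rw [hc, hym]
      have := two_mul_re_conj_mul_le hδ (hzδ m hmn) (y := y m) (w := y (m + 1))
      calc _ = θ ^ m * (2 * ((y m).re * (y (m + 1) + z m * y m).re
            + (y m).im * (y (m + 1) + z m * y m).im)) := by rw [hy]; ring
        _ ≤ _ := by gcongr
    have h1 : 2 * ((A *ᵥ x) ⬝ᵥ (A *ᵥ x')) ≤
        -(δ / 2) * ∑ m ∈ Finset.range n, θ ^ m * ‖y m‖ ^ 2 + δ / 2 * (θ ^ n * ‖y n‖ ^ 2) := by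
      rw [hdot, Finset.mul_sum]
      exact (Finset.sum_le_sum hstep).trans
        (sum_cascade_le hδ hθ n (fun m => ‖y m‖ ^ 2) (sq_nonneg _))
    have h2 : ∑ m ∈ Finset.range n, θ ^ m * ‖y m‖ ^ 2 = (A *ᵥ x) ⬝ᵥ (A *ᵥ x) := by
      rw [hdot]
      refine Finset.sum_congr rfl fun m hm => ?_
      have hmn := Finset.mem_range.mp hm
      have hym : polyComb n (partialProd z m) (ext x) = y m := by
        rw [hy]; simp [hmn.ne]
      rw [hym, ← Complex.normSq_eq_norm_sq, Complex.normSq_apply]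
    have h3 : ‖y n‖ ^ 2 = η ^ 2 := by simp [hy]
    rw [h2, h3] at h1
    have h4 := mul_le_mul_of_nonneg_left (hlow x) (half_pos hδ).le
    have h5 : min ε (δ / 2 * ε) * (x ⬝ᵥ x) ≤ δ / 2 * ε * (x ⬝ᵥ x) := by
      gcongr
      · exact Finset.sum_nonneg fun i _ => mul_self_nonneg _
      · exact min_le_right _ _
    linarith

end Hurwitz

/-! ### The internal-model error in the coordinates u, z, η̂, α̃. -/

section Coordinates

variable {s : ℕ}

/-- All entries of `ζ̃` but the last one. -/
def zOf (ν : Nu s) : Fin (2 * s) → ℝ := fun i => zetaOf ν i.castSucc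

/-- The filtered error `η̂ + R ζ̃`. -/
def errOf (r : Fin (2 * s) → ℝ) (ν : Nu s) : ℝ := etaOf ν + rowR r ⬝ᵥ zetaOf ν

theorem rowR_dotProduct (r : Fin (2 * s) → ℝ) (ν : Nu s) :
    rowR r ⬝ᵥ zetaOf ν = r ⬝ᵥ zOf ν + zetaOf ν (Fin.last (2 * s)) := by
  simp [dotProduct, Fin.sum_univ_castSucc, rowR, zOf]

theorem vecNorm_zetaOf_sq (ν : Nu s) :
    vecNorm (zetaOf ν) ^ 2 = vecNorm (zOf ν) ^ 2 + zetaOf ν (Fin.last (2 * s)) ^ 2 := by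
  simp [vecNorm_sq, Fin.sum_univ_castSucc, zOf]

theorem vecNorm_zOf_sq_add_alphaOf_sq_le (ν : Nu s) :
    vecNorm (alphaOf ν) ^ 2 + vecNorm (zOf ν) ^ 2 ≤ ‖ν‖ ^ 2 := by
  rw [norm_sq_nu, vecNorm_zetaOf_sq]
  nlinarith [sq_nonneg (etaOf ν), sq_nonneg (zetaOf ν (Fin.last (2 * s)))]

/-- The norm is controlled by the transformed coordinates. -/
theorem norm_sq_nu_le (r : Fin (2 * s) → ℝ) (ν : Nu s) :
    ‖ν‖ ^ 2 ≤ (4 + 3 * vecNorm r ^ 2) *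
      (errOf r ν ^ 2 + vecNorm (zOf ν) ^ 2 + etaOf ν ^ 2 + vecNorm (alphaOf ν) ^ 2) := by
  -- The only entry missing from the new coordinates is recovered from u, because the last entry of
  -- R is 1.
  have h1 : zetaOf ν (Fin.last (2 * s)) = errOf r ν - etaOf ν - r ⬝ᵥ zOf ν := by
    rw [errOf, rowR_dotProduct]; ring
  have h2 : (r ⬝ᵥ zOf ν) ^ 2 ≤ vecNorm r ^ 2 * vecNorm (zOf ν) ^ 2 := by
    rw [← mul_pow, ← sq_abs]
    exact pow_le_pow_left₀ (abs_nonneg _) (abs_dotProduct_le_vecNorm _ _) 2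
  rw [norm_sq_nu, vecNorm_zetaOf_sq, h1]
  have h3 : (errOf r ν - etaOf ν - r ⬝ᵥ zOf ν) ^ 2 ≤
      3 * (errOf r ν ^ 2 + etaOf ν ^ 2 + (r ⬝ᵥ zOf ν) ^ 2) := by
    nlinarith [sq_nonneg (errOf r ν + etaOf ν), sq_nonneg (errOf r ν + r ⬝ᵥ zOf ν),
      sq_nonneg (etaOf ν - r ⬝ᵥ zOf ν)]
  have h4 : 0 ≤ vecNorm r ^ 2 * (errOf r ν ^ 2 + etaOf ν ^ 2 + vecNorm (alphaOf ν) ^ 2) := by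
    positivity
  nlinarith [sq_nonneg (errOf r ν), sq_nonneg (etaOf ν), sq_nonneg (vecNorm (alphaOf ν)),
    sq_nonneg (vecNorm (zOf ν))]

end Coordinates

namespace Model

variable {V : Type*} [Fintype V] (S : Model V) (j : V) (t : ℝ) (ν : Nu (S.s j))

theorem etaOf_nuField : etaOf (S.nuField j t ν 0 0) = -etaOf ν := by
  simp [nuField, mkNu, etaOf]

theorem alphaOf_nuField : alphaOf (S.nuField j t ν 0 0) =
    (-(S.kα * errOf (S.r j) ν)) • vecLam (zetaOf ν + S.phi j t) := by
  ext k
  simp [nuField, mkNu, alphaOf, errOf]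

theorem zetaOf_nuField (i : Fin (2 * S.s j + 1)) : zetaOf (S.nuField j t ν 0 0) i =
    (if i = Fin.last _ then alphaOf ν ⬝ᵥ vecLam (zetaOf ν + S.phi j t) else 0)
      + (matA (S.α j) *ᵥ zetaOf ν) i - errOf (S.r j) ν * colG (S.s j) S.g i := by
  have h : zetaOf (S.nuField j t ν 0 0) i =
      ((matA (alphaOf ν + S.α j) - matA (S.α j)) *ᵥ (zetaOf ν + S.phi j t)
      + (matA (S.α j) - Matrix.vecMulVec (colG (S.s j) S.g) (rowR (S.r j))) *ᵥ zetaOf ν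
      - (etaOf ν + S.M j * 0) • colG (S.s j) S.g) i := rfl
  rw [h, matA_add_sub_mulVec, sub_mulVec, vecMulVec_mulVec]
  simp only [Pi.add_apply, Pi.sub_apply, Pi.smul_apply, Pi.single_apply, errOf, smul_eq_mul,
    MulOpposite.smul_eq_mul_unop, MulOpposite.unop_op, mul_zero, add_zero]
  ring

theorem zOf_nuField_of_lt (i : ℕ) (h : i + 1 < 2 * S.s j) :
    zOf (S.nuField j t ν 0 0) ⟨i, by omega⟩ = zOf ν ⟨i + 1, h⟩ := by
  have hne : (⟨i, by omega⟩ : Fin (2 * S.s j + 1)) ≠ Fin.last _ := by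
    intro h'; have := congrArg Fin.val h'; simp at this; omega
  have h1 := S.zetaOf_nuField j t ν ⟨i, by omega⟩
  rw [if_neg hne, matA_mulVec_of_lt _ _ _ (by omega), colG, if_neg (by simp; omega),
    if_neg (by simp; omega), mul_zero, sub_zero, zero_add] at h1
  exact h1

/-- Here the entry of G is 1, and subtracting u from the last entry of ζ̃ leaves -r·z - η̂. Thus z
obeys the companion equation of the Hurwitz polynomial. -/
theorem zOf_nuField_last (h : 0 < 2 * S.s j) :
    zOf (S.nuField j t ν 0 0) ⟨2 * S.s j - 1, by omega⟩ = -(S.r j ⬝ᵥ zOf ν) - etaOf ν := by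
  have hne : (⟨2 * S.s j - 1, by omega⟩ : Fin (2 * S.s j + 1)) ≠ Fin.last _ := by
    intro h'; have := congrArg Fin.val h'; simp at this; omega
  have h1 := S.zetaOf_nuField j t ν ⟨2 * S.s j - 1, by omega⟩
  rw [if_neg hne, matA_mulVec_of_lt _ _ _ (by omega), colG, if_neg (by simp; omega),
    if_pos (by simp; omega)] at h1
  have h2 : (⟨2 * S.s j - 1 + 1, by omega⟩ : Fin (2 * S.s j + 1)) = Fin.last _ :=
    Fin.ext (by simp; omega)
  rw [h2, errOf, rowR_dotProduct] at h1
  have h3 : zOf (S.nuField j t ν 0 0) ⟨2 * S.s j - 1, by omega⟩ =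
      zetaOf (S.nuField j t ν 0 0) ⟨2 * S.s j - 1, by omega⟩ := rfl
  rw [h3, h1]
  ring

/-- The part of the error dynamics that is linear in `z` and `η̂`. -/
def errInput : ℝ :=
  -etaOf ν + S.r j ⬝ᵥ zOf (S.nuField j t ν 0 0) + S.α j ⬝ᵥ vecLam (zetaOf ν)

/-- The last entry g of G gives the damping of u, and the parameter error in the last row of A
enters with weight one. -/
theorem errOf_nuField : errOf (S.r j) (S.nuField j t ν 0 0) =
    -(S.g * errOf (S.r j) ν) + alphaOf ν ⬝ᵥ vecLam (zetaOf ν + S.phi j t) + S.errInput j t ν := by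
  have h1 := S.zetaOf_nuField j t ν (Fin.last _)
  rw [if_pos rfl, matA_mulVec_last, colG, if_pos (by simp)] at h1
  have h2 : errOf (S.r j) (S.nuField j t ν 0 0) = etaOf (S.nuField j t ν 0 0) +
    (S.r j ⬝ᵥ zOf (S.nuField j t ν 0 0) + zetaOf (S.nuField j t ν 0 0) (Fin.last _)) := by
    rw [← rowR_dotProduct]; rfl
  rw [h2, h1, etaOf_nuField, errInput]
  ring

theorem vecNorm_vecLam_zetaOf_le : vecNorm (vecLam (zetaOf ν)) ≤ vecNorm (zOf ν) :=
  vecNorm_vecLam_le_castSucc _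

theorem exists_abs_errInput_le : ∃ C, 0 < C ∧ ∀ t ν,
    |S.errInput j t ν| ≤ C * (vecNorm (zOf ν) + |etaOf ν|) := by
  refine ⟨1 + (∑ i, |S.r j i|) * (1 + vecNorm (S.r j)) + vecNorm (S.α j), ?_, fun t ν => ?_⟩
  · have := vecNorm_nonneg (S.r j); have := vecNorm_nonneg (S.α j)
    have : 0 ≤ ∑ i, |S.r j i| := Finset.sum_nonneg fun _ _ => abs_nonneg _
    positivity
  · have hz := vecNorm_nonneg (zOf ν)
    have hη := abs_nonneg (etaOf ν)
    have hr := vecNorm_nonneg (S.r j)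
    have h1 : ∀ i, |zOf (S.nuField j t ν 0 0) i| ≤
        (1 + vecNorm (S.r j)) * (vecNorm (zOf ν) + |etaOf ν|) := by
      intro i
      by_cases hi : (i : ℕ) + 1 < 2 * S.s j
      · have h := S.zOf_nuField_of_lt j t ν i hi
        rw [Fin.eta] at h
        rw [h]
        refine (abs_le_vecNorm _ _).trans ?_
        nlinarith [mul_nonneg hr hz, mul_nonneg hr hη]
      · have h := S.zOf_nuField_last j t ν (by have := i.isLt; omega)
        have h2 : (⟨2 * S.s j - 1, by have := i.isLt; omega⟩ : Fin (2 * S.s j)) = i :=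
          Fin.ext (by simp; omega)
        rw [h2] at h
        rw [h]
        refine (abs_sub _ _).trans ?_
        rw [abs_neg]
        have := abs_dotProduct_le_vecNorm (S.r j) (zOf ν)
        nlinarith [mul_nonneg hr hz, mul_nonneg hr hη]
    have h2 : |S.r j ⬝ᵥ zOf (S.nuField j t ν 0 0)| ≤
        (∑ i, |S.r j i|) * ((1 + vecNorm (S.r j)) * (vecNorm (zOf ν) + |etaOf ν|)) := by
      rw [Finset.sum_mul]
      refine (Finset.abs_sum_le_sum_abs _ _).trans (Finset.sum_le_sum fun i _ => ?_)
      rw [abs_mul]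
      exact mul_le_mul_of_nonneg_left (h1 i) (abs_nonneg _)
    have h3 : |S.α j ⬝ᵥ vecLam (zetaOf ν)| ≤ vecNorm (S.α j) * vecNorm (zOf ν) :=
      (abs_dotProduct_le_vecNorm _ _).trans
        (mul_le_mul_of_nonneg_left (S.vecNorm_vecLam_zetaOf_le j ν) (vecNorm_nonneg _))
    have h4 : |S.errInput j t ν| ≤ |etaOf ν|
        + (∑ i, |S.r j i|) * ((1 + vecNorm (S.r j)) * (vecNorm (zOf ν) + |etaOf ν|))
        + vecNorm (S.α j) * vecNorm (zOf ν) := by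
      rw [errInput]
      refine (abs_add_le _ _).trans (add_le_add ((abs_add_le _ _).trans (add_le_add ?_ h2)) h3)
      rw [abs_neg]
    have h5 := mul_nonneg (vecNorm_nonneg (S.α j)) hη
    linarith

end Model

/-! ### Bounded antiderivatives of products of cosines. -/

section Oscillation

/-- Without resonance the sum and difference frequencies are nonzero, so the product has mean zero.
-/
theorem exists_antideriv_cos_mul_cos {a b : ℝ} (hab : a ^ 2 ≠ b ^ 2) (ψ χ : ℝ) :
    ∃ (f : ℝ → ℝ) (B : ℝ), ContDiff ℝ 1 f ∧ (∀ t, |f t| ≤ B) ∧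
      ∀ t, HasDerivAt f (Real.cos (a * t + ψ) * Real.cos (b * t + χ)) t := by
  refine ⟨fun t => (a * (Real.sin (a * t + ψ) * Real.cos (b * t + χ))
    - b * (Real.cos (a * t + ψ) * Real.sin (b * t + χ))) / (a ^ 2 - b ^ 2),
    (|a| + |b|) / |a ^ 2 - b ^ 2|, by fun_prop, fun t => ?_, fun t => ?_⟩
  · rw [abs_div]
    gcongr
    refine (abs_sub _ _).trans ?_
    simp only [abs_mul]
    have h1 := Real.abs_sin_le_one (a * t + ψ)
    have h2 := Real.abs_sin_le_one (b * t + χ)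
    have h3 := Real.abs_cos_le_one (a * t + ψ)
    have h4 := Real.abs_cos_le_one (b * t + χ)
    exact add_le_add (mul_le_of_le_one_right (abs_nonneg _) (mul_le_one₀ h1 (abs_nonneg _) h4))
      (mul_le_of_le_one_right (abs_nonneg _) (mul_le_one₀ h3 (abs_nonneg _) h2))
  · have ha : HasDerivAt (fun t => a * t + ψ) a t := by
      simpa using ((hasDerivAt_id t).const_mul a).add_const ψ
    have hb : HasDerivAt (fun t => b * t + χ) b t := by
      simpa using ((hasDerivAt_id t).const_mul b).add_const χ
    have h := (((ha.sin.mul hb.cos).const_mul a).sub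
      ((ha.cos.mul hb.sin).const_mul b)).div_const (a ^ 2 - b ^ 2)
    refine h.congr_deriv ?_
    have : a ^ 2 - b ^ 2 ≠ 0 := sub_ne_zero.mpr hab
    field_simp
    ring

theorem exists_antideriv_cos_sq {a : ℝ} (ha0 : a ≠ 0) (ψ : ℝ) :
    ∃ (f : ℝ → ℝ) (B : ℝ), ContDiff ℝ 1 f ∧ (∀ t, |f t| ≤ B) ∧
      ∀ t, HasDerivAt f (Real.cos (a * t + ψ) * Real.cos (a * t + ψ) - 1 / 2) t := by
  refine ⟨fun t => (Real.sin (a * t + ψ) * Real.cos (a * t + ψ)) / (2 * a),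
    1 / |2 * a|, by fun_prop, fun t => ?_, fun t => ?_⟩
  · rw [abs_div, abs_mul]
    gcongr
    exact mul_le_one₀ (Real.abs_sin_le_one _) (abs_nonneg _) (Real.abs_cos_le_one _)
  · have ha : HasDerivAt (fun t => a * t + ψ) a t := by
      simpa using ((hasDerivAt_id t).const_mul a).add_const ψ
    refine ((ha.sin.mul ha.cos).div_const (2 * a)).congr_deriv ?_
    have := Real.sin_sq_add_cos_sq (a * t + ψ)
    field_simp
    linear_combination -this

end Oscillation

/-! ### Scalar estimates for the Lyapunov functions. -/

section Scalar

theorem young_err {g C u l Z H : ℝ} (hg : 0 < g) (hl : |l| ≤ C * (Z + H)) :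
    u * l ≤ g / 2 * u ^ 2 + C ^ 2 / g * (Z ^ 2 + H ^ 2) := by
  have h1 : l ^ 2 ≤ (C * (Z + H)) ^ 2 := by
    rw [← sq_abs l]; exact pow_le_pow_left₀ (abs_nonneg l) hl 2
  have h2 : 0 ≤ (g * u - l) ^ 2 / (2 * g) := by positivity
  have h3 : (g * u - l) ^ 2 / (2 * g) = g / 2 * u ^ 2 + l ^ 2 / (2 * g) - u * l := by
    field_simp; ring
  have h4 : l ^ 2 / (2 * g) ≤ C ^ 2 / g * (Z ^ 2 + H ^ 2) := by
    rw [div_le_iff₀ (by positivity)]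
    have : C ^ 2 / g * (Z ^ 2 + H ^ 2) * (2 * g) = 2 * C ^ 2 * (Z ^ 2 + H ^ 2) := by
      field_simp
    rw [this]
    nlinarith [mul_nonneg (sq_nonneg C) (sq_nonneg (Z - H))]
  linarith

/-- All terms with a factor A combine to A·Y. Young's inequality spends half of the decay in A on
them, and Y² is bounded by a multiple of the error on the right. -/
theorem cross_terms_le {c C σ Z H A : ℝ} (hc : 0 < c) (hC : 0 < C) :
    -(c / 2) * A ^ 2 + C * (σ * A + (Z + H) * A + A * (A * Z) + σ ^ 2 * (1 + Z)
      + A * (σ * (1 + Z))) ≤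
    -(c / 4 * A ^ 2) + (20 * C ^ 2 / c + 2 * C) *
      ((σ ^ 2 + Z ^ 2 + H ^ 2) * (1 + (A ^ 2 + Z ^ 2))) := by
  set Y := 2 * σ + Z + H + A * Z + σ * Z with hY
  set Q := (σ ^ 2 + Z ^ 2 + H ^ 2) * (1 + (A ^ 2 + Z ^ 2)) with hQ
  have h1 : C * (A * Y) ≤ c / 4 * A ^ 2 + C ^ 2 / c * Y ^ 2 := by
    have h2 : 0 ≤ (c * A - 2 * C * Y) ^ 2 / (4 * c) := by positivity
    have h3 : (c * A - 2 * C * Y) ^ 2 / (4 * c) =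
        c / 4 * A ^ 2 + C ^ 2 / c * Y ^ 2 - C * (A * Y) := by
      field_simp; ring
    linarith
  have hY2 : Y ^ 2 ≤ 20 * Q := by
    -- Cauchy–Schwarz with five summands; the factor 4 in (2σ)² then gives 20.
    have h2 : Y ^ 2 ≤ 5 * ((2 * σ) ^ 2 + Z ^ 2 + H ^ 2 + (A * Z) ^ 2 + (σ * Z) ^ 2) := by
      have := Finset.sum_mul_sq_le_sq_mul_sq Finset.univ ![1, 1, 1, 1, 1]
        ![2 * σ, Z, H, A * Z, σ * Z]
      simp [Fin.sum_univ_five] at this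
      rw [hY]
      linarith
    have h3 : (2 * σ) ^ 2 + Z ^ 2 + H ^ 2 + (A * Z) ^ 2 + (σ * Z) ^ 2 ≤ 4 * Q := by
      rw [hQ]
      nlinarith [sq_nonneg σ, sq_nonneg Z, sq_nonneg H, sq_nonneg (A * Z), sq_nonneg (σ * Z),
        sq_nonneg (A * σ), sq_nonneg (A * H), sq_nonneg (Z * H), sq_nonneg (Z * Z)]
    linarith
  have h4 : C ^ 2 / c * Y ^ 2 ≤ 20 * C ^ 2 / c * Q := by
    calc C ^ 2 / c * Y ^ 2 ≤ C ^ 2 / c * (20 * Q) := by gcongr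
      _ = _ := by ring
  have h5 : C * (σ ^ 2 * (1 + Z)) ≤ 2 * C * Q := by
    have : σ ^ 2 * (1 + Z) ≤ 2 * Q := by
      rw [hQ]
      nlinarith [sq_nonneg σ, sq_nonneg Z, sq_nonneg H, sq_nonneg (A * Z), sq_nonneg (σ * Z),
        sq_nonneg (A * σ), sq_nonneg (A * H), sq_nonneg (Z * H), sq_nonneg (Z * Z),
        mul_nonneg (sq_nonneg σ) (sq_nonneg (Z - 1))]
    nlinarith
  rw [hY] at h1
  linarith

/-- The letters stand for b = α̃·Λ(φ), e = α̃·Λ(ζ̃), l the linear input of u', q = |Wα̃|², R the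
corrector terms with α̃', and s₁, b₁ the pairings with the differentiated phases and with α̃'. The
-b² from u' cancels the +b² of the corrector, leaving -q/2 and cross terms. -/
theorem auxiliary_le {g C0 F cW A Z u s₁ b b₁ R e l η q : ℝ} (hg : 0 < g) (hC0 : 0 < C0)
    (hF : 0 < F) (hcW : 0 < cW) (hA0 : 0 ≤ A) (hZ0 : 0 ≤ Z) (b_s1 : |s₁| ≤ F * A)
    (b_b : |b| ≤ F * A) (b_b1 : |b₁| ≤ F * (|u| * (1 + Z))) (b_R : |R| ≤ F * (A * (|u| * (1 + Z))))
    (b_e : |e| ≤ A * Z) (b_l : |l| ≤ C0 * (Z + |η|)) (b_q : cW * A ^ 2 ≤ q) :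
    u * s₁ - (-(g * u) + (b + e) + l) * b - u * b₁ + b ^ 2 - 1 / 2 * q + R ≤
      -(cW / 4 * A ^ 2) + (20 * (F + g * F + C0 * F) ^ 2 / cW + 2 * (F + g * F + C0 * F)) *
        ((u ^ 2 + Z ^ 2 + η ^ 2) * (1 + (A ^ 2 + Z ^ 2))) := by
  have hD : 0 < F + g * F + C0 * F := by positivity
  have hu0 := abs_nonneg u
  have hH0 := abs_nonneg η
  have t1 : u * s₁ ≤ F * (|u| * A) := by
    refine (le_abs_self _).trans ?_
    rw [abs_mul]
    calc |u| * |s₁| ≤ |u| * (F * A) := by gcongr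
      _ = _ := by ring
  have t2 : g * u * b ≤ g * F * (|u| * A) := by
    refine (le_abs_self _).trans ?_
    rw [abs_mul, abs_mul, abs_of_pos hg]
    calc g * |u| * |b| ≤ g * |u| * (F * A) := by gcongr
      _ = _ := by ring
  have t3 : -(e * b) ≤ F * (A * (A * Z)) := by
    refine (neg_le_abs _).trans ?_
    rw [abs_mul]
    calc |e| * |b| ≤ (A * Z) * (F * A) := by gcongr
      _ = _ := by ring
  have t4 : -(l * b) ≤ C0 * F * ((Z + |η|) * A) := by
    refine (neg_le_abs _).trans ?_
    rw [abs_mul]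
    calc |l| * |b| ≤ (C0 * (Z + |η|)) * (F * A) := by gcongr
      _ = _ := by ring
  have t5 : -(u * b₁) ≤ F * (|u| ^ 2 * (1 + Z)) := by
    refine (neg_le_abs _).trans ?_
    rw [abs_mul]
    calc |u| * |b₁| ≤ |u| * (F * (|u| * (1 + Z))) := by gcongr
      _ = _ := by ring
  have t6 : R ≤ F * (A * (|u| * (1 + Z))) := (le_abs_self _).trans b_R
  have hscal := cross_terms_le (σ := |u|) (Z := Z) (H := |η|) (A := A) hcW hD
  rw [sq_abs η, sq_abs u] at hscal
  have hgF : 0 ≤ g * F := by positivity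
  have hCF : 0 ≤ C0 * F := by positivity
  have p1 : 0 ≤ |u| * A := by positivity
  have p2 : 0 ≤ (Z + |η|) * A := by positivity
  have p3 : 0 ≤ A * (A * Z) := by positivity
  have p4 : 0 ≤ u ^ 2 * (1 + Z) := by positivity
  have p5 : 0 ≤ A * (|u| * (1 + Z)) := by positivity
  rw [sq_abs] at t5
  have g1 := mul_nonneg hCF p1
  have g2 := mul_nonneg (add_nonneg hF.le hgF) p2
  have g3 := mul_nonneg (add_nonneg hgF hCF) p3
  have g4 := mul_nonneg (add_nonneg hgF hCF) p4
  have g5 := mul_nonneg (add_nonneg hgF hCF) p5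
  linarith

theorem abs_sum_mul_le {ι : Type*} [Fintype ι] {f F x : ι → ℝ} {X : ℝ} (hf : ∀ i, |f i| ≤ F i)
    (hx : ∀ i, |x i| ≤ X) : |∑ i, f i * x i| ≤ (∑ i, F i) * X := by
  rw [Finset.sum_mul]
  refine (Finset.abs_sum_le_sum_abs _ _).trans (Finset.sum_le_sum fun i _ => ?_)
  rw [abs_mul]
  exact mul_le_mul (hf i) (hx i) (abs_nonneg _) ((abs_nonneg _).trans (hf i))

theorem exists_abs_mulVec_le {m n : Type*} [Fintype m] [Fintype n] (W : Matrix m n ℝ) :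
    ∃ C, 0 < C ∧ ∀ v i, |(W *ᵥ v) i| ≤ C * vecNorm v := by
  refine ⟨∑ i, vecNorm (W i) + 1, ?_, fun v i => ?_⟩
  · have : 0 ≤ ∑ i, vecNorm (W i) := Finset.sum_nonneg fun i _ => vecNorm_nonneg _
    positivity
  · refine (abs_dotProduct_le_vecNorm (W i) v).trans
      (mul_le_mul_of_nonneg_right ?_ (vecNorm_nonneg v))
    have := Finset.single_le_sum (f := fun i => vecNorm (W i)) (fun i _ => vecNorm_nonneg _)
      (Finset.mem_univ i)
    linarith

end Scalar

theorem hasDerivAt_mul_line {E : Type*} [NormedAddCommGroup E] [NormedSpace ℝ E]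
    (p q : E →L[ℝ] ℝ) {f : ℝ → ℝ} {f' t : ℝ} (hf : HasDerivAt f f' t) (ν v : E) :
    HasDerivAt (fun h : ℝ => f (t + h) * (p (ν + h • v) * q (ν + h • v)))
      (f' * (p ν * q ν) + f t * (p v * q ν + p ν * q v)) 0 := by
  have hl : HasDerivAt (fun h : ℝ => ν + h • v) v 0 := by
    simpa using ((hasDerivAt_id (0 : ℝ)).smul_const v).const_add ν
  have hp := p.hasFDerivAt.comp_hasDerivAt (0 : ℝ) hl
  have hq := q.hasFDerivAt.comp_hasDerivAt (0 : ℝ) hl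
  have hf' : HasDerivAt (fun h : ℝ => f (t + h)) f' 0 := by
    have h0 : HasDerivAt f f' (t + 0) := by simpa using hf
    simpa using HasDerivAt.comp_const_add t 0 h0
  refine (hf'.mul (hp.mul hq)).congr_deriv ?_
  simp

/-! ### Coordinates as continuous linear functionals. -/

section Functionals

variable {s : ℕ}

/-- `η̂` as a functional. -/
def etaL : Nu s →L[ℝ] ℝ := EuclideanSpace.proj (Sum.inl ())

/-- `η̂ + R ζ̃` as a functional. -/
def errL (r : Fin (2 * s) → ℝ) : Nu s →L[ℝ] ℝ :=
  etaL + ∑ i, rowR r i • EuclideanSpace.proj (Sum.inr (Sum.inl i))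

/-- A combination of the entries of `ζ̃` other than the last as a functional. -/
def zL (c : Fin (2 * s) → ℝ) : Nu s →L[ℝ] ℝ :=
  ∑ i, c i • EuclideanSpace.proj (Sum.inr (Sum.inl i.castSucc))

/-- A combination of the entries of `α̃` as a functional. -/
def alphaL (c : Fin s → ℝ) : Nu s →L[ℝ] ℝ :=
  ∑ k, c k • EuclideanSpace.proj (Sum.inr (Sum.inr k))

theorem etaL_apply (ν : Nu s) : etaL ν = etaOf ν := rfl

theorem errL_apply (r : Fin (2 * s) → ℝ) (ν : Nu s) : errL r ν = errOf r ν := by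
  simp [errL, errOf, etaL_apply, dotProduct, zetaOf]

theorem zL_apply (c : Fin (2 * s) → ℝ) (ν : Nu s) : zL c ν = c ⬝ᵥ zOf ν := by
  simp [zL, dotProduct, zOf, zetaOf]

theorem alphaL_apply (c : Fin s → ℝ) (ν : Nu s) : alphaL c ν = c ⬝ᵥ alphaOf ν := by
  simp [alphaL, dotProduct, alphaOf]

end Functionals

/-! ### Weak and auxiliary Lyapunov functions of the internal model. -/

namespace Model

variable {V : Type*} [Fintype V] (S : Model V) (j : V)

/-- A weak Lyapunov function: its derivative is negative in all coordinates but `α̃`. -/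
theorem exists_weak_lyapunov : ∃ (W₀ : ℝ → Nu (S.s j) → ℝ) (c₀ m : ℝ), IsTVQuad W₀ ∧ 0 < c₀ ∧
    0 < m ∧ (∀ t ν, c₀ * ‖ν‖ ^ 2 ≤ W₀ t ν) ∧
    ∀ t ν, deriv (fun τ => W₀ τ ν) t + fderiv ℝ (fun v => W₀ t v) ν (S.nuField j t ν 0 0) ≤
      -(m * (errOf (S.r j) ν ^ 2 + vecNorm (zOf ν) ^ 2 + etaOf ν ^ 2)) := by
  obtain ⟨A, ε, C, hε, hC, hlow, hder⟩ := exists_hurwitz_form (S.r j) (S.r_hurwitz j)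
  obtain ⟨C0, hC0, herr⟩ := S.exists_abs_errInput_le j
  have hg := S.g_pos
  have hk := S.kα_pos
  -- `C1` makes the decay in z exceed the Young penalty by one; `C2` does the same for η̂, including
  -- its forcing of z.
  set C1 : ℝ := (C0 ^ 2 / S.g + 1) / ε with hC1
  set C2 : ℝ := (C0 ^ 2 / S.g + 1 + C1 * C) / 2 with hC2
  have hC1p : 0 < C1 := by positivity
  have hC2p : 0 < C2 := by positivity
  set W₀ : ℝ → Nu (S.s j) → ℝ := fun _ ν => (1 / 2 * (errL (S.r j) ν * errL (S.r j) ν)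
    + ∑ k, 1 / (2 * S.kα) * (alphaL (Pi.single k 1) ν * alphaL (Pi.single k 1) ν))
    + (∑ i, C1 * (zL (A i) ν * zL (A i) ν) + C2 * (etaL ν * etaL ν)) with hW
  have hq : IsTVQuad W₀ :=
    ((isTVQuad_const_mul _ _ _).add (IsTVQuad.sum _ fun _ _ => isTVQuad_const_mul _ _ _)).add
      ((IsTVQuad.sum _ fun _ _ => isTVQuad_const_mul _ _ _).add (isTVQuad_const_mul _ _ _))
  have hval : ∀ t ν, W₀ t ν = 1 / 2 * errOf (S.r j) ν ^ 2
      + 1 / (2 * S.kα) * vecNorm (alphaOf ν) ^ 2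
      + (C1 * ((A *ᵥ zOf ν) ⬝ᵥ (A *ᵥ zOf ν)) + C2 * etaOf ν ^ 2) := by
    intro t ν
    rw [← dotProduct_self_eq_vecNorm_sq]
    simp only [hW, errL_apply, alphaL_apply, zL_apply, etaL_apply, single_one_dotProduct,
      ← Finset.mul_sum, sq]
    rfl
  set m0 : ℝ := min (min (1 / 2) (1 / (2 * S.kα))) (min (C1 * ε) C2) with hm0
  have hm0p : 0 < m0 := by positivity
  have hcr : 0 < 4 + 3 * vecNorm (S.r j) ^ 2 := by positivity
  refine ⟨W₀, m0 / (4 + 3 * vecNorm (S.r j) ^ 2), min (S.g / 2) 1, hq, by positivity,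
    by positivity, fun t ν => ?_, fun t ν => ?_⟩
  · rw [hval t ν, div_mul_eq_mul_div, div_le_iff₀ hcr]
    have h1 := norm_sq_nu_le (S.r j) ν
    have h2 := mul_le_mul_of_nonneg_left h1 hm0p.le
    have h3 := mul_le_mul_of_nonneg_left (hlow (zOf ν)) hC1p.le
    rw [dotProduct_self_eq_vecNorm_sq] at h3
    have e1 : m0 * errOf (S.r j) ν ^ 2 ≤ 1 / 2 * errOf (S.r j) ν ^ 2 := by
      gcongr; exact (min_le_left _ _).trans (min_le_left _ _)
    have e2 : m0 * vecNorm (alphaOf ν) ^ 2 ≤ 1 / (2 * S.kα) * vecNorm (alphaOf ν) ^ 2 := by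
      gcongr; exact (min_le_left _ _).trans (min_le_right _ _)
    have e3 : m0 * vecNorm (zOf ν) ^ 2 ≤ C1 * ε * vecNorm (zOf ν) ^ 2 := by
      gcongr; exact (min_le_right _ _).trans (min_le_left _ _)
    have e4 : m0 * etaOf ν ^ 2 ≤ C2 * etaOf ν ^ 2 := by
      gcongr; exact (min_le_right _ _).trans (min_le_right _ _)
    refine h2.trans ?_
    rw [← mul_assoc, mul_comm m0, mul_assoc, mul_comm]
    refine mul_le_mul_of_nonneg_right ?_ hcr.le
    linarith
  · set f := S.nuField j t ν 0 0 with hf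
    have hD : HasDerivAt (fun h : ℝ => W₀ (t + h) (ν + h • f))
        (errOf (S.r j) ν * errOf (S.r j) f + 1 / S.kα * (alphaOf ν ⬝ᵥ alphaOf f)
          + (C1 * (2 * ((A *ᵥ zOf ν) ⬝ᵥ (A *ᵥ zOf f))) + 2 * C2 * (etaOf ν * etaOf f))) 0 := by
      have hterm : ∀ (c : ℝ) (p : Nu (S.s j) →L[ℝ] ℝ),
          HasDerivAt (fun h : ℝ => c * (p (ν + h • f) * p (ν + h • f))) (2 * c * (p ν * p f)) 0 :=
        fun c p => (hasDerivAt_mul_line p p (hasDerivAt_const t c) ν f).congr_deriv (by ring)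
      have h := ((hterm (1 / 2) (errL (S.r j))).add
        (HasDerivAt.fun_sum (u := Finset.univ) fun k _ =>
          hterm (1 / (2 * S.kα)) (alphaL (Pi.single k 1)))).add
        ((HasDerivAt.fun_sum (u := Finset.univ) fun i _ => hterm C1 (zL (A i))).add
          (hterm C2 etaL))
      refine h.congr_deriv ?_
      simp only [errL_apply, alphaL_apply, zL_apply, etaL_apply, single_one_dotProduct,
        ← Finset.mul_sum]
      have hkk : 2 * (1 / (2 * S.kα)) = 1 / S.kα := by field_simp
      rw [hkk]
      change _ + 1 / S.kα * (alphaOf ν ⬝ᵥ alphaOf f)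
        + (2 * C1 * ((A *ᵥ zOf ν) ⬝ᵥ (A *ᵥ zOf f)) + _) = _
      ring
    have hline := hasDerivAt_line (W := W₀) f (hq.1.differentiable one_ne_zero (t, ν))
    rw [hline.unique hD, hf, S.errOf_nuField, S.etaOf_nuField, S.alphaOf_nuField, dotProduct_smul,
      smul_eq_mul]
    have h1 := hder (zOf ν) (zOf f) (etaOf ν) (S.zOf_nuField_of_lt j t ν)
      (S.zOf_nuField_last j t ν)
    rw [dotProduct_self_eq_vecNorm_sq] at h1
    have h2 := young_err (u := errOf (S.r j) ν) hg (herr t ν)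
    rw [sq_abs] at h2
    have h3 := mul_le_mul_of_nonneg_left h1 hC1p.le
    have h4 : C1 * ε = C0 ^ 2 / S.g + 1 := by rw [hC1]; field_simp
    have h5 : 2 * C2 = C0 ^ 2 / S.g + 1 + C1 * C := by rw [hC2]; ring
    -- The weight 1/(2kα) makes the adaptation term the exact negative of the cross term in u u'.
    have h6 : 1 / S.kα * (-(S.kα * errOf (S.r j) ν)
        * (alphaOf ν ⬝ᵥ vecLam (zetaOf ν + S.phi j t))) =
        -(errOf (S.r j) ν * (alphaOf ν ⬝ᵥ vecLam (zetaOf ν + S.phi j t))) := by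
      field_simp
    rw [h6]
    have h7 : C1 * (-ε * vecNorm (zOf ν) ^ 2 + C * etaOf ν ^ 2) =
        -((C0 ^ 2 / S.g + 1) * vecNorm (zOf ν) ^ 2) + C1 * C * etaOf ν ^ 2 := by
      rw [← h4]; ring
    have h8 : 2 * C2 * (etaOf ν * -etaOf ν) =
        -((C0 ^ 2 / S.g + 1 + C1 * C) * etaOf ν ^ 2) := by rw [h5]; ring
    rw [h7] at h3
    rw [h8]
    have e1 : min (S.g / 2) 1 * errOf (S.r j) ν ^ 2 ≤ S.g / 2 * errOf (S.r j) ν ^ 2 := by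
      gcongr; exact min_le_left _ _
    have e2 : min (S.g / 2) 1 * (vecNorm (zOf ν) ^ 2 + etaOf ν ^ 2) ≤
        1 * (vecNorm (zOf ν) ^ 2 + etaOf ν ^ 2) := by
      gcongr; exact min_le_right _ _
    linarith

theorem exists_antideriv_cos_mul_cos_freq (χ : Fin (S.s j) → ℝ) (l m : Fin (S.s j)) :
    ∃ (f : ℝ → ℝ) (B : ℝ), ContDiff ℝ 1 f ∧ (∀ t, |f t| ≤ B) ∧
      ∀ t, HasDerivAt f (Real.cos (S.freq j l * t + χ l) * Real.cos (S.freq j m * t + χ m)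
        - if l = m then 1 / 2 else 0) t := by
  by_cases hlm : l = m
  · subst hlm
    simpa using exists_antideriv_cos_sq (S.freq_pos j l).ne' (χ l)
  · have hne : S.freq j l ^ 2 ≠ S.freq j m ^ 2 := by
      rw [Ne, sq_eq_sq₀ (S.freq_pos j l).le (S.freq_pos j m).le]
      exact fun h => hlm (S.freq_inj j h)
    simpa [hlm] using exists_antideriv_cos_mul_cos hne (χ l) (χ m)

/-- Minus the product of error and regression term, plus a quadratic form in `α̃` with oscillating
coefficients. -/
def auxFun (W : Matrix (Fin (S.s j)) (Fin (S.s j)) ℝ) (χ : Fin (S.s j) → ℝ)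
    (ψ : Fin (S.s j) → Fin (S.s j) → ℝ → ℝ) (t : ℝ) (ν : Nu (S.s j)) : ℝ :=
  (∑ l, -Real.cos (S.freq j l * t + χ l) * (errL (S.r j) ν * alphaL (W l) ν))
    + ∑ l, ∑ m, ψ l m t * (alphaL (W l) ν * alphaL (W m) ν)

variable {j} in
theorem isTVQuad_auxFun (W : Matrix (Fin (S.s j)) (Fin (S.s j)) ℝ) (χ : Fin (S.s j) → ℝ)
    {ψ : Fin (S.s j) → Fin (S.s j) → ℝ → ℝ} {B : Fin (S.s j) → Fin (S.s j) → ℝ}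
    (hψC : ∀ l m, ContDiff ℝ 1 (ψ l m)) (hψB : ∀ l m t, |ψ l m t| ≤ B l m) :
    IsTVQuad (S.auxFun j W χ ψ) := by
  refine (IsTVQuad.sum _ fun l _ => isTVQuad_mul
    (f := fun t => -Real.cos (S.freq j l * t + χ l)) (by fun_prop) (B := 1)
    (fun t => ?_) _ _).add
    (IsTVQuad.sum _ fun l _ => IsTVQuad.sum _ fun m _ => isTVQuad_mul (hψC l m) (hψB l m) _ _)
  rw [abs_neg]
  exact Real.abs_cos_le_one _

-- The derivatives of ψ are the products of cosines minus their means. Summed against the entries of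
-- Wα̃ they give (α̃·Λ(φ))² - ½|Wα̃|².
variable {j} in
theorem hasDerivAt_auxFun_line (W : Matrix (Fin (S.s j)) (Fin (S.s j)) ℝ) (χ : Fin (S.s j) → ℝ)
    {ψ : Fin (S.s j) → Fin (S.s j) → ℝ → ℝ}
    (hψD : ∀ l m t, HasDerivAt (ψ l m)
      (Real.cos (S.freq j l * t + χ l) * Real.cos (S.freq j m * t + χ m)
        - if l = m then 1 / 2 else 0) t) (t : ℝ) (ν f : Nu (S.s j)) :
    HasDerivAt (fun h : ℝ => S.auxFun j W χ ψ (t + h) (ν + h • f))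
      (errOf (S.r j) ν * (∑ l, (S.freq j l * Real.sin (S.freq j l * t + χ l))
          * (W *ᵥ alphaOf ν) l)
        - errOf (S.r j) f * (∑ l, Real.cos (S.freq j l * t + χ l) * (W *ᵥ alphaOf ν) l)
        - errOf (S.r j) ν * (∑ l, Real.cos (S.freq j l * t + χ l) * (W *ᵥ alphaOf f) l)
        + (∑ l, Real.cos (S.freq j l * t + χ l) * (W *ᵥ alphaOf ν) l) ^ 2
        - 1 / 2 * ((W *ᵥ alphaOf ν) ⬝ᵥ (W *ᵥ alphaOf ν))
        + ∑ l, ∑ m, ψ l m t * ((W *ᵥ alphaOf f) l * (W *ᵥ alphaOf ν) m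
          + (W *ᵥ alphaOf ν) l * (W *ᵥ alphaOf f) m)) 0 := by
  have hc : ∀ l, HasDerivAt (fun t => -Real.cos (S.freq j l * t + χ l))
      (S.freq j l * Real.sin (S.freq j l * t + χ l)) t := fun l => by
    have h1 : HasDerivAt (fun t => S.freq j l * t + χ l) (S.freq j l) t := by
      simpa using ((hasDerivAt_id t).const_mul (S.freq j l)).add_const (χ l)
    refine h1.cos.neg.congr_deriv ?_
    ring
  have h := (HasDerivAt.fun_sum (u := Finset.univ) fun l _ =>
      hasDerivAt_mul_line (errL (S.r j)) (alphaL (W l)) (hc l) ν f).add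
    (HasDerivAt.fun_sum (u := Finset.univ) fun l _ =>
      HasDerivAt.fun_sum (u := Finset.univ) fun m _ =>
        hasDerivAt_mul_line (alphaL (W l)) (alphaL (W m)) (hψD l m t) ν f)
  refine h.congr_deriv ?_
  have hβ : ∀ (l : Fin (S.s j)) (v : Nu (S.s j)), W l ⬝ᵥ alphaOf v = (W *ᵥ alphaOf v) l :=
    fun _ _ => rfl
  simp only [errL_apply, alphaL_apply, hβ]
  generalize W *ᵥ alphaOf ν = β
  generalize W *ᵥ alphaOf f = β'
  generalize errOf (S.r j) ν = u
  generalize errOf (S.r j) f = u'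
  have h1 : ∑ l, ∑ m, (Real.cos (S.freq j l * t + χ l) * Real.cos (S.freq j m * t + χ m)
      - if l = m then 1 / 2 else 0) * (β l * β m) =
      (∑ l, Real.cos (S.freq j l * t + χ l) * β l) ^ 2 - 1 / 2 * (β ⬝ᵥ β) := by
    simp only [sub_mul, Finset.sum_sub_distrib, ite_mul, zero_mul, Finset.sum_ite_eq,
      Finset.mem_univ, if_true]
    rw [sq, Finset.sum_mul_sum, dotProduct, Finset.mul_sum]
    congr 1
    exact Finset.sum_congr rfl fun l _ => Finset.sum_congr rfl fun m _ => by ring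
  have h2 : ∑ l, -Real.cos (S.freq j l * t + χ l) * (u' * β l + u * β' l) =
      -(∑ l, u' * (Real.cos (S.freq j l * t + χ l) * β l))
        - ∑ l, u * (Real.cos (S.freq j l * t + χ l) * β' l) := by
    rw [← Finset.sum_neg_distrib, ← Finset.sum_sub_distrib]
    exact Finset.sum_congr rfl fun l _ => by ring
  have h3 : ∑ l, S.freq j l * Real.sin (S.freq j l * t + χ l) * (u * β l) =
      ∑ l, u * (S.freq j l * Real.sin (S.freq j l * t + χ l) * β l) :=
    Finset.sum_congr rfl fun l _ => by ring
  simp only [Finset.sum_add_distrib]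
  rw [h1, h2, h3, Finset.mul_sum, Finset.mul_sum, Finset.mul_sum]
  ring

/-- An auxiliary function whose derivative is negative in `α̃`: the regressor is persistently
exciting. -/
theorem exists_auxiliary_lyapunov : ∃ (W₁ : ℝ → Nu (S.s j) → ℝ) (c C : ℝ), IsTVQuad W₁ ∧ 0 < c ∧
    0 < C ∧ ∀ t ν, deriv (fun τ => W₁ τ ν) t
      + fderiv ℝ (fun v => W₁ t v) ν (S.nuField j t ν 0 0) ≤
      -(c * vecNorm (alphaOf ν) ^ 2)
        + C * ((errOf (S.r j) ν ^ 2 + vecNorm (zOf ν) ^ 2 + etaOf ν ^ 2) * (1 + ‖ν‖ ^ 2)) := by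
  obtain ⟨W, χ, hWinj, hφW⟩ := S.exists_vecLam_phi_eq j
  obtain ⟨cW, hcW, hWlow⟩ := exists_mul_dotProduct_le_mulVec W hWinj
  obtain ⟨K, hK, hWup⟩ := exists_abs_mulVec_le W
  obtain ⟨C0, hC0, herr⟩ := S.exists_abs_errInput_le j
  obtain ⟨Φ, hΦ⟩ := S.exists_vecNorm_phi_le j
  have hΦ0 : 0 ≤ Φ := (vecNorm_nonneg _).trans (hΦ 0)
  have hg := S.g_pos
  have hk := S.kα_pos
  choose ψ B hψC hψB hψD using S.exists_antideriv_cos_mul_cos_freq j χ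
  have hq := S.isTVQuad_auxFun W χ hψC hψB
  -- One constant serves all four bounds required by `auxiliary_le`.
  obtain ⟨F, hFp, hF1, hF2, hF3, hF4⟩ : ∃ F : ℝ, 0 < F ∧ (∑ l, S.freq j l) * K ≤ F ∧
      (∑ _l : Fin (S.s j), (1 : ℝ)) * K ≤ F ∧
      (∑ _l : Fin (S.s j), (1 : ℝ)) * (K * (S.kα * (1 + Φ))) ≤ F ∧
      (∑ l, ∑ m, B l m) * (2 * (K * (K * (S.kα * (1 + Φ))))) ≤ F := by
    refine ⟨max (max ((∑ l, S.freq j l) * K) ((∑ _l : Fin (S.s j), (1 : ℝ)) * K))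
      (max (max ((∑ _l : Fin (S.s j), (1 : ℝ)) * (K * (S.kα * (1 + Φ)))) 1)
        ((∑ l, ∑ m, B l m) * (2 * (K * (K * (S.kα * (1 + Φ))))))), ?_, ?_, ?_, ?_, ?_⟩
    · exact one_pos.trans_le ((le_max_right _ _).trans ((le_max_left _ _).trans (le_max_right _ _)))
    · exact (le_max_left _ _).trans (le_max_left _ _)
    · exact (le_max_right _ _).trans (le_max_left _ _)
    · exact (le_max_left _ _).trans ((le_max_left _ _).trans (le_max_right _ _))
    · exact (le_max_right _ _).trans (le_max_right _ _)
  refine ⟨S.auxFun j W χ ψ, cW / 4,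
    20 * (F + S.g * F + C0 * F) ^ 2 / cW + 2 * (F + S.g * F + C0 * F), hq, by positivity,
    by positivity, fun t ν => ?_⟩
  have hline := hasDerivAt_line (W := S.auxFun j W χ ψ) (S.nuField j t ν 0 0)
    (hq.1.differentiable one_ne_zero (t, ν))
  rw [hline.unique (S.hasDerivAt_auxFun_line W χ hψD t ν _)]
  have hbφ : alphaOf ν ⬝ᵥ vecLam (S.phi j t) =
      ∑ l, Real.cos (S.freq j l * t + χ l) * (W *ᵥ alphaOf ν) l := by
    simp only [dotProduct, hφW, mulVec, Finset.mul_sum]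
    rw [Finset.sum_comm]
    exact Finset.sum_congr rfl fun l _ => Finset.sum_congr rfl fun k _ => by ring
  have hΛ : vecLam (zetaOf ν + S.phi j t) = vecLam (zetaOf ν) + vecLam (S.phi j t) := rfl
  have hZ0 : 0 ≤ vecNorm (zOf ν) := vecNorm_nonneg _
  have hβu : ∀ l, |(W *ᵥ alphaOf ν) l| ≤ K * vecNorm (alphaOf ν) := fun l => hWup _ l
  have hβ'u : ∀ l, |(W *ᵥ alphaOf (S.nuField j t ν 0 0)) l| ≤
      K * (S.kα * (1 + Φ)) * (|errOf (S.r j) ν| * (1 + vecNorm (zOf ν))) := by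
    intro l
    refine (hWup _ l).trans ?_
    rw [mul_assoc]
    refine mul_le_mul_of_nonneg_left ?_ hK.le
    rw [S.alphaOf_nuField, vecNorm_smul, abs_neg, abs_mul, abs_of_pos hk]
    have h1 : vecNorm (vecLam (zetaOf ν + S.phi j t)) ≤ vecNorm (zOf ν) + Φ := by
      rw [hΛ]
      exact (vecNorm_add_le _ _).trans (add_le_add (S.vecNorm_vecLam_zetaOf_le j ν)
        ((vecNorm_vecLam_le _).trans (hΦ t)))
    have h2 : vecNorm (zOf ν) + Φ ≤ (1 + Φ) * (1 + vecNorm (zOf ν)) := by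
      nlinarith [mul_nonneg hΦ0 hZ0]
    calc S.kα * |errOf (S.r j) ν| * vecNorm (vecLam (zetaOf ν + S.phi j t))
        ≤ S.kα * |errOf (S.r j) ν| * ((1 + Φ) * (1 + vecNorm (zOf ν))) := by
          gcongr; exact h1.trans h2
      _ = _ := by ring
  have b_ββ := hWlow (alphaOf ν)
  rw [dotProduct_self_eq_vecNorm_sq] at b_ββ
  have herrf := S.errOf_nuField j t ν
  rw [hΛ, dotProduct_add, add_comm (alphaOf ν ⬝ᵥ vecLam (zetaOf ν)), hbφ] at herrf
  rw [herrf]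
  have hcos := fun l => Real.abs_cos_le_one (S.freq j l * t + χ l)
  have hA0 : 0 ≤ vecNorm (alphaOf ν) := vecNorm_nonneg _
  have hu0 := abs_nonneg (errOf (S.r j) ν)
  refine (auxiliary_le hg hC0 hFp hcW hA0 hZ0 ?_ ?_ ?_ ?_ ?_ (herr t ν) b_ββ).trans ?_
  · refine (abs_sum_mul_le (F := S.freq j) (fun l => ?_) hβu).trans ?_
    · rw [abs_mul, abs_of_pos (S.freq_pos j l)]
      exact mul_le_of_le_one_right (S.freq_pos j l).le (Real.abs_sin_le_one _)
    · rw [← mul_assoc]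
      gcongr
  · refine (abs_sum_mul_le (F := fun _ => 1) hcos hβu).trans ?_
    rw [← mul_assoc]
    gcongr
  · refine (abs_sum_mul_le (F := fun _ => 1) hcos hβ'u).trans ?_
    rw [← mul_assoc]
    gcongr
  · refine (Finset.abs_sum_le_sum_abs _ _).trans ((Finset.sum_le_sum fun l _ =>
      abs_sum_mul_le (F := B l) (X := 2 * (K * (K * (S.kα * (1 + Φ)))) * (vecNorm (alphaOf ν)
        * (|errOf (S.r j) ν| * (1 + vecNorm (zOf ν))))) (fun m => hψB l m t) fun m => ?_).trans ?_)
    · refine (abs_add_le _ _).trans ?_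
      rw [abs_mul, abs_mul]
      have e1 := mul_le_mul (hβ'u l) (hβu m) (abs_nonneg _) ((abs_nonneg _).trans (hβ'u l))
      have e2 := mul_le_mul (hβu l) (hβ'u m) (abs_nonneg _) ((abs_nonneg _).trans (hβu l))
      linarith
    · rw [← Finset.sum_mul, ← mul_assoc]
      gcongr
  · exact (abs_dotProduct_le_vecNorm _ _).trans
      (mul_le_mul_of_nonneg_left (S.vecNorm_vecLam_zetaOf_le j ν) hA0)
  · gcongr
    exact vecNorm_zOf_sq_add_alphaOf_sq_le ν

theorem exists_isLyapunov : ∃ (U : ∀ j, ℝ → Nu (S.s j) → ℝ) (b : V → ℝ), S.IsLyapunov U b := by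
  have h : ∀ j, ∃ (U : ℝ → Nu (S.s j) → ℝ) (b : ℝ), 0 < b ∧
      ContDiff ℝ 1 (fun p : ℝ × Nu (S.s j) => U p.1 p.2) ∧
      (∃ Ulow Uup : Nu (S.s j) → ℝ, IsPosDefRadUnbdd Ulow ∧ IsPosDefRadUnbdd Uup ∧
        ∀ t, 0 ≤ t → ∀ ν, Ulow ν ≤ U t ν ∧ U t ν ≤ Uup ν) ∧
      (∀ t, 0 ≤ t → ∀ ν, deriv (fun τ => U τ ν) t
        + fderiv ℝ (fun v => U t v) ν (S.nuField j t ν 0 0) ≤ -‖ν‖ ^ 2) ∧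
      (∀ t, 0 ≤ t → ∀ ν, ‖fderiv ℝ (fun v => U t v) ν‖ ≤ b * (‖ν‖ + ‖ν‖ ^ 3)) := by
    intro j
    obtain ⟨W₀, c₀, m, hq₀, hc₀, hm, hlow, hD₀⟩ := S.exists_weak_lyapunov j
    obtain ⟨W₁, c, C, hq₁, hc, hC, hD₁⟩ := S.exists_auxiliary_lyapunov j
    have hcr : 0 < 4 + 3 * vecNorm (S.r j) ^ 2 := by positivity
    refine exists_strict_lyapunov (F := fun t ν => S.nuField j t ν 0 0) hq₀ hq₁
      (P := fun ν => errOf (S.r j) ν ^ 2 + vecNorm (zOf ν) ^ 2 + etaOf ν ^ 2)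
      (A := fun ν => vecNorm (alphaOf ν) ^ 2) (fun ν => by positivity) hc₀ hm hC
      (c₁ := min 1 c / (4 + 3 * vecNorm (S.r j) ^ 2)) (by positivity) hlow hD₀ hD₁ fun ν => ?_
    -- P covers u, z and η̂, and the auxiliary decay covers α̃; together they control ‖ν‖² by the
    -- change of coordinates.
    rw [div_mul_eq_mul_div, div_le_iff₀ hcr]
    have h1 := mul_le_mul_of_nonneg_left (norm_sq_nu_le (S.r j) ν)
      (by positivity : 0 ≤ min 1 c)
    refine h1.trans ?_
    rw [← mul_assoc, mul_comm (min 1 c), mul_assoc, mul_comm]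
    refine mul_le_mul_of_nonneg_right ?_ hcr.le
    rw [mul_add]
    refine add_le_add ?_ ?_
    · exact mul_le_of_le_one_left (by positivity) (min_le_left _ _)
    · gcongr
      exact min_le_right _ _
  choose U b hU using h
  exact ⟨U, b, hU⟩

end Model

end FreqControl

end

/-! ### The theorem. -/

open FreqControl in
theorem mainTheorem4 {V : Type*} [Fintype V] [DecidableEq V] (S : Model V)
    [DecidableRel S.comm.Adj] :
    -- the Lyapunov functions of the internal-model subsystems exist
    (∃ (U : ∀ j, ℝ → Nu (S.s j) → ℝ) (b : V → ℝ), S.IsLyapunov U b) ∧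
    ∀ (U : ∀ j, ℝ → Nu (S.s j) → ℝ) (b : V → ℝ), S.IsLyapunov U b → ∀ ctil : ℝ, 0 < ctil →
      -- admissible constants exist (they do not involve the gains `d`)
      (∃ cbar phibar c2 c3 : ℝ, S.Constants U b ctil cbar phibar c2 c3) ∧
      ∀ cbar phibar c2 c3 : ℝ, S.Constants U b ctil cbar phibar c2 c3 →
      ∀ d : V → ℝ, S.GainAssumption d c3 →
        0 < S.gain d c3 ∧ S.gain d c3 < 1 ∧
        ∀ xs : S.State, S.IsEquilibrium d xs →
          -- differential dissipation inequality in the region, for all disturbance values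
          (∀ t, 0 ≤ t → ∀ (x : S.State) (w : V → ℝ), S.V2 U t x.2.2.2 ≤ ctil →
            S.derivAlong d (S.storage U c3 xs) t x w ≤
                -(1 / (4 * c3 ^ 2)) * (∑ j, ‖x.2.2.2 j‖ ^ 2)
                - 1 / (2 * c3 ^ 2) * ((x.2.2.1 - xs.2.2.1) ⬝ᵥ
                    (S.comm.lapMatrix ℝ *ᵥ (x.2.2.1 - xs.2.2.1)))
                - 1 / (2 * c3 ^ 2) * (∑ j, (S.D j + d j - Model.kappa c3) * (x.2.1 j) ^ 2)
                + (∑ j, w j ^ 2) ∧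
            S.derivAlong d (S.storage U c3 xs) t x w ≤
              (∑ j, w j ^ 2) - (S.gain d c3)⁻¹ * ∑ j, (x.2.1 j) ^ 2) ∧
          ∀ w : V → ℝ → ℝ,
            (∀ j, ∀ T : ℝ, 0 < T → MemLp (w j) 2 (volume.restrict (Set.Ioc 0 T))) →
            ∀ T : ℝ, 0 < T → ∀ x : ℝ → S.State, S.IsTrajectory d w T x →
              -- a trajectory that starts in the region with a small energy budget stays in it
              (c3 ^ 2 * (S.storage U c3 xs 0 (x 0) + ∫ t in (0 : ℝ)..T, ∑ j, w j t ^ 2) < ctil →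
                ∀ t ∈ Set.Icc 0 T, S.V2 U t (x t).2.2.2 ≤ ctil) ∧
              -- along trajectories in the region: dissipation and the bound on the `L₂`-gain
              ((∀ t ∈ Set.Icc 0 T, S.V2 U t (x t).2.2.2 ≤ ctil) →
                (∀ t₁ t₂ : ℝ, 0 ≤ t₁ → t₁ ≤ t₂ → t₂ ≤ T →
                  S.storage U c3 xs t₂ (x t₂) - S.storage U c3 xs t₁ (x t₁) ≤
                    ∫ t in t₁..t₂, ((∑ j, w j t ^ 2)
                      - (S.gain d c3)⁻¹ * ∑ j, ((x t).2.1 j) ^ 2)) ∧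
                (∫ t in (0 : ℝ)..T, ∑ j, ((x t).2.1 j) ^ 2) ≤
                  S.gain d c3 * (∫ t in (0 : ℝ)..T, ∑ j, w j t ^ 2)
                    + S.gain d c3 * S.storage U c3 xs 0 (x 0) ∧
                (x 0 = xs →
                  (∫ t in (0 : ℝ)..T, ∑ j, ((x t).2.1 j) ^ 2) ≤
                    S.gain d c3 * ∫ t in (0 : ℝ)..T, ∑ j, w j t ^ 2)) := by
  refine ⟨S.exists_isLyapunov, fun U b hU ctil _ =>
    ⟨hU.exists_constants S.exists_vecNorm_phi_le, fun cbar phibar c2 c3 hc d hd => ?_⟩⟩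
  have h1 := hd.one_lt_inv_gain hc.c3_gt_one
  have hg : 0 < S.gain d c3 := inv_pos.mp (zero_lt_one.trans h1)
  refine ⟨hg, (one_lt_inv₀ hg).mp h1, fun xs h => ⟨fun t ht x w hx =>
    ⟨h.derivAlong_storage_le hU hc hd ht w hx, h.derivAlong_storage_le_gain hU hc hd ht w hx⟩,
    fun w hw T hT x hx => ⟨fun hlt => hx.V2_le h hU hc hd hT (fun j => hw j T hT) hlt,
      fun hreg => ?_⟩⟩⟩
  have h2 := hx.integral_omega_le h hU hc hd hT (fun j => hw j T hT) hreg
  refine ⟨fun t₁ t₂ h1 h12 h2 => hx.storage_sub_le h hU hc hd hT (fun j => hw j T hT) h1 h12 h2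
    (fun t ht => hreg t ⟨h1.trans ht.1, ht.2.trans h2⟩), h2, fun h0 => ?_⟩
  -- The storage vanishes at an equilibrium because ν = 0 there and `U` is zero at ν = 0.
  rwa [h0, h.storage_self hU, mul_zero, add_zero] at h2
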